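/- All curves are over $\mathbb{C}$. A plane curve of degree $d$ is a curve $C\subset\mathbb{P}^2_{\mathbb{C}}$ defined by an irreducible form of degree $d$. It is rational if its normalization is isomorphic to $\mathbb{P}^1$, and unicuspidal if it has exactly one singular point $p$ (the cusp) and is analytically locally irreducible at $p$. Near $p$, in suitable local analytic coordinates, $C$ is then parametrized by $(t^a,\ c_1t^{b_1}+c_2t^{b_2}+\cdots)$ with $1<a<b_1<b_2<\cdots$, all $c_i\neq 0$, $a\nmid b_1$ and $\gcd(a,b_1,b_2,\dots)=1$. Put $g_0=a$, $\beta_0=0$ and, as long as $g_{j-1}>1$, let $\beta_j$ be the least exponent $b_i$ not divisible by $g_{j-1}$ and $g_j=\gcd(g_{j-1},\beta_j)$. The Newton pairs of the cusp are the pairs $\left(\frac{g_{j-1}}{g_j},\frac{\beta_j-\beta_{j-1}}{g_j}\right)$, $j=1,2,\dots$. An ordered factorization of $d$ is a finite sequence $(n_1,\dots,n_r)$ of integers $n_i\ge 2$ with $n_1\cdots n_r=d$. **Theorem.** Let $d>1$ be an integer. To every ordered factorization $\mathbf n=(n_1,\dots,n_r)$ of $d$ one can attach a rational plane curve $C_{\mathbf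 n}$ of degree $d$ such that $C_{\mathbf m}$ and $C_{\mathbf n}$ are not isomorphic (as abstract curves over $\mathbb{C}$) whenever $\mathbf m\neq\mathbf n$, and such that: * if $d>2$, then every $C_{\mathbf n}$ is unicuspidal, the tangent line to $C_{\mathbf n}$ at the cusp meets $C_{\mathbf n}$ only at the cusp (that is, $C_{\mathbf n}$ is an Abhyankar–Moh–Suzuki curve), and the Newton pairs of the cusp are $$(n_1-1,n_1),\ (n_2,n_1n_2-1),\ (n_3,n_2n_3-1),\ \dots,\ (n_r,n_{r-1}n_r-1)\qquad\text{if } n_1>2,$$ $$(n_2,4n_2-1),\ (n_3,n_2n_3-1),\ \dots,\ (n_r,n_{r-1}n_r-1)\qquad\text{if } n_1=2;$$ these lists of pairs are different for different ordered factorizations of $d$; * if $d=2$, where $(2)$ is the only ordered factorization, the curve is a smooth conic. In particular, for every $d>2$ there are at least as many pairwise non-isomorphic rational unicuspidal plane curves of degree $d$ as there are ordered factorizations of $d$; for $d=2$ the same holds if the smooth conic is counted as a (degenerate) unicuspidal curve. -/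

import Mathlib

open scoped LinearAlgebra.Projectivization

noncomputable section

/-- The complex projective plane (its set of closed points). -/
abbrev P2 : Type := ℙ ℂ (Fin 3 → ℂ)

/-- An (integral) plane curve of degree `d` over `ℂ`, given by an irreducible form of degree `d`. -/
structure PlaneCurve (d : ℕ) where
  /-- the equation of the curve -/
  F : MvPolynomial (Fin 3) ℂ
  isHomogeneous : F.IsHomogeneous d
  irreducible : Irreducible F

/-- The value of a triple of forms at the chosen representative of a point of the plane. -/
def evalForms (A : Fin 3 → MvPolynomial (Fin 3) ℂ) (p : P2) : Fin 3 → ℂ :=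
  fun i => MvPolynomial.eval p.rep (A i)

/-- `v` is a basis of `ℂ³` whose first vector represents `p`; then
`(x, y) ↦ [v 0 + x • v 1 + y • v 2]` is an affine chart of the plane centred at `p`. -/
def IsFrameAt (v : Fin 3 → Fin 3 → ℂ) (p : P2) : Prop :=
  LinearIndependent ℂ v ∧ ∃ h : v 0 ≠ 0, Projectivization.mk ℂ (v 0) h = p

namespace PlaneCurve

variable {d e : ℕ}

/-- The set of closed points of the curve. -/
def points (C : PlaneCurve d) : Set P2 :=
  {p | MvPolynomial.eval p.rep C.F = 0}

/-! ### Isomorphism -/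

/-- A map between two plane curves is regular if near every point of the source it is given by a
triple of forms of the same degree. -/
def IsRegularMap (C : PlaneCurve d) (D : PlaneCurve e) (φ : C.points → D.points) : Prop :=
  ∀ p : C.points, ∃ (k : ℕ) (A : Fin 3 → MvPolynomial (Fin 3) ℂ),
    (∀ i, (A i).IsHomogeneous k) ∧ evalForms A p ≠ 0 ∧
    ∀ (q : C.points) (h : evalForms A q ≠ 0),
      (φ q : P2) = Projectivization.mk ℂ (evalForms A q) h

/-- Isomorphism of plane curves as abstract algebraic varieties over `ℂ` (no compatibility with
the embeddings in the plane is asked for). -/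
def Isomorphic (C : PlaneCurve d) (D : PlaneCurve e) : Prop :=
  ∃ φ : C.points ≃ D.points, IsRegularMap C D φ ∧ IsRegularMap D C φ.symm

/-! ### Rationality -/

/-- The normalization of the curve is the projective line: there is a birational morphism from
the projective line to the curve. The morphism is given by binary forms `A` of the same degree
without common zero; `B` is its rational inverse. (Such a morphism is finite and its source is
normal, so it is the normalization.) -/
def IsRational (C : PlaneCurve d) : Prop :=
  ∃ (k : ℕ) (A : Fin 3 → MvPolynomial (Fin 2) ℂ),
    (∀ i, (A i).IsHomogeneous k) ∧
    (∀ z : Fin 2 → ℂ, z ≠ 0 → ∃ i, MvPolynomial.eval z (A i) ≠ 0) ∧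
    MvPolynomial.bind₁ A C.F = 0 ∧
    ∃ (l : ℕ) (B : Fin 2 → MvPolynomial (Fin 3) ℂ) (h : MvPolynomial (Fin 2) ℂ),
      (∀ j, (B j).IsHomogeneous l) ∧ h ≠ 0 ∧
      ∀ j, MvPolynomial.bind₁ A (B j) = h * MvPolynomial.X j

/-! ### Singularities -/

/-- `p` is a singular point of the curve. -/
def IsSingularAt (C : PlaneCurve d) (p : P2) : Prop :=
  p ∈ C.points ∧ ∀ i, MvPolynomial.eval p.rep (MvPolynomial.pderiv i C.F) = 0

/-- The curve is smooth. -/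
def IsSmooth (C : PlaneCurve d) : Prop :=
  ∀ p, ¬ C.IsSingularAt p

/-- The equation `F (v 0 + x • v 1 + y • v 2)` of the curve in the affine chart defined by `v`. -/
def localEquation (C : PlaneCurve d) (v : Fin 3 → Fin 3 → ℂ) : MvPolynomial (Fin 2) ℂ :=
  MvPolynomial.aeval
    (fun i => MvPolynomial.C (v 0 i) + MvPolynomial.C (v 1 i) * MvPolynomial.X 0
      + MvPolynomial.C (v 2 i) * MvPolynomial.X 1) C.F

/-- The curve is (analytically) locally irreducible at `p`: its local equation is irreducible
as a power series. This does not depend on the chart. -/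
def IsLocallyIrreducibleAt (C : PlaneCurve d) (p : P2) : Prop :=
  ∃ v, IsFrameAt v p ∧ Irreducible (C.localEquation v : MvPowerSeries (Fin 2) ℂ)

/-- `p` is the unique singular point of the curve, and the curve is locally irreducible there. -/
def IsUnicuspidalAt (C : PlaneCurve d) (p : P2) : Prop :=
  C.IsSingularAt p ∧ (∀ q, C.IsSingularAt q → q = p) ∧ C.IsLocallyIrreducibleAt p

/-- Intersection multiplicity at the point `[v]` of the curve with the line joining `[v]`
and `[w]`. -/
def lineMultiplicity (C : PlaneCurve d) (v w : Fin 3 → ℂ) : ℕ∞ :=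
  emultiplicity (Polynomial.X : Polynomial ℂ)
    (MvPolynomial.aeval
      (fun i => Polynomial.C (v i) + Polynomial.C (w i) * Polynomial.X) C.F)

/-- The line joining `p` and another point `[w]` is tangent to the curve at `p`: its intersection
multiplicity with the curve at `p` exceeds the multiplicity of the curve at `p`, which is the
smallest intersection multiplicity at `p` with a line through `p`. -/
def IsTangentLineAt (C : PlaneCurve d) (p : P2) (w : Fin 3 → ℂ) : Prop :=
  p ∈ C.points ∧ LinearIndependent ℂ ![p.rep, w] ∧
  ∃ w', LinearIndependent ℂ ![p.rep, w'] ∧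
    C.lineMultiplicity p.rep w' < C.lineMultiplicity p.rep w

/-- The tangent line to the curve at `p` meets the curve only at `p`. -/
def TangentLineMeetsOnlyAt (C : PlaneCurve d) (p : P2) : Prop :=
  ∃ w, C.IsTangentLineAt p w ∧
    ∀ q ∈ C.points, q.rep ∈ Submodule.span ℂ {p.rep, w} → q = p

end PlaneCurve

/-! ### Newton pairs -/

/-- The set of exponents of the monomials of a power series in one variable. -/
def exponents (y : PowerSeries ℂ) : Set ℕ :=
  {b | PowerSeries.coeff b y ≠ 0}

/-- `NewtonPairsFrom S g β L`: reading the exponents in `S`, starting with current greatest common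
divisor `g` and last characteristic exponent `β` at which it dropped, the remaining Newton pairs
are those in `L`. The next characteristic exponent `β'` is the least exponent not divisible by
`g`; it contributes the pair `(g / g', (β' - β) / g')`, where `g' = gcd (g, β')`. -/
inductive NewtonPairsFrom (S : Set ℕ) : ℕ → ℕ → List (ℕ × ℕ) → Prop
  | nil (β : ℕ) : NewtonPairsFrom S 1 β []
  | cons (g β β' : ℕ) (L : List (ℕ × ℕ)) (hg : 1 < g) (hβ' : IsLeast {b ∈ S | ¬ g ∣ b} β')
      (hL : NewtonPairsFrom S (Nat.gcd g β') β' L) :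
      NewtonPairsFrom S g β ((g / Nat.gcd g β', (β' - β) / Nat.gcd g β') :: L)

/-- Formal local coordinates at the origin of the plane: two power series without constant term
and with invertible linear part. -/
def IsFormalCoordinates (U : Fin 2 → MvPowerSeries (Fin 2) ℂ) : Prop :=
  (∀ i, MvPowerSeries.constantCoeff (U i) = 0) ∧
  (Matrix.of fun i j => MvPowerSeries.coeff (Finsupp.single j 1) (U i)).det ≠ 0

/-- In suitable formal local coordinates at `p`, the curve has a parametrization
`(t ^ a, c₁ t ^ b₁ + c₂ t ^ b₂ + ⋯)` with `1 < a < b₁ < b₂ < ⋯`, all `cᵢ` nonzero, `a ∤ b₁` and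
`gcd (a, b₁, b₂, …) = 1`, and the Newton pairs of this parametrization are those in `L`.
Here `γ` is the parametrization in the affine chart `v`, and `U` are the local coordinates.
(`NewtonPairsFrom` can only end at greatest common divisor `1`.) -/
def PlaneCurve.HasNewtonPairsAt {d : ℕ} (C : PlaneCurve d) (p : P2) (L : List (ℕ × ℕ)) : Prop :=
  ∃ (v : Fin 3 → Fin 3 → ℂ) (γ : Fin 2 → PowerSeries ℂ) (U : Fin 2 → MvPowerSeries (Fin 2) ℂ)
    (a b₁ : ℕ) (y : PowerSeries ℂ),
    IsFrameAt v p ∧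
    (∀ i, PowerSeries.constantCoeff (γ i) = 0) ∧
    MvPolynomial.aeval γ (C.localEquation v) = 0 ∧
    IsFormalCoordinates U ∧
    MvPowerSeries.subst γ (U 0) = (PowerSeries.X : PowerSeries ℂ) ^ a ∧
    MvPowerSeries.subst γ (U 1) = y ∧
    1 < a ∧ a < b₁ ∧ IsLeast (exponents y) b₁ ∧ ¬ a ∣ b₁ ∧
    NewtonPairsFrom (exponents y) a 0 L

/-! ### Ordered factorizations -/

/-- The ordered factorizations of `d`: lists of integers `≥ 2` with product `d`. -/
def OrderedFactorization (d : ℕ) : Type :=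
  {n : List ℕ // (∀ k ∈ n, 2 ≤ k) ∧ n.prod = d}

/-- The pairs `(n₂, n₁ n₂ - 1), (n₃, n₂ n₃ - 1), …, (nᵣ, nᵣ₋₁ nᵣ - 1)`. -/
def amsTail : ℕ → List ℕ → List (ℕ × ℕ)
  | _, [] => []
  | k, m :: ns => (m, k * m - 1) :: amsTail m ns

/-- The Newton pairs attached to `n₁, …, nᵣ`: if `n₁ > 2` they are
`(n₁ - 1, n₁), (n₂, n₁ n₂ - 1), …, (nᵣ, nᵣ₋₁ nᵣ - 1)`; if `n₁ = 2` they are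
`(n₂, 4 n₂ - 1), (n₃, n₂ n₃ - 1), …, (nᵣ, nᵣ₋₁ nᵣ - 1)`. -/
def amsNewtonPairs : List ℕ → List (ℕ × ℕ)
  | [] => []
  | [n₁] => if n₁ = 2 then [] else [(n₁ - 1, n₁)]
  | n₁ :: n₂ :: ns =>
      if n₁ = 2 then (n₂, 4 * n₂ - 1) :: amsTail n₂ ns
      else (n₁ - 1, n₁) :: amsTail n₁ (n₂ :: ns)

end

/-! The curve is the projective closure of an affine line embedded by an explicit polynomial
automorphism of the plane. Put p_r = t, p_{r+1} = 0 and p_{i-1} = p_i^{n_i} + p_{i+1}; the line is t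
↦ (x, y) = (p_1, p_0), and p_i has degree n_{i+1}⋯n_r. The recursion can be run backwards: q_0 = y,
q_1 = x, q_{i+1} = q_{i-1} - q_i^{n_i} restrict to the p_i, so q_r recovers t and q_{r+1} = 0 is the
equation (`eqPair_paramPair`, `eq_paramPair_of_eqPair`). `paramPair` and `eqPair` are the
homogenized chains. Hence the affine part has coordinate ring ℂ[t], which gives irreducibility and
rationality; a Jacobian computation shows that it is smooth. On z = 0 the equation becomes ±x^d, so
[0:1:0] is the only point at infinity, and for d > 2 it is singular with tangent z = 0.

Newton pairs. With s = 1/t and P_i = p_i(s, 1), the local coordinates at infinity are x/y = s^a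
P_1/P_0 and z/y = s^d/P_0, where a = d - d/n_1. In a uniformizer τ with x/y = τ^a, the least
exponent of z/y not divisible by g | a is the order of the change of z/y under τ ↦ ζτ, with ζ a
primitive g-th root of unity. In terms of s this is a substitution s ↦ sε fixing x/y. The main
device is a symmetry, `order_deviation_swap`: if s ↦ sε fixes one function and s ↦ sε' fixes
another, with equal constant terms, then the change of each function under the other's substitution
has order ord(ε' - ε), up to the order of the function. Applied along the chain it reduces (p_0,
p_1) to (p_1, p_2), and so on, until ζ itself detects the change; this gives all characteristic
exponents (`exists_cusp_parametrization`).

Local irreducibility. In a uniformizer with z/y = τ^d the series x/y has d distinct conjugates under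
d-th roots of unity. A factor of the local equation vanishing on this branch therefore absorbs all
of the x-order d of the equation on z = 0, and its cofactor is a unit.

Non-isomorphism. The invariant is the set `cuspValues` of orders at the cusp, k·d - deg G(p_1, p_0,
1) for forms G of degree k. An injective regular map acts on the parameter t by a Möbius
transformation; it sends cusp to cusp, since otherwise 1 would be a value, and so t changes affinely
and the values pull back (`cuspValues_subset`). The least value not divisible by n_i⋯n_r is
n_1⋯n_{i-1}·d - n_{i+1}⋯n_r (`mem_cuspValues`, `le_of_mem_cuspValues`), and comparing these values
at the first place where two factorizations differ separates the curves. -/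

noncomputable section

/-! ### The two chains of forms and the identities between them. -/

/-- The first two coordinates `(p₀, p₁)` of the chain of binary forms
`p_{i-1} = p_i ^ nᵢ + S ^ _ * p_{i+1}`, ending with `p_r = T`, `p_{r+1} = 0`. -/
def paramPair {R : Type*} [CommRing R] (S T : R) : List ℕ → R × R
  | [] => (T, 0)
  | n :: L => ((paramPair S T L).1 ^ n +
      S ^ (n * L.prod - L.tail.prod) * (paramPair S T L).2, (paramPair S T L).1)

/-- The last two members `(q_r, q_{r+1})` of the chain of ternary forms `q₀ = y`, `q₁ = x`,
`q_{i+1} = z ^ _ * q_{i-1} - q_i ^ nᵢ`, where the list is `nᵣ, …, n₁`. -/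
def eqPair {R : Type*} [CommRing R] (x y z : R) : List ℕ → R × R
  | [] => (y, x)
  | n :: M => ((eqPair x y z M).2,
      z ^ (n * M.prod - M.tail.prod) * (eqPair x y z M).1 - (eqPair x y z M).2 ^ n)

section Numerics

variable {L M : List ℕ}

lemma prod_pos_of_two_le (h : ∀ k ∈ L, 2 ≤ k) : 0 < L.prod :=
  List.prod_pos fun k hk => by have := h k hk; omega

lemma tail_two_le (h : ∀ k ∈ L, 2 ≤ k) : ∀ k ∈ L.tail, 2 ≤ k :=
  fun k hk => h k (List.mem_of_mem_tail hk)

lemma tail_prod_le (h : ∀ k ∈ L, 2 ≤ k) : L.tail.prod ≤ L.prod := by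
  cases L with
  | nil => simp
  | cons n L =>
    have := h n (by simp)
    simpa using Nat.le_mul_of_pos_left L.prod (show 0 < n by omega)

lemma tail_prod_lt (h : ∀ k ∈ L, 2 ≤ k) {n : ℕ} (hn : 2 ≤ n) : L.tail.prod < n * L.prod := by
  have h1 := tail_prod_le h
  have h2 := prod_pos_of_two_le h
  nlinarith

lemma prod_reverseAux (M L : List ℕ) : (M.reverseAux L).prod = M.prod * L.prod := by
  rw [List.reverseAux_eq, List.prod_append, List.prod_reverse]

lemma reverseAux_two_le (hM : ∀ k ∈ M, 2 ≤ k) (hL : ∀ k ∈ L, 2 ≤ k) :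
    ∀ k ∈ M.reverseAux L, 2 ≤ k := by
  intro k hk
  rw [List.reverseAux_eq, List.mem_append, List.mem_reverse] at hk
  exact hk.elim (hM k) (hL k)

end Numerics

section Generic

variable {R R' : Type*} [CommRing R] [CommRing R']

lemma map_paramPair (f : R →+* R') (S T : R) (L : List ℕ) :
    paramPair (f S) (f T) L = (f (paramPair S T L).1, f (paramPair S T L).2) := by
  induction L with
  | nil => simp [paramPair]
  | cons n L ih => simp [paramPair, ih]

lemma map_eqPair (f : R →+* R') (x y z : R) (M : List ℕ) :
    eqPair (f x) (f y) (f z) M = (f (eqPair x y z M).1, f (eqPair x y z M).2) := by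
  induction M with
  | nil => simp [eqPair]
  | cons n L ih => simp [eqPair, ih]

/-- Solving the recursion of `paramPair` for its last term gives the recursion of `eqPair`, so
reading off the entries of M undoes the chain. `List.reverseAux` moves one entry at a time from M to
L, in step with both recursions. -/
lemma eqPair_paramPair (T : R) (M L : List ℕ) :
    eqPair (paramPair 1 T (M.reverseAux L)).2 (paramPair 1 T (M.reverseAux L)).1 1 M =
      paramPair 1 T L := by
  induction M generalizing L with
  | nil => simp [eqPair]
  | cons n M ih =>
    have := ih (n :: L)
    simp only [List.reverseAux] at this ⊢
    simp only [eqPair, this]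
    simp [paramPair]

/-- Each step (u, v) ↦ (v, u - v^n) is invertible. The coefficient ring is arbitrary because this is
used both at points, over ℂ, and in the quotient by the affine equation. -/
lemma eq_paramPair_of_eqPair {x y T : R} {M L : List ℕ}
    (h : eqPair x y 1 M = paramPair 1 T L) : (y, x) = paramPair 1 T (M.reverseAux L) := by
  induction M generalizing L with
  | nil => simpa [eqPair] using h
  | cons n M ih =>
    apply ih (L := n :: L)
    simp only [eqPair, one_pow, one_mul] at h
    have h1 := congrArg Prod.fst h
    have h2 := congrArg Prod.snd h
    simp only at h1 h2
    refine Prod.ext ?_ ?_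
    · simp [paramPair, ← h1, ← h2]
    · simp [paramPair, ← h1]

/-- The homogeneous form of `eqPair_paramPair`: x, y and z are replaced by binary forms of degree d,
and the power of S makes up the difference between the degree of the substituted q_i and that of
p_i. -/
lemma eqPair_paramPair_homogeneous (S T : R) (M L : List ℕ) (hM : ∀ k ∈ M, 2 ≤ k)
    (hL : ∀ k ∈ L, 2 ≤ k) :
    eqPair (S ^ ((M.reverseAux L).prod - (M.reverseAux L).tail.prod) *
        (paramPair S T (M.reverseAux L)).2) (paramPair S T (M.reverseAux L)).1
        (S ^ (M.reverseAux L).prod) M =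
      (S ^ ((M.reverseAux L).prod * M.tail.prod - L.prod) * (paramPair S T L).1,
        S ^ ((M.reverseAux L).prod * M.prod - L.tail.prod) * (paramPair S T L).2) := by
  induction M generalizing L with
  | nil => simp [eqPair]
  | cons n M ih =>
    have hn := hM n (by simp)
    have hM' : ∀ k ∈ M, 2 ≤ k := fun k hk => hM k (by simp [hk])
    have := ih (n :: L) hM' (by simpa [hn] using hL)
    simp only [List.reverseAux] at this ⊢
    simp only [eqPair, this]
    set d := (M.reverseAux (n :: L)).prod with hd
    have hd' : d = M.prod * (n * L.prod) := by rw [hd, prod_reverseAux, List.prod_cons]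
    have e1 : M.tail.prod < n * M.prod := tail_prod_lt hM' hn
    have e2 : L.tail.prod < n * L.prod := tail_prod_lt hL hn
    have e3 := prod_pos_of_two_le hM'
    have e4 := prod_pos_of_two_le hL
    have e5 := prod_pos_of_two_le (tail_two_le hM')
    have e6 : n * L.prod ≤ d * M.tail.prod := by
      rw [hd']
      calc n * L.prod = 1 * (n * L.prod) * 1 := by ring
        _ ≤ _ := Nat.mul_le_mul (Nat.mul_le_mul e3 le_rfl) e5
    have e7 : L.prod ≤ d * M.prod := by
      rw [hd']
      calc L.prod = 1 * (1 * L.prod) * 1 := by ring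
        _ ≤ _ := Nat.mul_le_mul (Nat.mul_le_mul e3 (Nat.mul_le_mul (by omega) le_rfl)) e3
    refine Prod.ext ?_ ?_
    · simp [paramPair]
    · simp only [paramPair, List.tail_cons, List.prod_cons]
      rw [mul_pow, ← pow_mul, ← pow_mul, ← mul_assoc, ← pow_add]
      have f1 : d * (n * M.prod - M.tail.prod) + (d * M.tail.prod - n * L.prod) =
          (d * M.prod - L.prod) * n := by
        zify [e1.le, e6, e7]; ring
      have f2 : d * (n * M.prod) - L.tail.prod =
          (d * M.prod - L.prod) * n + (n * L.prod - L.tail.prod) := by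
        have e8 : L.tail.prod ≤ d * (n * M.prod) := by
          calc L.tail.prod ≤ n * L.prod := e2.le
            _ ≤ _ := e6
            _ ≤ _ := Nat.mul_le_mul le_rfl e1.le
        zify [e2.le, e7, e8]; ring
      rw [f1, f2, pow_add]
      ring

lemma eqPair_homogeneous_smul (c x y z : R) (M : List ℕ) (hM : ∀ k ∈ M, 2 ≤ k) :
    eqPair (c * x) (c * y) (c * z) M =
      (c ^ M.tail.prod * (eqPair x y z M).1, c ^ M.prod * (eqPair x y z M).2) := by
  induction M with
  | nil => simp [eqPair]
  | cons n M ih =>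
    have hn := hM n (by simp)
    have hM' : ∀ k ∈ M, 2 ≤ k := fun k hk => hM k (by simp [hk])
    have e1 : M.tail.prod < n * M.prod := tail_prod_lt hM' hn
    simp only [eqPair, ih hM', List.tail_cons, List.prod_cons, Prod.mk.injEq, true_and]
    have e2 : c ^ (n * M.prod) = c ^ (n * M.prod - M.tail.prod) * c ^ M.tail.prod := by
      rw [← pow_add, Nat.sub_add_cancel e1.le]
    rw [mul_pow, mul_pow, ← pow_mul, mul_comm M.prod n, e2]
    ring

/-- The exponent of z is positive at every step, so only the terms -q_i^{n_i} survive. This gives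
the unique point at infinity, the contact with the tangent line and the x-order of the local
equation. -/
lemma eqPair_z_zero (x y : R) (M : List ℕ) (hM : ∀ k ∈ M, 2 ≤ k) :
    ∃ ε : R, IsUnit ε ∧ (eqPair x y 0 M).2 = ε * x ^ M.prod := by
  induction M with
  | nil => exact ⟨1, isUnit_one, by simp [eqPair]⟩
  | cons n M ih =>
    have hn := hM n (by simp)
    have hM' : ∀ k ∈ M, 2 ≤ k := fun k hk => hM k (by simp [hk])
    have e1 : M.tail.prod < n * M.prod := tail_prod_lt hM' hn
    obtain ⟨ε, hε, h⟩ := ih hM'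
    refine ⟨-ε ^ n, (hε.pow n).neg, ?_⟩
    simp only [eqPair, h, List.prod_cons]
    rw [zero_pow (by omega), mul_pow, ← pow_mul, mul_comm n]
    ring

end Generic

section Homogeneous

open MvPolynomial

variable {σ : Type*}

lemma paramPair_isHomogeneous {S T : MvPolynomial σ ℂ} (hS : S.IsHomogeneous 1)
    (hT : T.IsHomogeneous 1) (L : List ℕ) (hL : ∀ k ∈ L, 2 ≤ k) :
    (paramPair S T L).1.IsHomogeneous L.prod ∧
      (paramPair S T L).2.IsHomogeneous L.tail.prod := by
  induction L with
  | nil => simpa [paramPair] using ⟨hT, isHomogeneous_zero _ _ _⟩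
  | cons n L ih =>
    have hn := hL n (by simp)
    have hL' : ∀ k ∈ L, 2 ≤ k := fun k hk => hL k (by simp [hk])
    have e1 : L.tail.prod < n * L.prod := tail_prod_lt hL' hn
    obtain ⟨h1, h2⟩ := ih hL'
    refine ⟨?_, by simpa [paramPair] using h1⟩
    simp only [paramPair, List.prod_cons]
    refine IsHomogeneous.add ?_ ?_
    · simpa [mul_comm] using h1.pow n
    · have := (hS.pow (n * L.prod - L.tail.prod)).mul h2
      rwa [one_mul, Nat.sub_add_cancel e1.le] at this

lemma eqPair_isHomogeneous {x y z : MvPolynomial σ ℂ} (hx : x.IsHomogeneous 1)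
    (hy : y.IsHomogeneous 1) (hz : z.IsHomogeneous 1) (M : List ℕ) (hM : ∀ k ∈ M, 2 ≤ k) :
    (eqPair x y z M).1.IsHomogeneous M.tail.prod ∧
      (eqPair x y z M).2.IsHomogeneous M.prod := by
  induction M with
  | nil => simpa [eqPair] using ⟨hy, hx⟩
  | cons n M ih =>
    have hn := hM n (by simp)
    have hM' : ∀ k ∈ M, 2 ≤ k := fun k hk => hM k (by simp [hk])
    have e1 : M.tail.prod < n * M.prod := tail_prod_lt hM' hn
    obtain ⟨h1, h2⟩ := ih hM'
    refine ⟨by simpa [eqPair] using h2, ?_⟩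
    simp only [eqPair, List.prod_cons]
    refine IsHomogeneous.sub ?_ ?_
    · have := (hz.pow (n * M.prod - M.tail.prod)).mul h1
      rwa [one_mul, Nat.sub_add_cancel e1.le] at this
    · simpa [mul_comm] using h2.pow n

end Homogeneous

section SeriesParam

/-- The constant coefficients of the forms `pᵢ (s, 1)`. -/
lemma constantCoeff_paramPair (L : List ℕ) (hL : ∀ k ∈ L, 2 ≤ k) :
    PowerSeries.constantCoeff (paramPair (PowerSeries.X : PowerSeries ℂ) 1 L).1 = 1 ∧
    (L ≠ [] → PowerSeries.constantCoeff (paramPair (PowerSeries.X : PowerSeries ℂ) 1 L).2 = 1) := by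
  induction L with
  | nil => simp [paramPair]
  | cons n L ih =>
    have hn := hL n (by simp)
    have hL' : ∀ k ∈ L, 2 ≤ k := fun k hk => hL k (by simp [hk])
    have e1 : L.tail.prod < n * L.prod := tail_prod_lt hL' hn
    obtain ⟨h1, h2⟩ := ih hL'
    refine ⟨?_, fun _ => by simpa [paramPair] using h1⟩
    simp [paramPair, h1, Nat.sub_ne_zero_of_lt e1]

/-- The degrees of the polynomials `pᵢ (1, t)`. -/
lemma paramPair_monic (L : List ℕ) (hL : ∀ k ∈ L, 2 ≤ k) :
    ((paramPair (1 : Polynomial ℂ) Polynomial.X L).1.Monic ∧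
      (paramPair (1 : Polynomial ℂ) Polynomial.X L).1.natDegree = L.prod) ∧
    (L ≠ [] → (paramPair (1 : Polynomial ℂ) Polynomial.X L).2.Monic ∧
      (paramPair (1 : Polynomial ℂ) Polynomial.X L).2.natDegree = L.tail.prod) := by
  induction L with
  | nil => simp [paramPair, Polynomial.monic_X]
  | cons n L ih =>
    have hn := hL n (by simp)
    have hL' : ∀ k ∈ L, 2 ≤ k := fun k hk => hL k (by simp [hk])
    have e1 : L.tail.prod < n * L.prod := tail_prod_lt hL' hn
    obtain ⟨⟨h1, h1'⟩, h2⟩ := ih hL'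
    refine ⟨?_, fun _ => by simpa [paramPair] using ⟨h1, h1'⟩⟩
    simp only [paramPair, one_pow, one_mul, List.prod_cons]
    have hdeg : ((paramPair (1 : Polynomial ℂ) Polynomial.X L).1 ^ n).natDegree = n * L.prod := by
      rw [h1.natDegree_pow, h1']
    have hlt : (paramPair (1 : Polynomial ℂ) Polynomial.X L).2.degree <
        ((paramPair (1 : Polynomial ℂ) Polynomial.X L).1 ^ n).degree := by
      rw [Polynomial.degree_eq_natDegree (h1.pow n).ne_zero, hdeg]
      by_cases hL0 : L = []
      · subst hL0; simp [paramPair]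
      · obtain ⟨h3, h4⟩ := h2 hL0
        rw [Polynomial.degree_eq_natDegree h3.ne_zero, h4]
        exact_mod_cast e1
    refine ⟨(h1.pow n).add_of_left hlt, ?_⟩
    rw [Polynomial.natDegree_add_eq_left_of_degree_lt hlt, hdeg]

end SeriesParam
end

/-! ### Substitutions X ↦ X·ε in power series and their deviations. -/

noncomputable section

namespace PowerSeries

lemma subst_congr_dvd {a b : PowerSeries ℂ} (ha : constantCoeff a = 0) (hb : constantCoeff b = 0)
    {n : ℕ} (h : X ^ n ∣ a - b) (f : PowerSeries ℂ) : X ^ n ∣ f.subst a - f.subst b := by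
  rw [X_pow_dvd_iff]
  intro m hm
  rw [map_sub, coeff_subst' (.of_constantCoeff_zero' ha), coeff_subst' (.of_constantCoeff_zero' hb),
    sub_eq_zero]
  refine finsum_congr fun j => ?_
  congr 1
  have := X_pow_dvd_iff.1 (h.trans (sub_dvd_pow_sub_pow a b j)) m hm
  rwa [map_sub, sub_eq_zero] at this

lemma constantCoeff_subst_of_zero {a : PowerSeries ℂ} (ha : constantCoeff a = 0)
    (f : PowerSeries ℂ) : constantCoeff (f.subst a) = constantCoeff f := by
  have h := subst_congr_dvd ha (b := 0) (map_zero _) (n := 1)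
    (by simpa [X_dvd_iff] using ha) f
  rw [pow_one, X_dvd_iff, map_sub, sub_eq_zero] at h
  rw [h, subst_zero_eq_C_constantCoeff]
  exact constantCoeff_C _

lemma order_eq_zero_of_constantCoeff {f : PowerSeries ℂ} (h : constantCoeff f ≠ 0) :
    f.order = 0 := by
  by_contra h'
  exact h (order_ne_zero_iff_constCoeff_eq_zero.1 h')

lemma order_of_coeff_one {S : PowerSeries ℂ} (h0 : constantCoeff S = 0) (h1 : coeff 1 S ≠ 0) :
    S.order = 1 := by
  have := (order_eq_nat (φ := S) (n := 1)).2 ⟨h1, fun i hi => by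
    obtain rfl : i = 0 := by omega
    simpa using h0⟩
  simpa using this

lemma order_subst_of_order_one {S : PowerSeries ℂ} (h0 : constantCoeff S = 0)
    (h1 : coeff 1 S ≠ 0) (f : PowerSeries ℂ) : order (f.subst S) = f.order := by
  have hS : HasSubst S := .of_constantCoeff_zero' h0
  by_cases hf : f = 0
  · subst hf
    rw [← coe_substAlgHom hS, map_zero]
  have hu : constantCoeff f.divXPowOrder ≠ 0 := by
    rw [constantCoeff_divXPowOrder]
    exact coeff_order hf
  conv_lhs => rw [← X_pow_order_mul_divXPowOrder (f := f)]
  rw [subst_mul hS, subst_pow hS, subst_X hS, order_mul, order_pow, order_of_coeff_one h0 h1,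
    order_eq_zero_of_constantCoeff (f := subst S f.divXPowOrder)
      (by rwa [constantCoeff_subst_of_zero h0])]
  simp [coe_toNat_order hf]

lemma exists_pow_eq {P : PowerSeries ℂ} (hP : constantCoeff P = 1) {m : ℕ} (hm : m ≠ 0) :
    ∃ Q : PowerSeries ℂ, constantCoeff Q = 1 ∧ Q ^ m = P := by
  have hs : constantCoeff (P - 1) = 0 := by simp [hP]
  have hS : HasSubst (P - 1) := .of_constantCoeff_zero' hs
  refine ⟨(binomialSeries ℂ (1 / m : ℚ)).subst (P - 1), ?_, ?_⟩
  · rw [constantCoeff_subst_of_zero hs, binomialSeries_constantCoeff]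
  · have key : ∀ k : ℕ, (binomialSeries ℂ (1 / m : ℚ)) ^ k =
        binomialSeries ℂ (k * (1 / m) : ℚ) := by
      intro k
      induction k with
      | zero => simp
      | succ k ih => rw [pow_succ, ih, ← binomialSeries_add]; congr 1; push_cast; ring
    rw [← subst_pow hS, key]
    have : (m * (1 / m) : ℚ) = ((1 : ℕ) : ℚ) := by
      field_simp; simp
    rw [this, binomialSeries_nat, pow_one, subst_add hS, subst_X hS, ← coe_substAlgHom hS, map_one]
    ring

/-- `S` is a uniformizer in terms of which `X ^ m / P` becomes the power `X ^ m`; for every `m`-th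
root of unity `ζ` the substitution `X ↦ X * ε` fixes `X ^ m / P` and is conjugate to `X ↦ ζ X`. -/
lemma exists_uniformizer {P : PowerSeries ℂ} (hP : constantCoeff P = 1) {m : ℕ} (hm : m ≠ 0) :
    ∃ S T : PowerSeries ℂ, constantCoeff S = 0 ∧ coeff 1 S ≠ 0 ∧ constantCoeff T = 0 ∧
      T.subst S = X ∧ S.subst T = X ∧ T ^ m * P = X ^ m ∧
      ∀ ζ : ℂ, ζ ^ m = 1 → ∃ ε : PowerSeries ℂ, constantCoeff ε = ζ ∧
        P.subst (X * ε) = ε ^ m * P ∧ (X * ε).subst S = S.subst (C ζ * X) := by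
  obtain ⟨Q, hQ0, hQ⟩ := exists_pow_eq hP hm
  have hQu : Q * Q⁻¹ = 1 := PowerSeries.mul_inv_cancel Q (by simp [hQ0])
  set T : PowerSeries ℂ := X * Q⁻¹ with hT
  have hT0 : constantCoeff T = 0 := by simp [hT]
  have hT1 : coeff 1 T = 1 := by
    rw [hT, show (1 : ℕ) = 0 + 1 from rfl, mul_comm, coeff_succ_mul_X]
    simp [hQ0]
  have hu : IsUnit (coeff 1 T) := by rw [hT1]; exact isUnit_one
  have hTS : HasSubst T := .of_constantCoeff_zero' hT0
  set S := T.substInvOfIsUnit hu with hS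
  have hS0 : constantCoeff S = 0 := constantCoeff_substInvOfIsUnit T hu
  have hS1 : coeff 1 S ≠ 0 := by
    rw [hS, coeff_one_substInvOfIsUnit]
    exact (hu.unit⁻¹).ne_zero
  have hSS : HasSubst S := .of_constantCoeff_zero' hS0
  have h1 : T.subst S = X := subst_substInvOfIsUnit_right T hT0 hu
  have h2 : S.subst T = X := subst_substInvOfIsUnit_left T hT0 hu
  have h3 : T ^ m * P = X ^ m := by
    rw [hT, ← hQ, mul_pow, mul_assoc, ← mul_pow, mul_comm Q⁻¹, hQu, one_pow, mul_one]
  refine ⟨S, T, hS0, hS1, hT0, h1, h2, h3, fun ζ hζ => ?_⟩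
  clear_value S T
  have hζT0 : constantCoeff (C ζ * T) = 0 := by simp [hT0]
  have hζT : HasSubst (C ζ * T) := .of_constantCoeff_zero' hζT0
  have hθ0 : constantCoeff (S.subst (C ζ * T)) = 0 := by
    rw [constantCoeff_subst_of_zero hζT0, hS0]
  -- The series S(ζT) is the rotation by ζ in the uniformizer T, rewritten in terms of X; ε is its
  -- quotient by X.
  obtain ⟨ε, hε⟩ := X_dvd_iff.2 hθ0
  have hε' : HasSubst (X * ε) := .of_constantCoeff_zero' (by simp)
  have hTθ : T.subst (X * ε) = C ζ * T := by
    rw [← hε, ← subst_comp_subst_apply hSS hζT, h1, subst_X hζT]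
  have hε0 : constantCoeff ε = ζ := by
    have := congrArg (coeff 1) hTθ
    rw [hT, subst_mul hε', subst_X hε', coeff_C_mul, ← hT, hT1, mul_assoc, mul_comm X,
      show (1 : ℕ) = 0 + 1 from rfl, coeff_succ_mul_X] at this
    simpa [constantCoeff_subst_of_zero (a := X * ε) (by simp), hQ0] using this
  refine ⟨ε, hε0, ?_, ?_⟩
  · have h4 := congrArg (subst (X * ε)) h3
    rw [subst_mul hε', subst_pow hε', subst_pow hε', subst_X hε', hTθ, mul_pow, ← map_pow, hζ,
      map_one, one_mul, mul_pow, ← h3] at h4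
    have hT' : T ^ m ≠ 0 := by
      intro h
      rw [h, zero_mul] at h3
      exact pow_ne_zero m X_ne_zero h3.symm
    apply mul_left_cancel₀ hT'
    linear_combination h4
  · rw [← hε, subst_comp_subst_apply hζT hSS]
    congr 1
    rw [subst_mul hSS, h1]
    congr 1
    exact subst_C ζ

/-- The deviation of `X ^ (-m) * P` from being fixed by `X ↦ X * ε`. -/
def deviation (m : ℕ) (P ε : PowerSeries ℂ) : PowerSeries ℂ :=
  P.subst (X * ε) - ε ^ m * P

lemma constantCoeff_deviation (m : ℕ) {P : PowerSeries ℂ} (hP : constantCoeff P = 1)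
    (ε : PowerSeries ℂ) : constantCoeff (deviation m P ε) = 1 - constantCoeff ε ^ m := by
  simp [deviation, constantCoeff_subst_of_zero (a := X * ε) (by simp), hP]

lemma order_deviation_eq_zero {m : ℕ} {P : PowerSeries ℂ} (hP : constantCoeff P = 1)
    {ε : PowerSeries ℂ} (h : constantCoeff ε ^ m ≠ 1) : (deviation m P ε).order = 0 :=
  order_eq_zero_of_constantCoeff (by
    rw [constantCoeff_deviation m hP]
    exact sub_ne_zero.2 (Ne.symm h))

/-- Compare ε' with ε, whose deviation vanishes. The change in P(Xε) has order greater than ord(ε' -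
ε) because of the extra factor X, while ε'^m - ε^m is ε' - ε times a series with constant term m
ε(0)^{m-1} ≠ 0. -/
lemma order_deviation {m : ℕ} (hm : m ≠ 0) {P : PowerSeries ℂ} (hP : constantCoeff P = 1)
    {ε ε' : PowerSeries ℂ} (hε : constantCoeff ε ≠ 0)
    (h0 : constantCoeff ε' = constantCoeff ε) (h : deviation m P ε = 0) :
    (deviation m P ε').order = (ε' - ε).order := by
  by_cases hd : ε' = ε
  · simp [hd, h]
  have hd' : ε' - ε ≠ 0 := sub_ne_zero.2 hd
  set n := (ε' - ε).order.toNat with hn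
  have e1 : deviation m P ε' = (P.subst (X * ε') - P.subst (X * ε)) -
      (∑ i ∈ Finset.range m, ε' ^ i * ε ^ (m - 1 - i)) * (ε' - ε) * P := by
    rw [Commute.geom_sum₂_mul (Commute.all _ _)]
    rw [deviation, sub_eq_zero] at h
    rw [deviation, h]; ring
  have e2 : X ^ (n + 1) ∣ P.subst (X * ε') - P.subst (X * ε) := by
    apply subst_congr_dvd (by simp) (by simp)
    rw [← mul_sub, pow_succ']
    exact mul_dvd_mul_left X X_pow_order_dvd
  have e3 : ((∑ i ∈ Finset.range m, ε' ^ i * ε ^ (m - 1 - i)) * (ε' - ε) * P).order = (n : ℕ∞) := by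
    rw [order_mul, order_mul, order_eq_zero_of_constantCoeff (f := P) (by simp [hP]),
      order_eq_zero_of_constantCoeff, zero_add, add_zero, hn, coe_toNat_order hd']
    have : ∀ i ∈ Finset.range m, constantCoeff (ε' ^ i * ε ^ (m - 1 - i)) =
        constantCoeff ε ^ (m - 1) := by
      intro i hi
      rw [Finset.mem_range] at hi
      rw [map_mul, map_pow, map_pow, h0, ← pow_add]
      congr 1; omega
    rw [map_sum, Finset.sum_congr rfl this]
    simp [hm, hε]
  have e4 : (n : ℕ∞) < order (P.subst (X * ε') - P.subst (X * ε) : PowerSeries ℂ) := by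
    have : ((n + 1 : ℕ) : ℕ∞) ≤ order (P.subst (X * ε') - P.subst (X * ε) : PowerSeries ℂ) :=
      nat_le_order _ _ (X_pow_dvd_iff.1 e2)
    exact lt_of_lt_of_le (by exact_mod_cast Nat.lt_succ_self n) this
  rw [e1, sub_eq_add_neg, order_add_of_order_ne, order_neg, e3, hn, coe_toNat_order hd']
  · rw [← coe_toNat_order hd', ← hn]
    exact inf_eq_right.2 e4.le
  · rw [order_neg, e3]; exact e4.ne'

/-- Both orders equal ord(ε' - ε), which is symmetric and does not involve m, m', P, P'. This lets
the substitution fixing one function be traded for the one fixing the other. -/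
lemma order_deviation_swap {m m' : ℕ} (hm : m ≠ 0) (hm' : m' ≠ 0) {P P' : PowerSeries ℂ}
    (hP : constantCoeff P = 1) (hP' : constantCoeff P' = 1) {ε ε' : PowerSeries ℂ}
    (hε : constantCoeff ε ≠ 0) (h0 : constantCoeff ε' = constantCoeff ε)
    (h : deviation m P ε = 0) (h' : deviation m' P' ε' = 0) :
    (deviation m' P' ε).order = (deviation m P ε').order := by
  rw [order_deviation hm hP hε h0 h, order_deviation hm' hP' (h0 ▸ hε) h0.symm h',
    ← order_neg, neg_sub]

lemma exists_deviation_eq_zero {m : ℕ} (hm : m ≠ 0) {P : PowerSeries ℂ}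
    (hP : constantCoeff P = 1) {ζ : ℂ} (hζ : ζ ^ m = 1) :
    ∃ ε, constantCoeff ε = ζ ∧ deviation m P ε = 0 := by
  obtain ⟨_, _, _, _, _, _, _, _, h⟩ := exists_uniformizer hP hm
  obtain ⟨ε, h1, h2, _⟩ := h ζ hζ
  exact ⟨ε, h1, by rw [deviation, h2, sub_self]⟩

end PowerSeries

open PowerSeries in
/-- The deviation of the second member of the chain under a substitution fixing the first one. -/
lemma order_deviation_paramPair (pre : List ℕ) (m : ℕ) (rest : List ℕ)
    (hL : ∀ k ∈ pre ++ m :: rest, 2 ≤ k) {ζ : ℂ} (hζ : ζ ^ (m :: rest).prod = 1)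
    (hζ' : ζ ^ rest.prod ≠ 1) {ε : PowerSeries ℂ} (hε : constantCoeff ε = ζ)
    (h : deviation (pre ++ m :: rest).prod (paramPair X 1 (pre ++ m :: rest)).1 ε = 0) :
    ∃ c : ℕ, (deviation (pre ++ m :: rest).tail.prod
        (paramPair X 1 (pre ++ m :: rest)).2 ε).order = c ∧
      c + ((m :: rest).prod + rest.prod) =
        (pre ++ m :: rest).prod + (pre ++ m :: rest).tail.prod := by
  induction pre generalizing ε with
  | nil =>
    refine ⟨0, ?_, by simp⟩
    simp only [List.nil_append, List.tail_cons]
    -- The constant term of this deviation is 1 - ζ^{rest.prod}, nonzero by `hζ'`.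
    exact order_deviation_eq_zero ((constantCoeff_paramPair _ hL).2 (by simp)) (by rwa [hε])
  | cons n pre ih =>
    simp only [List.cons_append] at h hL ⊢
    set L := pre ++ m :: rest with hLdef
    have hn : 2 ≤ n := hL n (by simp)
    have hL' : ∀ k ∈ L, 2 ≤ k := fun k hk => hL k (by simp [hk])
    have hne : L ≠ [] := by simp [hLdef]
    have hpos := prod_pos_of_two_le hL'
    have hlt := tail_prod_lt hL' hn
    have hζL : ζ ^ L.prod = 1 := by
      obtain ⟨k, hk⟩ : (m :: rest).prod ∣ L.prod := by
        rw [hLdef, List.prod_append]; exact Dvd.intro_left _ rfl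
      rw [hk, pow_mul, hζ, one_pow]
    have hζ0 : ζ ≠ 0 := by
      rintro rfl
      rw [zero_pow hpos.ne'] at hζL
      exact zero_ne_one hζL
    -- By the swap, the deviation of p_1 under ε (which fixes p_0) has the order of the deviation of
    -- p_0 under an ε' fixing p_1.
    obtain ⟨ε', hε', h'⟩ := exists_deviation_eq_zero hpos.ne' (constantCoeff_paramPair L hL').1 hζL
    obtain ⟨c, hc, hcs⟩ := ih hL' hε' h'
    refine ⟨(n * L.prod - L.tail.prod) + c, ?_, ?_⟩
    · simp only [List.tail_cons]
      have hP2 : (paramPair (X : PowerSeries ℂ) 1 (n :: L)).2 = (paramPair X 1 L).1 := rfl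
      rw [hP2, order_deviation_swap (m := (n :: L).prod) (prod_pos_of_two_le hL).ne' hpos.ne'
        (constantCoeff_paramPair (n :: L) hL).1 (constantCoeff_paramPair L hL').1
        (by rwa [hε]) (by rw [hε, hε']) h h']
      have hs : HasSubst (X * ε') := .of_constantCoeff_zero' (by simp)
      -- Since p_0 = p_1^n + s^N p_2 and ε' fixes p_1, only the deviation of p_2 remains; the
      -- induction hypothesis applies to it, and s^N adds N to the order.
      have key : deviation (n :: L).prod (paramPair X 1 (n :: L)).1 ε' =
          X ^ (n * L.prod - L.tail.prod) * ε' ^ (n * L.prod - L.tail.prod) *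
            deviation L.tail.prod (paramPair X 1 L).2 ε' := by
        rw [deviation, sub_eq_zero] at h'
        simp only [deviation, paramPair, List.prod_cons]
        rw [subst_add hs, subst_mul hs, subst_pow hs, subst_pow hs, subst_X hs, h', mul_pow,
          ← pow_mul, mul_comm L.prod n]
        have : ε' ^ (n * L.prod) = ε' ^ (n * L.prod - L.tail.prod) * ε' ^ L.tail.prod := by
          rw [← pow_add, Nat.sub_add_cancel hlt.le]
        rw [this]
        ring
      rw [key, order_mul, order_mul, hc, order_X_pow, order_pow,
        order_eq_zero_of_constantCoeff (f := ε') (by rwa [hε'])]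
      simp
    · simp only [List.prod_cons, List.tail_cons] at hcs ⊢
      omega
end

/-! ### Characteristic exponents and Newton pairs of the cusp. -/

noncomputable section

namespace PowerSeries

lemma rescale_subst {S : PowerSeries ℂ} (hS : constantCoeff S = 0) (ζ : ℂ) (f : PowerSeries ℂ) :
    rescale ζ (f.subst S) = f.subst (rescale ζ S) := by
  have h : HasSubst (ζ • X : PowerSeries ℂ) := HasSubst.smul_X' ζ
  rw [rescale_eq_subst, rescale_eq_subst, subst_comp_subst_apply (.of_constantCoeff_zero' hS) h]

/-- The coefficient of X^b in the difference is (ζ^b - 1) times that of w, and ζ^b = 1 exactly when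
g divides b. -/
lemma isLeast_of_order_rescale {g : ℕ} {ζ : ℂ} (hζ : IsPrimitiveRoot ζ g) {w : PowerSeries ℂ}
    {β : ℕ} (h : order (rescale ζ w - w) = β) : IsLeast {b ∈ exponents w | ¬ g ∣ b} β := by
  have hc : ∀ b, coeff b (rescale ζ w - w) = (ζ ^ b - 1) * coeff b w := by
    intro b; rw [map_sub, coeff_rescale]; ring
  obtain ⟨h1, h2⟩ := order_eq_nat.1 h
  rw [hc] at h1
  refine ⟨⟨right_ne_zero_of_mul h1, fun hd => left_ne_zero_of_mul h1 ?_⟩, fun b hb => ?_⟩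
  · rw [(hζ.pow_eq_one_iff_dvd β).2 hd, sub_self]
  · by_contra hlt
    have h3 := h2 b (not_le.1 hlt)
    rw [hc] at h3
    rcases mul_eq_zero.1 h3 with h4 | h4
    · exact hb.2 ((hζ.pow_eq_one_iff_dvd b).1 (sub_eq_zero.1 h4))
    · exact hb.1 h4

/-- The conjugation behaviour of `X ^ d / P₀` along the uniformizer of `X ^ a * P₁ / P₀`. -/
lemma order_rescale_sub {d : ℕ} {P₀ S ε : PowerSeries ℂ} {ζ : ℂ}
    (hP₀ : constantCoeff P₀ = 1) (hS0 : constantCoeff S = 0) (hS1 : coeff 1 S ≠ 0)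
    (hS : (X * ε).subst S = S.subst (C ζ * X)) :
    order (rescale ζ ((X ^ d * P₀⁻¹).subst S) - (X ^ d * P₀⁻¹).subst S) =
      d + (deviation d P₀ ε).order := by
  have hSS : HasSubst S := .of_constantCoeff_zero' hS0
  have hε0 : constantCoeff (X * ε) = 0 := by simp
  have hε : HasSubst (X * ε) := .of_constantCoeff_zero' hε0
  have e1 : rescale ζ S = (X * ε).subst S := by
    rw [rescale_eq_subst, hS]; congr 1; exact smul_eq_C_mul X ζ
  rw [rescale_subst hS0, e1, ← subst_comp_subst_apply hε hSS, ← subst_sub hSS,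
    order_subst_of_order_one hS0 hS1]
  have hPε : constantCoeff (P₀.subst (X * ε)) = 1 := by
    rw [constantCoeff_subst_of_zero hε0, hP₀]
  have h1 : P₀ * P₀⁻¹ = 1 := PowerSeries.mul_inv_cancel _ (by simp [hP₀])
  have h2 : P₀.subst (X * ε) * P₀⁻¹.subst (X * ε) = 1 := by
    rw [← subst_mul hε, h1, ← coe_substAlgHom hε, map_one]
  have key : ((X ^ d * P₀⁻¹).subst (X * ε) - X ^ d * P₀⁻¹) * P₀ * (P₀.subst (X * ε)) =
      X ^ d * (-deviation d P₀ ε) := by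
    rw [subst_mul hε, subst_pow hε, subst_X hε, deviation, mul_pow]
    linear_combination (X ^ d * ε ^ d * P₀) * h2 - X ^ d * (P₀.subst (X * ε)) * h1
  have := congrArg order key
  rw [order_mul, order_mul, order_mul, order_X_pow, order_neg,
    order_eq_zero_of_constantCoeff (f := P₀) (by simp [hP₀]),
    order_eq_zero_of_constantCoeff (f := P₀.subst (X * ε)) (by simp [hPε])] at this
  simpa using this

end PowerSeries

open PowerSeries in
-- The two substituted series are x/y and z/y in terms of s = 1/t, and S expresses s in the
-- uniformizer that makes x/y a pure power. Each exponent is d plus the order of a deviation of P₀,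
-- found by swapping and descending the chain.
lemma exists_cusp_parametrization (n : ℕ) (L : List ℕ) (hL : ∀ k ∈ n :: L, 2 ≤ k) :
    ∃ S w : PowerSeries ℂ, constantCoeff S = 0 ∧ coeff 1 S ≠ 0 ∧
      subst S (X ^ (n * L.prod - L.prod) *
        ((paramPair X 1 (n :: L)).2 * (paramPair X 1 (n :: L)).1⁻¹) : PowerSeries ℂ) = (X : PowerSeries ℂ) ^ (n * L.prod - L.prod) ∧
      subst S (X ^ (n * L.prod) * (paramPair X 1 (n :: L)).1⁻¹ : PowerSeries ℂ) = w ∧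
      (2 < n → IsLeast {b ∈ exponents w | ¬ (n * L.prod - L.prod) ∣ b} (n * L.prod)) ∧
      ∀ pre m rest, L = pre ++ m :: rest →
        IsLeast {b ∈ exponents w | ¬ (m :: rest).prod ∣ b}
          (2 * (n * L.prod) + L.prod - (m :: rest).prod - rest.prod) := by
  have hn : 2 ≤ n := hL n (by simp)
  have hL' : ∀ k ∈ L, 2 ≤ k := fun k hk => hL k (by simp [hk])
  have hpos := prod_pos_of_two_le hL'
  obtain ⟨a, ha⟩ : ∃ a, n * L.prod - L.prod = a := ⟨_, rfl⟩
  obtain ⟨d, hd⟩ : ∃ d, n * L.prod = d := ⟨_, rfl⟩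
  have had : a + L.prod = d := by
    have : L.prod ≤ n * L.prod := Nat.le_mul_of_pos_left _ (by omega)
    omega
  have ha0 : a ≠ 0 := by
    have : 2 * L.prod ≤ n * L.prod := Nat.mul_le_mul hn le_rfl
    omega
  rw [ha, hd]
  set P₀ := (paramPair (X : PowerSeries ℂ) 1 (n :: L)).1 with hP₀def
  set P₁ := (paramPair (X : PowerSeries ℂ) 1 (n :: L)).2 with hP₁def
  have hP₀ : constantCoeff P₀ = 1 := (constantCoeff_paramPair _ hL).1
  have hP₁ : constantCoeff P₁ = 1 := (constantCoeff_paramPair _ hL).2 (by simp)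
  have hi₀ : P₀ * P₀⁻¹ = 1 := PowerSeries.mul_inv_cancel _ (by simp [hP₀])
  have hi₁ : P₁ * P₁⁻¹ = 1 := PowerSeries.mul_inv_cancel _ (by simp [hP₁])
  have hQ : constantCoeff (P₀ * P₁⁻¹) = 1 := by simp [hP₀, hP₁]
  obtain ⟨S, T, hS0, hS1, hT0, hTS, hST, hTP, hconj⟩ := exists_uniformizer hQ ha0
  have hSS : HasSubst S := .of_constantCoeff_zero' hS0
  refine ⟨S, _, hS0, hS1, ?_, rfl, ?_, ?_⟩
  · have : X ^ a * (P₁ * P₀⁻¹) = T ^ a := by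
      rw [← hTP]; linear_combination T ^ a * P₁ * P₁⁻¹ * hi₀ + T ^ a * hi₁
    rw [this, subst_pow hSS, hTS]
  · intro hn2
    have hz := Complex.isPrimitiveRoot_exp a ha0
    set ζ := Complex.exp (2 * Real.pi * Complex.I / a) with hζ
    obtain ⟨ε, hε, hdev, hS⟩ := hconj ζ hz.pow_eq_one
    refine isLeast_of_order_rescale hz ?_
    -- For n > 2, d = a + L.prod with 0 < L.prod < a, so ζ^d ≠ 1 and the deviation is a unit. For n
    -- = 2 the number a divides d and this fails.
    rw [order_rescale_sub hP₀ hS0 hS1 hS, order_deviation_eq_zero hP₀, add_zero]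
    rw [hε, Ne, hz.pow_eq_one_iff_dvd, ← had, Nat.dvd_add_right dvd_rfl]
    intro h
    have h2 := Nat.le_of_dvd hpos h
    have h3 : 3 * L.prod ≤ n * L.prod := Nat.mul_le_mul hn2 le_rfl
    omega
  · intro pre m rest hLeq
    have hmr : (m :: rest).prod ∣ L.prod := by
      rw [hLeq, List.prod_append]; exact Dvd.intro_left _ rfl
    have hmr2 : ∀ k ∈ m :: rest, 2 ≤ k := fun k hk => hL' k (by rw [hLeq]; simp [List.mem_cons.1 hk])
    have hm0 := prod_pos_of_two_le hmr2
    have hrest : ∀ k ∈ rest, 2 ≤ k := fun k hk => hmr2 k (by simp [hk])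
    have hr0 := prod_pos_of_two_le hrest
    have hz := Complex.isPrimitiveRoot_exp (m :: rest).prod hm0.ne'
    set ζ := Complex.exp (2 * Real.pi * Complex.I / ((m :: rest).prod : ℕ)) with hζ
    have hζL : ζ ^ L.prod = 1 := (hz.pow_eq_one_iff_dvd _).2 hmr
    have hζd : ζ ^ d = 1 := by rw [← hd, mul_comm, pow_mul, hζL, one_pow]
    have hζa : ζ ^ a = 1 := by
      rw [← had, pow_add, hζL, mul_one] at hζd; exact hζd
    have hζr : ζ ^ rest.prod ≠ 1 := by
      rw [Ne, hz.pow_eq_one_iff_dvd]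
      intro h
      have h2 := Nat.le_of_dvd hr0 h
      have h3 := hmr2 m (by simp)
      rw [List.prod_cons] at h2
      nlinarith
    have hζ0 : ζ ≠ 0 := hz.ne_zero hm0.ne'
    obtain ⟨ε, hε, hdev, hS⟩ := hconj ζ hζa
    obtain ⟨ε₀, hε₀, hdev₀⟩ := exists_deviation_eq_zero (m := d) (by omega) hP₀ hζd
    obtain ⟨c, hc, hcs⟩ := order_deviation_paramPair (n :: pre) m rest
      (by rw [List.cons_append, ← hLeq]; exact hL) hz.pow_eq_one hζr hε₀
      (by rw [List.cons_append, ← hLeq, List.prod_cons, hd]; exact hdev₀)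
    rw [List.cons_append, ← hLeq, List.tail_cons, ← hP₁def] at hc
    rw [List.cons_append, ← hLeq, List.tail_cons, List.prod_cons (l := L), hd] at hcs
    refine isLeast_of_order_rescale hz ?_
    -- Here ε fixes x/y and ε₀ fixes z/y. After the swap one needs the deviation of P₀/P₁ under ε₀,
    -- which is that of P₁ up to a unit because ε₀ fixes P₀.
    rw [order_rescale_sub hP₀ hS0 hS1 hS, order_deviation_swap ha0 (by omega) hQ hP₀
      (by rwa [hε]) (by rw [hε, hε₀]) (by rw [deviation, hdev, sub_self]) hdev₀]
    have hs : HasSubst (X * ε₀) := .of_constantCoeff_zero' (by simp)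
    have hs0 : constantCoeff (X * ε₀) = 0 := by simp
    have h1 : (P₁).subst (X * ε₀) * P₁⁻¹.subst (X * ε₀) = 1 := by
      rw [← subst_mul hs, hi₁, ← coe_substAlgHom hs, map_one]
    have key : deviation a (P₀ * P₁⁻¹) ε₀ * P₁ * P₁.subst (X * ε₀) =
        - (ε₀ ^ a * P₀ * deviation L.prod P₁ ε₀) := by
      have h2 : P₀.subst (X * ε₀) = ε₀ ^ a * ε₀ ^ L.prod * P₀ := by
        rw [← pow_add, had]; exact sub_eq_zero.1 hdev₀
      rw [deviation, deviation, subst_mul hs, h2]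
      linear_combination (ε₀ ^ a * ε₀ ^ L.prod * P₀ * P₁) * h1 -
        (ε₀ ^ a * P₀ * (P₁.subst (X * ε₀))) * hi₁
    have := congrArg order key
    rw [order_mul, order_mul, order_neg, order_mul, order_mul, hc, order_pow,
      order_eq_zero_of_constantCoeff (f := P₁) (by simp [hP₁]),
      order_eq_zero_of_constantCoeff (f := P₀) (by simp [hP₀]),
      order_eq_zero_of_constantCoeff (f := ε₀) (by rwa [hε₀]),
      order_eq_zero_of_constantCoeff (f := P₁.subst (X * ε₀))
        (by simp [constantCoeff_subst_of_zero hs0, hP₁])] at this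
    simp only [add_zero, smul_zero, zero_add] at this
    rw [this, ← Nat.cast_add]
    congr 1
    omega

/-- With B = 2d + n_2⋯n_r, the exponent at which the gcd drops from m·R to R is B - mR - R, and B -
k·L.prod - L.prod is the preceding one, k being the preceding entry. For L = m :: L₁ with R =
L₁.prod the difference is (km - 1)R, hence the pair (m, km - 1). -/
lemma newtonPairsFrom_amsTail {E : Set ℕ} {B : ℕ} (k : ℕ) (L : List ℕ) (hk : 2 ≤ k)
    (hL : ∀ j ∈ L, 2 ≤ j) (hB : L.prod ∣ B) (hB' : (k + 1) * L.prod ≤ B)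
    (h : ∀ pre m rest, L = pre ++ m :: rest →
      IsLeast {b ∈ E | ¬ (m :: rest).prod ∣ b} (B - (m :: rest).prod - rest.prod)) :
    NewtonPairsFrom E L.prod (B - k * L.prod - L.prod) (amsTail k L) := by
  induction L generalizing k with
  | nil => exact NewtonPairsFrom.nil _
  | cons m L ih =>
    have hm : 2 ≤ m := hL m (by simp)
    have hL' : ∀ k ∈ L, 2 ≤ k := fun k hk => hL k (by simp [hk])
    have hpos := prod_pos_of_two_le hL'
    have h0 := h [] m L rfl
    rw [List.prod_cons] at h0 hB hB' ⊢
    have hle : m * L.prod + L.prod ≤ B := by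
      have e1 : L.prod ≤ m * L.prod := Nat.le_mul_of_pos_left _ (by omega)
      have e2 : m * L.prod ≤ k * (m * L.prod) := Nat.le_mul_of_pos_left _ (by omega)
      have e3 : (k + 1) * (m * L.prod) = k * (m * L.prod) + m * L.prod := by ring
      omega
    have hgcd : Nat.gcd (m * L.prod) (B - m * L.prod - L.prod) = L.prod := by
      obtain ⟨q, hq⟩ := hB
      apply Nat.dvd_antisymm
      · have h1 := Nat.gcd_dvd_left (m * L.prod) (B - m * L.prod - L.prod)
        have h2 := Nat.gcd_dvd_right (m * L.prod) (B - m * L.prod - L.prod)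
        have h3 := (Nat.dvd_add_right h2).1 (show _ ∣ (B - m * L.prod - L.prod) + L.prod by
          rw [Nat.sub_add_cancel (by omega)]
          exact Nat.dvd_sub (h1.trans (hq ▸ Dvd.intro _ rfl)) h1)
        exact h3
      · refine Nat.dvd_gcd (Dvd.intro_left _ rfl) (Nat.dvd_sub (Nat.dvd_sub ?_ (Dvd.intro_left _ rfl)) dvd_rfl)
        exact hq ▸ (Dvd.intro_left m rfl : L.prod ∣ m * L.prod).mul_right q
    have hcons := NewtonPairsFrom.cons (m * L.prod) (B - k * (m * L.prod) - m * L.prod)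
      (B - m * L.prod - L.prod) (amsTail m L) (by nlinarith) h0 (by
        rw [hgcd]
        refine ih m hm hL' ((Dvd.intro_left m rfl : L.prod ∣ m * L.prod).trans hB)
          (by nlinarith) fun pre m' rest he => ?_
        exact h (m :: pre) m' rest (by rw [he, List.cons_append]))
    rw [hgcd, Nat.mul_div_cancel _ hpos] at hcons
    have hq : (B - m * L.prod - L.prod - (B - k * (m * L.prod) - m * L.prod)) / L.prod = k * m - 1 := by
      have e1 : B - m * L.prod - L.prod - (B - k * (m * L.prod) - m * L.prod) = (k * m - 1) * L.prod := by
        rw [Nat.sub_mul, one_mul, mul_assoc]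
        have : (k + 1) * (m * L.prod) = k * (m * L.prod) + m * L.prod := by ring
        omega
      rw [e1, Nat.mul_div_cancel _ hpos]
    rw [hq] at hcons
    exact hcons

/-- The Newton pairs read off from the characteristic exponents of the cusp. -/
lemma newtonPairsFrom_amsNewtonPairs {E : Set ℕ} (n : ℕ) (L : List ℕ)
    (hL : ∀ k ∈ n :: L, 2 ≤ k) (hne : 2 < (n :: L).prod)
    (h0 : 2 < n → IsLeast {b ∈ E | ¬ (n * L.prod - L.prod) ∣ b} (n * L.prod))
    (h : ∀ pre m rest, L = pre ++ m :: rest →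
      IsLeast {b ∈ E | ¬ (m :: rest).prod ∣ b}
        (2 * (n * L.prod) + L.prod - (m :: rest).prod - rest.prod)) :
    NewtonPairsFrom E (n * L.prod - L.prod) 0 (amsNewtonPairs (n :: L)) ∧
    ∃ b₁, n * L.prod - L.prod < b₁ ∧ IsLeast {b ∈ E | ¬ (n * L.prod - L.prod) ∣ b} b₁ := by
  have hn : 2 ≤ n := hL n (by simp)
  have hL' : ∀ k ∈ L, 2 ≤ k := fun k hk => hL k (by simp [hk])
  have hpos := prod_pos_of_two_le hL'
  rw [List.prod_cons] at hne
  have hsub : n * L.prod - L.prod = (n - 1) * L.prod := by rw [Nat.sub_mul, one_mul]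
  have hdvd : L.prod ∣ 2 * (n * L.prod) + L.prod :=
    Dvd.dvd.add ((Dvd.intro_left n rfl : L.prod ∣ n * L.prod).mul_left 2) dvd_rfl
  by_cases hn2 : n = 2
  -- For n = 2 the multiplicity is already the product of the remaining entries, so no pair comes
  -- from n, and the first exponent is `h` with empty prefix, (4m - 1)·L.prod.
  · subst hn2
    cases L with
    | nil => simp at hne
    | cons m L =>
      have hm : 2 ≤ m := hL m (by simp)
      have hL'' : ∀ k ∈ L, 2 ≤ k := fun k hk => hL k (by simp [hk])
      have hpos' := prod_pos_of_two_le hL''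
      have h1 := h [] m L rfl
      have e1 : 2 * (m :: L).prod - (m :: L).prod = (m :: L).prod := by omega
      rw [e1]
      have e2 : 2 * (2 * (m :: L).prod) + (m :: L).prod - (m :: L).prod - L.prod =
          (4 * m - 1) * L.prod := by
        rw [List.prod_cons, Nat.sub_mul, one_mul, mul_assoc]; omega
      rw [e2] at h1
      have hgcd : Nat.gcd (m :: L).prod ((4 * m - 1) * L.prod) = L.prod := by
        rw [List.prod_cons, Nat.gcd_mul_right]
        have : Nat.gcd m (4 * m - 1) = 1 := by
          have h5 := Nat.gcd_dvd_left m (4 * m - 1)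
          have h6 := Nat.gcd_dvd_right m (4 * m - 1)
          have h7 := (Nat.dvd_add_right h6).1 (show _ ∣ (4 * m - 1) + 1 by
            rw [Nat.sub_add_cancel (by omega)]; exact h5.mul_left 4)
          exact Nat.dvd_one.1 h7
        rw [this, one_mul]
      refine ⟨?_, (4 * m - 1) * L.prod, ?_, h1⟩
      · have := NewtonPairsFrom.cons (m :: L).prod 0 ((4 * m - 1) * L.prod) (amsTail m L)
          (by rw [List.prod_cons]; nlinarith) h1 (by
            rw [hgcd]
            have h8 := newtonPairsFrom_amsTail (E := E) (B := 4 * m * L.prod + m * L.prod) m L hm hL''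
              (Dvd.dvd.add (Dvd.intro_left _ rfl) (Dvd.intro_left _ rfl)) (by nlinarith)
              (fun pre m' rest he => by
                have h9 := h (m :: pre) m' rest (by rw [he, List.cons_append])
                have e3 : 2 * (2 * (m :: L).prod) + (m :: L).prod =
                    4 * m * L.prod + m * L.prod := by rw [List.prod_cons]; ring
                rwa [e3] at h9)
            have e4 : 4 * m * L.prod + m * L.prod - m * L.prod - L.prod = (4 * m - 1) * L.prod := by
              rw [Nat.sub_mul, one_mul]; omega
            rwa [e4] at h8)
        rw [hgcd, Nat.sub_zero, Nat.mul_div_cancel _ hpos', List.prod_cons,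
          Nat.mul_div_cancel _ hpos'] at this
        rw [List.prod_cons]
        simpa [amsNewtonPairs] using this
      · rw [List.prod_cons]
        exact Nat.mul_lt_mul_of_pos_right (by omega) hpos'
  · have hn3 : 2 < n := by omega
    have h1 := h0 hn3
    refine ⟨?_, n * L.prod, by omega, h1⟩
    have hgcd : Nat.gcd (n * L.prod - L.prod) (n * L.prod) = L.prod := by
      rw [hsub, Nat.gcd_mul_right]
      have : Nat.gcd (n - 1) n = 1 := by
        have h5 := Nat.gcd_dvd_left (n - 1) n
        have h6 := Nat.gcd_dvd_right (n - 1) n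
        have h7 := (Nat.dvd_add_right h5).1 (show _ ∣ (n - 1) + 1 by
          rwa [Nat.sub_add_cancel (by omega)])
        exact Nat.dvd_one.1 h7
      rw [this, one_mul]
    have := NewtonPairsFrom.cons (n * L.prod - L.prod) 0 (n * L.prod) (amsTail n L)
      (by
        have : 3 * L.prod ≤ n * L.prod := Nat.mul_le_mul hn3 le_rfl
        omega) h1 (by
        rw [hgcd]
        have h8 := newtonPairsFrom_amsTail (E := E) n L hn hL' hdvd (by nlinarith) h
        have e4 : 2 * (n * L.prod) + L.prod - n * L.prod - L.prod = n * L.prod := by omega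
        rwa [e4] at h8)
    rw [hgcd, Nat.sub_zero, Nat.mul_div_cancel _ hpos, hsub, Nat.mul_div_cancel _ hpos] at this
    rw [hsub]
    cases L with
    | nil => simpa [amsNewtonPairs, hn2, amsTail] using this
    | cons m L => simpa [amsNewtonPairs, hn2] using this
end

/-! ### Irreducibility of the equation. -/

noncomputable section

section Irreducible

open Polynomial

lemma eqPair_natDegree {R : Type*} [CommRing R] [IsDomain R] (b c : R) (M : List ℕ)
    (hM : ∀ k ∈ M, 2 ≤ k) :
    (eqPair (X : R[X]) (C b) (C c) M).1.natDegree ≤ M.tail.prod ∧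
    (eqPair (X : R[X]) (C b) (C c) M).2.natDegree = M.prod ∧
      IsUnit (eqPair (X : R[X]) (C b) (C c) M).2.leadingCoeff := by
  induction M with
  | nil => simp [eqPair]
  | cons n M ih =>
    have hn := hM n (by simp)
    have hM' : ∀ k ∈ M, 2 ≤ k := fun k hk => hM k (by simp [hk])
    have e1 : M.tail.prod < n * M.prod := tail_prod_lt hM' hn
    obtain ⟨h1, h2, h3⟩ := ih hM'
    set A := (eqPair (X : R[X]) (C b) (C c) M).1 with hA
    set B := (eqPair (X : R[X]) (C b) (C c) M).2 with hB
    have hlt : (C c ^ (n * M.prod - M.tail.prod) * A).degree < (-B ^ n).degree := by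
      rw [degree_neg, degree_pow, degree_eq_natDegree (p := B)
        (by intro h0; simp [h0] at h3), h2, ← C_pow]
      refine lt_of_le_of_lt ((degree_le_natDegree).trans (Nat.cast_le.2
        ((natDegree_C_mul_le _ _).trans h1))) ?_
      rw [nsmul_eq_mul]
      exact_mod_cast e1
    refine ⟨?_, ?_, ?_⟩
    · simp only [eqPair, List.tail_cons, ← hB, h2, le_refl]
    · simp only [eqPair, ← hA, ← hB, List.prod_cons]
      rw [sub_eq_add_neg, natDegree_add_eq_right_of_degree_lt hlt, natDegree_neg, natDegree_pow, h2]
    · simp only [eqPair, ← hA, ← hB]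
      rw [sub_eq_add_neg, leadingCoeff_add_of_degree_lt hlt, leadingCoeff_neg, leadingCoeff_pow]
      exact (h3.pow n).neg

/-- Restriction of polynomials in `y` (inner variable) and `x` (outer variable) to the
parametrized affine line. -/
def restrictLine (L : List ℕ) : ℂ[X][X] →+* ℂ[X] :=
  eval₂RingHom (eval₂RingHom C (paramPair 1 X L).1) (paramPair 1 X L).2

lemma restrictLine_eqPair (M L : List ℕ) :
    (restrictLine (M.reverseAux L) (eqPair (X : ℂ[X][X]) (C X) 1 M).1,
      restrictLine (M.reverseAux L) (eqPair (X : ℂ[X][X]) (C X) 1 M).2) = paramPair 1 X L := by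
  rw [← map_eqPair, ← eqPair_paramPair X M L]
  simp [restrictLine]

/-- The affine equation generates the ideal of the parametrized line. -/
lemma dvd_of_restrictLine_eq_zero (M : List ℕ) {g : ℂ[X][X]}
    (hg : restrictLine (M.reverseAux []) g = 0) : (eqPair (X : ℂ[X][X]) (C X) 1 M).2 ∣ g := by
  set f := (eqPair (X : ℂ[X][X]) (C X) 1 M).2 with hf
  rw [← Ideal.mem_span_singleton, ← Ideal.Quotient.eq_zero_iff_mem]
  set π := Ideal.Quotient.mk (Ideal.span {f}) with hπ
  -- In the quotient the last q vanishes, so inverting the chain expresses the classes of y and x as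
  -- p_0 and p_1 at the class of q_r. Thus π factors through restriction to the line, with t ↦ q_r.
  have h1 : eqPair (π X) (π (C X)) 1 M = paramPair 1 (π (eqPair (X : ℂ[X][X]) (C X) 1 M).1) [] := by
    rw [← map_one π, map_eqPair, map_one, paramPair]
    refine Prod.ext rfl ?_
    exact Ideal.Quotient.eq_zero_iff_mem.2 (Ideal.mem_span_singleton_self f)
  have h2 := eq_paramPair_of_eqPair h1
  set lift : ℂ[X] →+* ℂ[X][X] ⧸ Ideal.span {f} :=
    eval₂RingHom (π.comp (C.comp C)) (π (eqPair (X : ℂ[X][X]) (C X) 1 M).1) with hlift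
  have h3 : π = lift.comp (restrictLine (M.reverseAux [])) := by
    have h4 := map_paramPair (R := ℂ[X]) (R' := ℂ[X][X] ⧸ Ideal.span {f}) lift 1 X (M.reverseAux [])
    rw [map_one, hlift, coe_eval₂RingHom, eval₂_X, ← h2] at h4
    refine Polynomial.ringHom_ext' (Polynomial.ringHom_ext' ?_ ?_) ?_
    · ext a
      simp [restrictLine, hlift]
    · have := congrArg Prod.fst h4
      simpa [restrictLine, hlift] using this
    · have := congrArg Prod.snd h4
      simpa [restrictLine, hlift] using this
  rw [h3, RingHom.comp_apply, hg, map_zero]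

/-- The equation generates the kernel of restriction to the line, a homomorphism to the domain ℂ[t].
-/
lemma prime_eqPair_affine (M : List ℕ) (hM : ∀ k ∈ M, 2 ≤ k) :
    Prime (eqPair (X : ℂ[X][X]) (C X) 1 M).2 := by
  set f := (eqPair (X : ℂ[X][X]) (C X) 1 M).2 with hf
  have h0 : restrictLine (M.reverseAux []) f = 0 :=
    congrArg Prod.snd (restrictLine_eqPair M [])
  have hne : f ≠ 0 := by
    intro h
    have := (eqPair_natDegree (X : ℂ[X]) 1 M hM).2.2
    rw [map_one, ← hf, h] at this
    simp at this
  refine ⟨hne, fun hu => ?_, fun a b hab => ?_⟩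
  · have := hu.map (restrictLine (M.reverseAux []))
    rw [h0] at this
    exact not_isUnit_zero this
  · obtain ⟨c, hc⟩ := hab
    have h1 : restrictLine (M.reverseAux []) a * restrictLine (M.reverseAux []) b = 0 := by
      rw [← map_mul, hc, map_mul, h0, zero_mul]
    exact (mul_eq_zero.1 h1).imp (dvd_of_restrictLine_eq_zero M) (dvd_of_restrictLine_eq_zero M)

/-- Setting z = 1 could only hide a factor by lowering its x-degree. As a polynomial in x the form
has unit leading coefficient, so every factor does too, and a factor that becomes a unit was one
already. -/
lemma irreducible_eqPair (M : List ℕ) (hM : ∀ k ∈ M, 2 ≤ k) :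
    Irreducible (eqPair (MvPolynomial.X 0 : MvPolynomial (Fin 3) ℂ) (MvPolynomial.X 1)
      (MvPolynomial.X 2) M).2 := by
  rw [← MulEquiv.irreducible_iff (MvPolynomial.finSuccEquiv ℂ 2)]
  have h1 : MvPolynomial.finSuccEquiv ℂ 2 (eqPair (MvPolynomial.X 0 : MvPolynomial (Fin 3) ℂ)
      (MvPolynomial.X 1) (MvPolynomial.X 2) M).2 =
      (eqPair (X : (MvPolynomial (Fin 2) ℂ)[X]) (C (MvPolynomial.X 0))
        (C (MvPolynomial.X 1)) M).2 := by
    have h2 := congrArg Prod.snd (map_eqPair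
      (MvPolynomial.finSuccEquiv ℂ 2 : MvPolynomial (Fin 3) ℂ →+* (MvPolynomial (Fin 2) ℂ)[X])
      (MvPolynomial.X 0) (MvPolynomial.X 1) (MvPolynomial.X 2) M)
    have e1 : (1 : Fin 3) = Fin.succ 0 := rfl
    have e2 : (2 : Fin 3) = Fin.succ 1 := rfl
    simp only [RingHom.coe_coe] at h2
    rw [← h2, e1, e2, MvPolynomial.finSuccEquiv_X_zero, MvPolynomial.finSuccEquiv_X_succ,
      MvPolynomial.finSuccEquiv_X_succ]
  rw [h1]
  obtain ⟨-, hdeg, hu⟩ := eqPair_natDegree (MvPolynomial.X 0 : MvPolynomial (Fin 2) ℂ)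
    (MvPolynomial.X 1) M hM
  set F := (eqPair (X : (MvPolynomial (Fin 2) ℂ)[X]) (C (MvPolynomial.X 0))
    (C (MvPolynomial.X 1)) M).2 with hF
  set δ : MvPolynomial (Fin 2) ℂ →+* ℂ[X] :=
    (MvPolynomial.aeval ![X, 1] : MvPolynomial (Fin 2) ℂ →ₐ[ℂ] ℂ[X]).toRingHom with hδ
  have hδF : F.map δ = (eqPair (X : ℂ[X][X]) (C X) 1 M).2 := by
    have := congrArg Prod.snd (map_eqPair (mapRingHom δ) (X : (MvPolynomial (Fin 2) ℂ)[X])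
      (C (MvPolynomial.X 0)) (C (MvPolynomial.X 1)) M)
    simp only [coe_mapRingHom] at this
    rw [hF, ← this]
    simp [hδ]
  have hp := prime_eqPair_affine M hM
  rw [← hδF] at hp
  have key : ∀ G H : (MvPolynomial (Fin 2) ℂ)[X], F = G * H → IsUnit (G.map δ) → IsUnit G := by
    intro G H hGH hG
    have hl : IsUnit G.leadingCoeff := by
      rw [hGH, leadingCoeff_mul] at hu
      exact isUnit_of_mul_isUnit_left hu
    have hd : (G.map δ).natDegree = G.natDegree :=
      natDegree_map_of_leadingCoeff_ne_zero δ (hl.map δ).ne_zero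
    rw [natDegree_eq_zero_of_isUnit hG] at hd
    rw [eq_C_of_natDegree_eq_zero hd.symm]
    rw [leadingCoeff, ← hd] at hl
    exact hl.map C
  refine ⟨fun hU => hp.not_isUnit (hU.map (mapRingHom δ)), fun G H hGH => ?_⟩
  have h3 : F.map δ = G.map δ * H.map δ := by rw [hGH, Polynomial.map_mul]
  exact (hp.irreducible.isUnit_or_isUnit h3).imp (key G H hGH)
    (key H G (by rw [hGH, mul_comm]))

end Irreducible

/-! ### The projective curve and its points. -/

open MvPolynomial

/-- The projective closure of the line embedded in the plane with degrees given by `L`. -/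
def amsCurve (d : ℕ) (L : List ℕ) (hL : ∀ k ∈ L, 2 ≤ k) (hd : L.prod = d) : PlaneCurve d where
  F := (eqPair (X 0) (X 1) (X 2) L.reverse).2
  isHomogeneous := by
    have := (eqPair_isHomogeneous (isHomogeneous_X ℂ (0 : Fin 3)) (isHomogeneous_X ℂ 1)
      (isHomogeneous_X ℂ 2) L.reverse (by simpa using hL)).2
    rwa [List.prod_reverse, hd] at this
  irreducible := irreducible_eqPair _ (by simpa using hL)

section Projective

lemma exists_rep_eq_smul (v : Fin 3 → ℂ) (hv : v ≠ 0) :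
    ∃ c : ℂ, c ≠ 0 ∧ (Projectivization.mk ℂ v hv).rep = c • v := by
  obtain ⟨a, ha⟩ := Projectivization.exists_smul_eq_mk_rep ℂ v hv
  exact ⟨a, a.ne_zero, ha.symm⟩

lemma eval_smul_of_isHomogeneous {σ : Type*} {F : MvPolynomial σ ℂ} {k : ℕ}
    (hF : F.IsHomogeneous k) (c : ℂ) (v : σ → ℂ) : eval (c • v) F = c ^ k * eval v F := by
  rw [eval_eq, eval_eq, Finset.mul_sum]
  refine Finset.sum_congr rfl fun m hm => ?_
  have : ∑ i ∈ m.support, m i = k := by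
    simpa [Finsupp.weight_apply, Finsupp.sum] using hF (mem_support_iff.1 hm)
  simp only [Pi.smul_apply, smul_eq_mul, mul_pow, Finset.prod_mul_distrib, Finset.prod_pow_eq_pow_sum, this]
  ring

lemma mk_mem_points {d : ℕ} (C : PlaneCurve d) (v : Fin 3 → ℂ) (hv : v ≠ 0) :
    Projectivization.mk ℂ v hv ∈ C.points ↔ eval v C.F = 0 := by
  obtain ⟨c, hc, h⟩ := exists_rep_eq_smul v hv
  simp [PlaneCurve.points, h, eval_smul_of_isHomogeneous C.isHomogeneous, hc]

lemma mk_eq_of_rep_eq_smul {p : P2} {v : Fin 3 → ℂ} (hv : v ≠ 0) {c : ℂ} (h : p.rep = c • v) :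
    p = Projectivization.mk ℂ v hv := by
  rw [← p.mk_rep, Projectivization.mk_eq_mk_iff']
  exact ⟨c, h.symm⟩

/-- The point at infinity of the vertical direction. -/
def cuspVec : Fin 3 → ℂ := ![0, 1, 0]

lemma cuspVec_ne_zero : cuspVec ≠ 0 := fun h => one_ne_zero (congrFun h 1)

def cuspPoint : P2 := Projectivization.mk ℂ cuspVec cuspVec_ne_zero

/-- The affine points of the curve. -/
def lineVec (L : List ℕ) (t : ℂ) : Fin 3 → ℂ := ![(paramPair 1 t L).2, (paramPair 1 t L).1, 1]

lemma lineVec_ne_zero (L : List ℕ) (t : ℂ) : lineVec L t ≠ 0 :=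
  fun h => one_ne_zero (congrFun h 2)

variable {d : ℕ} {L : List ℕ} (hL : ∀ k ∈ L, 2 ≤ k) (hd : L.prod = d)

lemma eval_eqPair (v : Fin 3 → ℂ) (M : List ℕ) :
    (eval v (eqPair (X 0) (X 1) (X 2) M).1, eval v (eqPair (X 0) (X 1) (X 2) M).2) =
      eqPair (v 0) (v 1) (v 2) M := by
  rw [← map_eqPair]; simp

lemma eval_lineVec (t : ℂ) :
    eval (lineVec L t) (eqPair (X 0) (X 1) (X 2) L.reverse).1 = t ∧
    eval (lineVec L t) (amsCurve d L hL hd).F = 0 := by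
  have h := eval_eqPair (lineVec L t) L.reverse
  have h2 := eqPair_paramPair t L.reverse []
  have h3 : L.reverse.reverseAux [] = L := by rw [List.reverseAux_eq]; simp
  rw [h3] at h2
  have h4 : eqPair (lineVec L t 0) (lineVec L t 1) (lineVec L t 2) L.reverse = paramPair 1 t [] := h2
  rw [h4] at h
  exact ⟨congrArg Prod.fst h, congrArg Prod.snd h⟩

/-- After scaling to z = 1, inverting the chain over ℂ shows that every affine point lies on the
line, its parameter being the value of q_r. -/
lemma eq_lineVec_of_eval {v : Fin 3 → ℂ} (hv : eval v (amsCurve d L hL hd).F = 0)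
    (h2 : v 2 ≠ 0) :
    v = v 2 • lineVec L (eval ((v 2)⁻¹ • v) (eqPair (X 0) (X 1) (X 2) L.reverse).1) := by
  set u := (v 2)⁻¹ • v with hu
  have hu2 : u 2 = 1 := by simp [hu, h2]
  have h0 : eval u (amsCurve d L hL hd).F = 0 := by
    rw [hu, eval_smul_of_isHomogeneous (amsCurve d L hL hd).isHomogeneous, hv, mul_zero]
  have h := eval_eqPair u L.reverse
  rw [hu2] at h
  set t := eval u (eqPair (X 0) (X 1) (X 2) L.reverse).1 with ht
  have h1 : eqPair (u 0) (u 1) 1 L.reverse = paramPair 1 t [] := by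
    rw [← h, paramPair]
    exact Prod.ext rfl h0
  have h3 := eq_paramPair_of_eqPair h1
  have h4 : L.reverse.reverseAux [] = L := by rw [List.reverseAux_eq]; simp
  rw [h4] at h3
  have h5 : u = lineVec L t := by
    rw [lineVec, ← h3]
    ext i; fin_cases i <;> simp [hu2]
  rw [← h5, hu, smul_smul, mul_inv_cancel₀ h2, one_smul]

lemma eq_zero_of_eval_of_z_eq_zero {v : Fin 3 → ℂ} (hv : eval v (amsCurve d L hL hd).F = 0)
    (h2 : v 2 = 0) : v 0 = 0 := by
  have h := congrArg Prod.snd (eval_eqPair v L.reverse)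
  obtain ⟨ε, hε, h3⟩ := eqPair_z_zero (v 0) (v 1) L.reverse (by simpa using hL)
  rw [h2, h3] at h
  have h4 : ε * v 0 ^ L.reverse.prod = 0 := by rw [← h]; exact hv
  exact eq_zero_of_pow_eq_zero ((mul_eq_zero.1 h4).resolve_left hε.ne_zero)
end Projective
end

/-! ### Rationality, singular points and the tangent line. -/

noncomputable section

open MvPolynomial

variable {d : ℕ} {L : List ℕ}

lemma paramPair_S_zero {R : Type*} [CommRing R] (T : R) (L : List ℕ) (hL : ∀ k ∈ L, 2 ≤ k) :
    (paramPair 0 T L).1 = T ^ L.prod := by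
  induction L with
  | nil => simp [paramPair]
  | cons n L ih =>
    have hn := hL n (by simp)
    have hL' : ∀ k ∈ L, 2 ≤ k := fun k hk => hL k (by simp [hk])
    have e1 : L.tail.prod < n * L.prod := tail_prod_lt hL' hn
    simp only [paramPair, ih hL', List.prod_cons]
    rw [zero_pow (by omega), ← pow_mul, mul_comm n]; ring

lemma reverse_reverseAux_nil (L : List ℕ) : L.reverse.reverseAux [] = L := by
  rw [List.reverseAux_eq]; simp

lemma reverse_two_le (hL : ∀ k ∈ L, 2 ≤ k) : ∀ k ∈ L.reverse, 2 ≤ k := by simpa using hL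

lemma amsCurve_isRational (hL : ∀ k ∈ L, 2 ≤ k) (hd : L.prod = d) :
    (amsCurve d L hL hd).IsRational := by
  have hd0 : 0 < d := hd ▸ prod_pos_of_two_le hL
  have hhom := paramPair_isHomogeneous (isHomogeneous_X ℂ (1 : Fin 2)) (isHomogeneous_X ℂ 0) L hL
  have htl := tail_prod_le hL
  rw [hd] at hhom htl
  have hpair := eqPair_paramPair_homogeneous (X 1 : MvPolynomial (Fin 2) ℂ) (X 0) L.reverse []
    (reverse_two_le hL) (by simp)
  rw [reverse_reverseAux_nil, hd] at hpair
  have he : 0 < L.reverse.tail.prod := prod_pos_of_two_le (tail_two_le (reverse_two_le hL))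
  set A : Fin 3 → MvPolynomial (Fin 2) ℂ := ![X 1 ^ (d - L.tail.prod) * (paramPair (X 1) (X 0) L).2,
    (paramPair (X 1) (X 0) L).1, X 1 ^ d] with hA
  have hbind : (bind₁ A (eqPair (X 0) (X 1) (X 2) L.reverse).1,
      bind₁ A (eqPair (X 0) (X 1) (X 2) L.reverse).2) =
      (X 1 ^ (d * L.reverse.tail.prod - 1) * X 0, 0) := by
    have := map_eqPair (bind₁ A : MvPolynomial (Fin 3) ℂ →ₐ[ℂ] _).toRingHom (X 0) (X 1) (X 2)
      L.reverse
    simp only [AlgHom.toRingHom_eq_coe, RingHom.coe_coe, bind₁_X_right] at this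
    rw [← this]
    simpa [hA, paramPair] using hpair
  -- The rational inverse is t = q_r, homogenized as [q_r : z^e] with e = deg q_r.
  refine ⟨d, A, ?_, ?_, congrArg Prod.snd hbind, L.reverse.tail.prod,
    ![(eqPair (X 0) (X 1) (X 2) L.reverse).1, X 2 ^ L.reverse.tail.prod],
    X 1 ^ (d * L.reverse.tail.prod - 1), ?_, pow_ne_zero _ (X_ne_zero _), ?_⟩
  · intro i
    fin_cases i
    · have := ((isHomogeneous_X ℂ (1 : Fin 2)).pow (d - L.tail.prod)).mul hhom.2
      rw [one_mul, Nat.sub_add_cancel htl] at this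
      exact this
    · exact hhom.1
    · exact isHomogeneous_X_pow _ _
  · intro z hz
    by_cases h1 : z 1 = 0
    · refine ⟨1, ?_⟩
      have h2 := congrArg Prod.fst (map_paramPair (eval z) (X 1) (X 0) L)
      simp only [eval_X, h1] at h2
      have h3 : eval z (A 1) = z 0 ^ L.prod := by
        rw [← paramPair_S_zero (z 0) L hL]
        exact h2.symm
      rw [h3]
      refine pow_ne_zero _ fun h0 => hz ?_
      ext i; fin_cases i <;> simp [h0, h1]
    · exact ⟨2, by simp [hA, h1]⟩
  · intro j
    fin_cases j
    · exact (eqPair_isHomogeneous (isHomogeneous_X ℂ (0 : Fin 3)) (isHomogeneous_X ℂ 1)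
        (isHomogeneous_X ℂ 2) L.reverse (reverse_two_le hL)).1
    · exact isHomogeneous_X_pow _ _
  · intro j
    fin_cases j
    · exact congrArg Prod.fst hbind
    · simp only [Fin.mk_one, Matrix.cons_val_one, map_pow, bind₁_X_right, Matrix.cons_val_fin_one]
      have : A 2 = X 1 ^ d := rfl
      rw [this, ← pow_mul, ← pow_succ, Nat.sub_add_cancel (Nat.mul_pos hd0 he)]

/-- Each step (q_{i-1}, q_i) ↦ (q_i, z^N q_{i-1} - q_i^n) multiplies the Jacobian in x and y by
-z^N. Hence the x- and y-derivatives of the equation cannot both vanish where z ≠ 0. -/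
lemma jacobian_eqPair (M : List ℕ) :
    ∃ (u : ℂ) (k : ℕ), u ≠ 0 ∧
      pderiv 0 (eqPair (X 0 : MvPolynomial (Fin 3) ℂ) (X 1) (X 2) M).1 *
        pderiv 1 (eqPair (X 0 : MvPolynomial (Fin 3) ℂ) (X 1) (X 2) M).2 -
      pderiv 1 (eqPair (X 0 : MvPolynomial (Fin 3) ℂ) (X 1) (X 2) M).1 *
        pderiv 0 (eqPair (X 0 : MvPolynomial (Fin 3) ℂ) (X 1) (X 2) M).2 = C u * X 2 ^ k := by
  induction M with
  | nil => exact ⟨-1, 0, by simp, by simp [eqPair, pderiv_X]⟩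
  | cons n M ih =>
    obtain ⟨u, k, hu, h⟩ := ih
    refine ⟨-u, n * M.prod - M.tail.prod + k, neg_ne_zero.2 hu, ?_⟩
    simp only [eqPair, map_sub, Derivation.leibniz, Derivation.leibniz_pow]
    have h1 : pderiv 0 (X 2 : MvPolynomial (Fin 3) ℂ) = 0 := pderiv_X_of_ne (by decide)
    have h2 : pderiv 1 (X 2 : MvPolynomial (Fin 3) ℂ) = 0 := pderiv_X_of_ne (by decide)
    rw [h1, h2, pow_add, map_neg]
    simp only [smul_eq_mul, nsmul_eq_mul]
    linear_combination (-(X 2) ^ (n * M.prod - M.tail.prod)) * h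

lemma rep_z_eq_zero_of_isSingularAt (hL : ∀ k ∈ L, 2 ≤ k) (hd : L.prod = d) {p : P2}
    (hp : (amsCurve d L hL hd).IsSingularAt p) : p.rep 2 = 0 := by
  obtain ⟨u, k, hu, h⟩ := jacobian_eqPair L.reverse
  have h2 := congrArg (eval p.rep) h
  have h3 := hp.2 0
  have h4 := hp.2 1
  simp only [amsCurve] at h3 h4
  rw [map_sub, map_mul, map_mul, h3, h4] at h2
  by_contra hne
  apply mul_ne_zero hu (pow_ne_zero k hne)
  simpa using h2.symm

lemma eq_cuspPoint_of_z_eq_zero (hL : ∀ k ∈ L, 2 ≤ k) (hd : L.prod = d) {p : P2}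
    (hp : p ∈ (amsCurve d L hL hd).points) (h : p.rep 2 = 0) : p = cuspPoint := by
  have h0 := eq_zero_of_eval_of_z_eq_zero hL hd hp h
  refine mk_eq_of_rep_eq_smul cuspVec_ne_zero (c := p.rep 1) ?_
  ext i; fin_cases i <;> simp [cuspVec, h, h0]

lemma cuspPoint_rep : cuspPoint.rep 0 = 0 ∧ cuspPoint.rep 1 ≠ 0 ∧ cuspPoint.rep 2 = 0 := by
  obtain ⟨c, hc, h⟩ := exists_rep_eq_smul cuspVec cuspVec_ne_zero
  rw [cuspPoint, h]
  simp [cuspVec, hc]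

lemma eval_eqPair_of_x_z_zero (v : Fin 3 → ℂ) (h0 : v 0 = 0) (h2 : v 2 = 0) (M : List ℕ)
    (hM : ∀ k ∈ M, 2 ≤ k) : eval v (eqPair (X 0) (X 1) (X 2) M).2 = 0 := by
  have h := congrArg Prod.snd (eval_eqPair v M)
  obtain ⟨ε, -, h3⟩ := eqPair_z_zero (v 0) (v 1) M hM
  rw [h2, h3, h0, zero_pow (prod_pos_of_two_le hM).ne', mul_zero] at h
  exact h

lemma cuspPoint_mem (hL : ∀ k ∈ L, 2 ≤ k) (hd : L.prod = d) :
    cuspPoint ∈ (amsCurve d L hL hd).points :=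
  eval_eqPair_of_x_z_zero _ cuspPoint_rep.1 cuspPoint_rep.2.2 _ (reverse_two_le hL)

lemma amsCurve_isSingularAt (hL : ∀ k ∈ L, 2 ≤ k) (hd : L.prod = d) (h2 : 2 < d) :
    (amsCurve d L hL hd).IsSingularAt cuspPoint := by
  refine ⟨cuspPoint_mem hL hd, fun i => ?_⟩
  have hM := reverse_two_le hL
  have hprod : L.reverse.prod = d := by rw [List.prod_reverse, hd]
  simp only [amsCurve]
  generalize L.reverse = M at hM hprod
  obtain ⟨hr0, -, hr2⟩ := cuspPoint_rep
  cases M with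
  | nil => simp at hprod; omega
  | cons n M =>
    have hn := hM n (by simp)
    have hM' : ∀ k ∈ M, 2 ≤ k := fun k hk => hM k (by simp [hk])
    -- The last step is z^N q_{r-1} - q_r^n, where q_r vanishes at the cusp; N ≥ 2 makes the
    -- z-derivative vanish too. Only for the conic is N = 1.
    have hk : 2 ≤ n * M.prod - M.tail.prod := by
      rw [List.prod_cons] at hprod
      cases M with
      | nil => simp at hprod ⊢; omega
      | cons m M =>
        have h3 : 1 ≤ M.prod := prod_pos_of_two_le fun k hk => hM' k (by simp [hk])
        have h4 : 2 ≤ m := hM' m (by simp)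
        simp only [List.prod_cons, List.tail_cons]
        have h5 : 2 * M.prod ≤ m * M.prod := Nat.mul_le_mul h4 le_rfl
        have h6 : 2 * (m * M.prod) ≤ n * (m * M.prod) := Nat.mul_le_mul hn le_rfl
        omega
    have hB := eval_eqPair_of_x_z_zero cuspPoint.rep hr0 hr2 M hM'
    simp only [eqPair, map_sub, Derivation.leibniz, Derivation.leibniz_pow, smul_eq_mul,
      nsmul_eq_mul, map_add, map_mul, map_pow, eval_X, hr2, hB]
    rw [zero_pow (by omega), zero_pow (by omega), zero_pow (by omega)]
    simp

lemma amsCurve_isSmooth (hL : ∀ k ∈ L, 2 ≤ k) (hd : L.prod = d) (h2 : d = 2) :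
    (amsCurve d L hL hd).IsSmooth := by
  intro p hp
  have hz := rep_z_eq_zero_of_isSingularAt hL hd hp
  obtain rfl := eq_cuspPoint_of_z_eq_zero hL hd hp.1 hz
  have hL2 : L = [2] := by
    rw [h2] at hd
    cases L with
    | nil => simp at hd
    | cons n L =>
      have hn := hL n (by simp)
      have hL' : ∀ k ∈ L, 2 ≤ k := fun k hk => hL k (by simp [hk])
      rw [List.prod_cons] at hd
      cases L with
      | nil => simp at hd; rw [hd]
      | cons m L =>
        have h3 : 1 ≤ L.prod := prod_pos_of_two_le fun k hk => hL' k (by simp [hk])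
        have h4 : 2 ≤ m := hL' m (by simp)
        rw [List.prod_cons] at hd
        have h5 : 2 * 1 ≤ m * L.prod := Nat.mul_le_mul h4 h3
        have h6 : 2 * 2 ≤ n * (m * L.prod) := Nat.mul_le_mul hn h5
        omega
  have h3 := hp.2 2
  subst hL2
  have h4 : pderiv 2 (X 0 : MvPolynomial (Fin 3) ℂ) = 0 := pderiv_X_of_ne (by decide)
  have h5 : pderiv 2 (X 1 : MvPolynomial (Fin 3) ℂ) = 0 := pderiv_X_of_ne (by decide)
  simp [amsCurve, eqPair, h4, h5] at h3
  exact cuspPoint_rep.2.1 h3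

/-- On the line x = 0 the first step gives c·z^{n-1}, and afterwards -q_i^n has smaller z-order than
the other term, so nothing cancels. The last inequality is the inductive invariant ensuring this; it
suffices for all n ≥ 2. -/
lemma eqPair_x_zero_order (c : ℂ) (hc : c ≠ 0) (M : List ℕ) (hM : ∀ k ∈ M, 2 ≤ k) (hne : M ≠ []) :
    ∃ (g : Polynomial ℂ) (j k : ℕ), g.eval 0 ≠ 0 ∧
      Polynomial.X ^ j ∣ (eqPair 0 (Polynomial.C c) Polynomial.X M).1 ∧
      (eqPair 0 (Polynomial.C c) Polynomial.X M).2 = Polynomial.X ^ k * g ∧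
      k < M.prod ∧ M.tail.prod + 2 * k < 2 * M.prod + j := by
  induction M with
  | nil => exact absurd rfl hne
  | cons n M ih =>
    have hn := hM n (by simp)
    have hM' : ∀ k ∈ M, 2 ≤ k := fun k hk => hM k (by simp [hk])
    by_cases h0 : M = []
    · subst h0
      refine ⟨Polynomial.C c, 1, n - 1, by simpa using hc, by simp [eqPair], ?_, ?_, ?_⟩
      · simp [eqPair, zero_pow (show n ≠ 0 by omega)]
      · simp; omega
      · simp; omega
    · obtain ⟨g, j, k, hg, ⟨a, ha⟩, hB, hk, hlt⟩ := ih hM' h0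
      have e1 : M.tail.prod < n * M.prod := tail_prod_lt hM' hn
      have hexp : n * k < n * M.prod - M.tail.prod + j := by
        obtain ⟨e, he⟩ : ∃ e, M.prod = k + e := ⟨M.prod - k, by omega⟩
        have h5 : n * M.prod = n * k + n * e := by rw [he]; ring
        have h6 : 2 * e ≤ n * e := Nat.mul_le_mul hn le_rfl
        omega
      obtain ⟨q, hq⟩ : ∃ q, n * M.prod - M.tail.prod + j = n * k + (q + 1) :=
        ⟨n * M.prod - M.tail.prod + j - n * k - 1, by omega⟩
      refine ⟨Polynomial.X ^ (q + 1) * a - g ^ n, k, n * k, ?_, ?_, ?_, ?_, ?_⟩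
      · simp [hg]
      · simp only [eqPair, hB]; exact Dvd.intro _ rfl
      · simp only [eqPair, hB, ha]
        rw [← mul_assoc, ← pow_add, hq, mul_pow, ← pow_mul, mul_comm k n, pow_add]; ring
      · simp only [List.prod_cons]
        exact Nat.mul_lt_mul_of_pos_left hk (by omega)
      · simp only [List.prod_cons, List.tail_cons]
        obtain ⟨e, he⟩ : ∃ e, M.prod = k + e := ⟨M.prod - k, by omega⟩
        have h5 : n * M.prod = n * k + n * e := by rw [he]; ring
        have h6 : 2 * e ≤ n * e := Nat.mul_le_mul hn le_rfl
        omega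

lemma lineMultiplicity_amsCurve (hL : ∀ k ∈ L, 2 ≤ k) (hd : L.prod = d) (v w : Fin 3 → ℂ) :
    (amsCurve d L hL hd).lineMultiplicity v w = emultiplicity (Polynomial.X : Polynomial ℂ)
      (eqPair (Polynomial.C (v 0) + Polynomial.C (w 0) * Polynomial.X)
        (Polynomial.C (v 1) + Polynomial.C (w 1) * Polynomial.X)
        (Polynomial.C (v 2) + Polynomial.C (w 2) * Polynomial.X) L.reverse).2 := by
  have := congrArg Prod.snd (map_eqPair (aeval (fun i => Polynomial.C (v i) +
    Polynomial.C (w i) * Polynomial.X) : MvPolynomial (Fin 3) ℂ →ₐ[ℂ] Polynomial ℂ).toRingHom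
    (X 0) (X 1) (X 2) L.reverse)
  simp only [AlgHom.toRingHom_eq_coe, RingHom.coe_coe, aeval_X] at this
  rw [this]
  rfl

lemma amsCurve_tangent (hL : ∀ k ∈ L, 2 ≤ k) (hd : L.prod = d) (h2 : 2 < d) :
    (amsCurve d L hL hd).TangentLineMeetsOnlyAt cuspPoint := by
  obtain ⟨h0, h1, hz⟩ := cuspPoint_rep
  have hM := reverse_two_le hL
  have hprod : L.reverse.prod = d := by rw [List.prod_reverse, hd]
  have hne : L.reverse ≠ [] := by rintro h; rw [h] at hprod; simp at hprod; omega
  -- The tangent is z = 0, with contact at least d; the line x = 0 meets the curve at the cusp with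
  -- smaller multiplicity.
  refine ⟨![1, 0, 0], ⟨cuspPoint_mem hL hd, ?_, ![0, 0, 1], ?_, ?_⟩, ?_⟩
  · rw [LinearIndependent.pair_iff]
    intro s t hst
    have e0 := congrFun hst 0
    have e1 := congrFun hst 1
    simp [h0, h1] at e0 e1
    exact ⟨e1, e0⟩
  · rw [LinearIndependent.pair_iff]
    intro s t hst
    have e0 := congrFun hst 2
    have e1 := congrFun hst 1
    simp [hz, h1] at e0 e1
    exact ⟨e1, e0⟩
  · rw [lineMultiplicity_amsCurve, lineMultiplicity_amsCurve]
    obtain ⟨ε, hε, hE⟩ := eqPair_z_zero (Polynomial.X : Polynomial ℂ)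
      (Polynomial.C (cuspPoint.rep 1)) L.reverse hM
    obtain ⟨g, j, k, hg, -, hB, hk, -⟩ := eqPair_x_zero_order _ h1 L.reverse hM hne
    simp only [h0, hz, Matrix.cons_val_zero, Matrix.cons_val_one, Matrix.cons_val, map_zero,
      map_one, zero_mul, one_mul, zero_add, add_zero]
    rw [hE, hB]
    have hXg : ¬ (Polynomial.X : Polynomial ℂ) ∣ g := by
      rwa [Polynomial.X_dvd_iff, Polynomial.coeff_zero_eq_eval_zero]
    have hlt : emultiplicity (Polynomial.X : Polynomial ℂ) (Polynomial.X ^ k * g) < L.reverse.prod := by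
      rw [emultiplicity_lt_iff_not_dvd]
      intro hdvd
      obtain ⟨q, hq⟩ : ∃ q, L.reverse.prod = k + (q + 1) := ⟨L.reverse.prod - k - 1, by omega⟩
      rw [hq, pow_add] at hdvd
      exact hXg ((dvd_pow_self _ (Nat.succ_ne_zero q)).trans
        ((mul_dvd_mul_iff_left (pow_ne_zero k Polynomial.X_ne_zero)).1 hdvd))
    refine lt_of_lt_of_le hlt ?_
    exact le_emultiplicity_of_pow_dvd (Dvd.intro_left _ rfl)
  · intro q hq hspan
    rw [Submodule.mem_span_pair] at hspan
    obtain ⟨a, b, hab⟩ := hspan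
    refine eq_cuspPoint_of_z_eq_zero hL hd hq ?_
    rw [← hab]
    simp [hz]
end

/-! ### The parametrization at the cusp and its Newton pairs. -/

noncomputable section

open MvPolynomial

variable {d : ℕ} {L : List ℕ}

/-- The standard affine chart centred at the cusp. -/
def cuspFrame : Fin 3 → Fin 3 → ℂ := ![![0, 1, 0], ![1, 0, 0], ![0, 0, 1]]

lemma isFrameAt_cuspFrame : IsFrameAt cuspFrame cuspPoint := by
  refine ⟨?_, cuspVec_ne_zero, rfl⟩
  rw [Fintype.linearIndependent_iff]
  intro g hg
  simp only [Fin.sum_univ_three] at hg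
  have e0 := congrFun hg 0
  have e1 := congrFun hg 1
  have e2 := congrFun hg 2
  simp [cuspFrame] at e0 e1 e2
  intro i; fin_cases i <;> assumption

lemma localEquation_cuspFrame (hL : ∀ k ∈ L, 2 ≤ k) (hd : L.prod = d) :
    (amsCurve d L hL hd).localEquation cuspFrame = (eqPair (X 0) 1 (X 1) L.reverse).2 := by
  have := congrArg Prod.snd (map_eqPair (aeval (fun i => C (cuspFrame 0 i) +
    C (cuspFrame 1 i) * X 0 + C (cuspFrame 2 i) * X 1) :
      MvPolynomial (Fin 3) ℂ →ₐ[ℂ] MvPolynomial (Fin 2) ℂ).toRingHom (X 0) (X 1) (X 2) L.reverse)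
  simp only [AlgHom.toRingHom_eq_coe, RingHom.coe_coe, aeval_X] at this
  simp only [cuspFrame, Matrix.cons_val_zero, Matrix.cons_val_one, Matrix.cons_val, map_zero,
      map_one, zero_mul, one_mul, zero_add, add_zero] at this
  rw [this]
  rfl

lemma aeval_localEquation (hL : ∀ k ∈ L, 2 ≤ k) (hd : L.prod = d) {R : Type*} [CommRing R]
    [Algebra ℂ R] (γ : Fin 2 → R) :
    aeval γ ((amsCurve d L hL hd).localEquation cuspFrame) = (eqPair (γ 0) 1 (γ 1) L.reverse).2 := by
  rw [localEquation_cuspFrame]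
  have := congrArg Prod.snd (map_eqPair (aeval γ : MvPolynomial (Fin 2) ℂ →ₐ[ℂ] R).toRingHom
    (X 0) 1 (X 1) L.reverse)
  simp only [AlgHom.toRingHom_eq_coe, RingHom.coe_coe, aeval_X, map_one] at this
  rw [this]

open PowerSeries in
/-- The parametrization `(x / y, 1 / y)` of the curve at infinity satisfies its equations. -/
lemma eqPair_cusp_series (hL : ∀ k ∈ L, 2 ≤ k) (hd : L.prod = d) :
    eqPair (PowerSeries.X ^ (d - L.tail.prod) * ((paramPair PowerSeries.X 1 L).2 *
      (paramPair PowerSeries.X 1 L).1⁻¹) : PowerSeries ℂ) 1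
      (PowerSeries.X ^ d * (paramPair PowerSeries.X 1 L).1⁻¹) L.reverse =
    ((paramPair PowerSeries.X 1 L).1⁻¹ ^ L.reverse.tail.prod *
      PowerSeries.X ^ (d * L.reverse.tail.prod - 1), 0) := by
  have hP₀ := (constantCoeff_paramPair L hL).1
  have hpair := eqPair_paramPair_homogeneous (PowerSeries.X : PowerSeries ℂ) 1 L.reverse []
    (reverse_two_le hL) (by simp)
  rw [reverse_reverseAux_nil, hd] at hpair
  have hsm := eqPair_homogeneous_smul (paramPair PowerSeries.X 1 L).1⁻¹
    (PowerSeries.X ^ (d - L.tail.prod) * (paramPair PowerSeries.X 1 L).2)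
    (paramPair PowerSeries.X 1 L).1 (PowerSeries.X ^ d : PowerSeries ℂ) L.reverse (reverse_two_le hL)
  rw [hpair, PowerSeries.inv_mul_cancel _ (by simp [hP₀])] at hsm
  have e1 : (paramPair PowerSeries.X 1 L).1⁻¹ *
      (PowerSeries.X ^ (d - L.tail.prod) * (paramPair PowerSeries.X 1 L).2) =
      (PowerSeries.X ^ (d - L.tail.prod) * ((paramPair PowerSeries.X 1 L).2 *
      (paramPair PowerSeries.X 1 L).1⁻¹) : PowerSeries ℂ) := by ring
  have e2 : (paramPair PowerSeries.X 1 L).1⁻¹ * (PowerSeries.X ^ d : PowerSeries ℂ) =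
    PowerSeries.X ^ d * (paramPair PowerSeries.X 1 L).1⁻¹ := by ring
  rw [e1, e2] at hsm
  rw [hsm]
  simp [paramPair]

lemma eqPair_subst_cusp_series (hL : ∀ k ∈ L, 2 ≤ k) (hd : L.prod = d) {S : PowerSeries ℂ}
    (hS : PowerSeries.constantCoeff S = 0) :
    eqPair (PowerSeries.subst S (PowerSeries.X ^ (d - L.tail.prod) *
      ((paramPair PowerSeries.X 1 L).2 * (paramPair PowerSeries.X 1 L).1⁻¹) : PowerSeries ℂ)) 1
      (PowerSeries.subst S (PowerSeries.X ^ d * (paramPair PowerSeries.X 1 L).1⁻¹ : PowerSeries ℂ))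
        L.reverse =
    (PowerSeries.subst S ((paramPair PowerSeries.X 1 L).1⁻¹ ^ L.reverse.tail.prod *
      PowerSeries.X ^ (d * L.reverse.tail.prod - 1) : PowerSeries ℂ), 0) := by
  have hSS : PowerSeries.HasSubst S := .of_constantCoeff_zero' hS
  have := map_eqPair (PowerSeries.substAlgHom (R := ℂ) hSS).toRingHom
    (PowerSeries.X ^ (d - L.tail.prod) * ((paramPair PowerSeries.X 1 L).2 *
      (paramPair PowerSeries.X 1 L).1⁻¹) : PowerSeries ℂ) 1
      (PowerSeries.X ^ d * (paramPair PowerSeries.X 1 L).1⁻¹) L.reverse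
  rw [eqPair_cusp_series hL hd, map_zero, map_one] at this
  simp only [AlgHom.toRingHom_eq_coe, RingHom.coe_coe, PowerSeries.coe_substAlgHom] at this
  exact this

lemma amsCurve_hasNewtonPairs (hL : ∀ k ∈ L, 2 ≤ k) (hd : L.prod = d) (h2 : 2 < d) :
    (amsCurve d L hL hd).HasNewtonPairsAt cuspPoint (amsNewtonPairs L) := by
  cases L with
  | nil => simp at hd; omega
  | cons n L =>
  obtain ⟨S, w, hS0, hS1, hu, hw, hex, hex'⟩ := exists_cusp_parametrization n L hL
  obtain ⟨a, ha⟩ : ∃ a, n * L.prod - L.prod = a := ⟨_, rfl⟩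
  have hn : 2 ≤ n := hL n (by simp)
  have hL' : ∀ k ∈ L, 2 ≤ k := fun k hk => hL k (by simp [hk])
  have hpos := prod_pos_of_two_le hL'
  have hd' : n * L.prod = d := by rw [← hd, List.prod_cons]
  have ha1 : 1 < a := by
    by_cases hn2 : n = 2
    · subst hn2; omega
    · have : 3 * L.prod ≤ n * L.prod := Nat.mul_le_mul (by omega) le_rfl
      omega
  have heq := eqPair_subst_cusp_series hL hd hS0
  rw [List.tail_cons, ← hd', hu, hw] at heq
  have hSS : PowerSeries.HasSubst S := .of_constantCoeff_zero' hS0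
  have hw0 : PowerSeries.constantCoeff w = 0 := by
    rw [← hw, PowerSeries.constantCoeff_subst_of_zero hS0]
    have : d ≠ 0 := by omega
    simp [hd', this]
  -- A(X^a) collects the terms of w whose exponents are divisible by a. Subtracting A of the first
  -- coordinate removes them by a change of coordinates, so that the least exponent left is not
  -- divisible by a; exponents not divisible by a divisor g of a are unchanged.
  set A : PowerSeries ℂ := PowerSeries.mk fun k => PowerSeries.coeff (k * a) w with hA
  set y : PowerSeries ℂ := w - A.subst (PowerSeries.X ^ a : PowerSeries ℂ) with hy
  have hycoeff : ∀ b, PowerSeries.coeff b y = if a ∣ b then 0 else PowerSeries.coeff b w := by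
    intro b
    rw [hy, map_sub, PowerSeries.coeff_subst_X_pow (by omega)]
    split_ifs with hab
    · rw [hA, PowerSeries.coeff_mk, Nat.div_mul_cancel hab]
      exact sub_self _
    · rw [sub_zero]
  have hset : ∀ g, g ∣ a → {b ∈ exponents y | ¬ g ∣ b} = {b ∈ exponents w | ¬ g ∣ b} := by
    intro g hg
    ext b
    simp only [exponents, Set.mem_ofPred_eq, hycoeff]
    constructor
    · rintro ⟨h1, h3⟩
      split_ifs at h1 with hab
      · exact absurd rfl h1
      · exact ⟨h1, h3⟩
    · rintro ⟨h1, h3⟩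
      rw [if_neg fun hab => h3 (hg.trans hab)]
      exact ⟨h1, h3⟩
  rw [ha] at hex
  obtain ⟨hNP, b₁, hab₁, hb₁⟩ := newtonPairsFrom_amsNewtonPairs (E := exponents y) n L hL
    (by rw [List.prod_cons, hd']; exact h2) (by rw [ha, hset a dvd_rfl]; exact hex)
    (by
      intro pre m rest hLe
      rw [hset _ ?_]
      · exact hex' pre m rest hLe
      · have : (m :: rest).prod ∣ L.prod := by
          rw [hLe, List.prod_append]; exact Dvd.intro_left _ rfl
        rw [← ha]
        exact Nat.dvd_sub (this.mul_left n) this)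
  rw [ha] at hNP hab₁ hb₁
  set γ : Fin 2 → PowerSeries ℂ := ![PowerSeries.X ^ a, w] with hγ
  have hγ0 : ∀ i, PowerSeries.constantCoeff (γ i) = 0 := by
    intro i; fin_cases i
    · have : a ≠ 0 := by omega
      simp [hγ, this]
    · exact hw0
  have hγs : MvPowerSeries.HasSubst γ := MvPowerSeries.hasSubst_of_constantCoeff_zero hγ0
  have hX0 : PowerSeries.HasSubst (MvPowerSeries.X 0 : MvPowerSeries (Fin 2) ℂ) :=
    PowerSeries.HasSubst.X 0
  refine ⟨cuspFrame, γ, ![MvPowerSeries.X 0, MvPowerSeries.X 1 -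
    A.subst (MvPowerSeries.X 0 : MvPowerSeries (Fin 2) ℂ)], a, b₁, y, isFrameAt_cuspFrame, hγ0,
    ?_, ⟨?_, ?_⟩, ?_, ?_, ha1, hab₁, ?_, hb₁.1.2, hNP⟩
  · rw [aeval_localEquation]
    have hgoal := congrArg Prod.snd heq
    rw [ha] at hgoal
    exact hgoal
  · intro i; fin_cases i
    · simp
    · have hA0 : PowerSeries.constantCoeff A = 0 := by
        rw [← PowerSeries.coeff_zero_eq_constantCoeff_apply, hA, PowerSeries.coeff_mk, zero_mul,
          PowerSeries.coeff_zero_eq_constantCoeff_apply, hw0]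
      have := PowerSeries.constantCoeff_subst_eq_zero
        (a := (MvPowerSeries.X 0 : MvPowerSeries (Fin 2) ℂ)) (by simp) A hA0
      simp only [Fin.mk_one, Matrix.cons_val_one, Matrix.cons_val_fin_one, map_sub, this]
      simp
  · rw [Matrix.det_fin_two]
    have e1 : (Finsupp.single (1 : Fin 2) 1 : Fin 2 →₀ ℕ) ≠
        Finsupp.single 0 ((Finsupp.single (1 : Fin 2) 1 : Fin 2 →₀ ℕ) 0) := by
      intro h
      have := DFunLike.congr_fun h 1
      simp at this
    simp only [Matrix.of_apply, Matrix.cons_val_zero, Matrix.cons_val_one, Matrix.cons_val_fin_one,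
      map_sub, PowerSeries.coeff_subst_single, if_neg e1]
    simp [MvPowerSeries.coeff_X, Finsupp.single_left_inj]
  · simp only [Matrix.cons_val_zero]
    rw [MvPowerSeries.subst_X hγs]
    rfl
  · simp only [Matrix.cons_val_one, Matrix.cons_val_fin_one]
    rw [MvPowerSeries.subst_sub hγs, MvPowerSeries.subst_X hγs, PowerSeries.subst,
      MvPowerSeries.subst_comp_subst_apply hX0.const hγs]
    simp only [MvPowerSeries.subst_X hγs]
    rfl
  · refine ⟨hb₁.1.1, fun b hb => hb₁.2 ⟨hb, fun hab => hb ?_⟩⟩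
    rw [hycoeff, if_pos hab]
end

/-! ### Local irreducibility at the cusp. -/

noncomputable section

namespace MvPowerSeries

/-- Evaluation of a power series in two variables on the graph of `a`. -/
def onGraph (a : PowerSeries ℂ) (G : MvPowerSeries (Fin 2) ℂ) : PowerSeries ℂ :=
  subst ![a, PowerSeries.X] G

lemma hasSubst_pair {τ : Type*} {a b : MvPowerSeries τ ℂ} (ha : constantCoeff a = 0)
    (hb : constantCoeff b = 0) : HasSubst ![a, b] :=
  hasSubst_of_constantCoeff_zero (by intro i; fin_cases i <;> assumption)

lemma hasSubst_graph {a : PowerSeries ℂ} (ha : PowerSeries.constantCoeff a = 0) :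
    HasSubst (τ := Unit) (S := ℂ) ![a, PowerSeries.X] :=
  hasSubst_pair ha PowerSeries.constantCoeff_X

/-- `a`, regarded as a power series in the second variable. -/
def inSecond (a : PowerSeries ℂ) : MvPowerSeries (Fin 2) ℂ :=
  PowerSeries.subst (X 1 : MvPowerSeries (Fin 2) ℂ) a

lemma constantCoeff_inSecond {a : PowerSeries ℂ} (ha : PowerSeries.constantCoeff a = 0) :
    constantCoeff (inSecond a) = 0 :=
  PowerSeries.constantCoeff_subst_eq_zero (by simp) a ha

lemma subst_inSecond {τ : Type*} {b c : MvPowerSeries τ ℂ} (hb : constantCoeff b = 0)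
    (hc : constantCoeff c = 0) (a : PowerSeries ℂ) :
    subst ![b, c] (inSecond a) = PowerSeries.subst c a := by
  have h := hasSubst_pair hb hc
  rw [inSecond, PowerSeries.subst, subst_comp_subst_apply (PowerSeries.HasSubst.X 1).const h]
  simp only [subst_X h]
  rfl

lemma onGraph_inSecond {b : PowerSeries ℂ} (hb : PowerSeries.constantCoeff b = 0)
    (a : PowerSeries ℂ) : onGraph b (inSecond a) = a := by
  rw [onGraph, subst_inSecond hb PowerSeries.constantCoeff_X]
  exact PowerSeries.X_subst a

lemma X_dvd_sub_onGraph_zero (K : MvPowerSeries (Fin 2) ℂ) :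
    X 0 ∣ K - inSecond (onGraph 0 K) := by
  set k : PowerSeries ℂ := PowerSeries.mk fun j => coeff (Finsupp.single 1 j) K with hk
  have h1 : X 0 ∣ K - inSecond k := by
    rw [X_dvd_iff]
    intro m hm
    have : m = Finsupp.single 1 (m 1) := by
      ext i; fin_cases i <;> simp [hm]
    rw [map_sub, inSecond, PowerSeries.coeff_subst_single, if_pos this, hk, PowerSeries.coeff_mk,
      ← this, sub_self]
  obtain ⟨q, hq⟩ := h1
  have h0 : HasSubst (τ := Unit) (S := ℂ) ![(0 : PowerSeries ℂ), PowerSeries.X] :=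
    hasSubst_graph (map_zero _)
  have h2 : onGraph 0 K = k := by
    have h3 := congrArg (onGraph 0) hq
    simp only [onGraph] at h3
    rw [subst_sub h0, subst_mul h0, subst_X h0] at h3
    simp only [Matrix.cons_val_zero, zero_mul] at h3
    rw [sub_eq_zero] at h3
    rw [onGraph, h3]
    exact onGraph_inSecond (map_zero _) k
  rw [h2]
  exact ⟨q, hq⟩

/-- A factor theorem: the translation X 0 ↦ X 0 + a reduces it to the case a = 0. -/
lemma dvd_of_onGraph_eq_zero {a : PowerSeries ℂ} (ha : PowerSeries.constantCoeff a = 0)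
    {G : MvPowerSeries (Fin 2) ℂ} (hG : onGraph a G = 0) : X 0 - inSecond a ∣ G := by
  have ha' := constantCoeff_inSecond ha
  have h1 : HasSubst ![X 0 + inSecond a, X 1] :=
    hasSubst_pair (by simp [ha']) (by simp)
  have h2 : HasSubst ![X 0 - inSecond a, X 1] :=
    hasSubst_pair (by simp [ha']) (by simp)
  have h0 : HasSubst (τ := Unit) (S := ℂ) ![(0 : PowerSeries ℂ), PowerSeries.X] :=
    hasSubst_graph (map_zero _)
  have h3 : onGraph 0 (subst ![X 0 + inSecond a, X 1] G) = 0 := by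
    rw [onGraph, subst_comp_subst_apply h1 h0]
    refine Eq.trans ?_ hG
    rw [onGraph]
    congr 1
    ext i : 1
    fin_cases i
    · have := onGraph_inSecond (b := 0) (map_zero _) a
      rw [onGraph] at this
      simp only [Fin.zero_eta, Matrix.cons_val_zero, subst_add h0, subst_X h0, this, zero_add]
    · simp only [Fin.mk_one, Matrix.cons_val_one, Matrix.cons_val_fin_one, subst_X h0]
  have h4 := X_dvd_sub_onGraph_zero (subst ![X 0 + inSecond a, X 1] G)
  rw [h3] at h4
  have hz : inSecond 0 = 0 := by
    rw [inSecond, ← PowerSeries.coe_substAlgHom (PowerSeries.HasSubst.X 1), map_zero]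
  rw [hz, sub_zero] at h4
  obtain ⟨q, hq⟩ := h4
  have h5 := congrArg (subst ![X 0 - inSecond a, X 1]) hq
  rw [subst_comp_subst_apply h1 h2, subst_mul h2, subst_X h2] at h5
  have h6 : (fun s => subst ![X 0 - inSecond a, X 1] ((![X 0 + inSecond a, X 1] :
      Fin 2 → MvPowerSeries (Fin 2) ℂ) s)) = X := by
    ext i : 1
    fin_cases i
    · simp only [Fin.zero_eta, Matrix.cons_val_zero, subst_add h2, subst_X h2]
      rw [subst_inSecond (by simp [ha']) (by simp)]
      exact sub_add_cancel _ _
    · simp only [Fin.mk_one, Matrix.cons_val_one, Matrix.cons_val_fin_one, subst_X h2]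
  rw [h6, subst_self, id] at h5
  rw [h5]
  exact Dvd.intro _ rfl

lemma prod_dvd_of_onGraph_eq_zero (s : Finset (PowerSeries ℂ))
    (hs : ∀ a ∈ s, PowerSeries.constantCoeff a = 0) (G : MvPowerSeries (Fin 2) ℂ)
    (hG : ∀ a ∈ s, onGraph a G = 0) : ∏ a ∈ s, (X 0 - inSecond a) ∣ G := by
  classical
  induction s using Finset.induction_on generalizing G with
  | empty => simp
  | insert b s hb ih =>
    have hb0 := hs b (Finset.mem_insert_self b s)
    obtain ⟨K, rfl⟩ := dvd_of_onGraph_eq_zero hb0 (hG b (Finset.mem_insert_self b s))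
    rw [Finset.prod_insert hb]
    refine mul_dvd_mul_left _ (ih (fun a ha => hs a (Finset.mem_insert_of_mem ha)) K fun a ha => ?_)
    have ha0 := hs a (Finset.mem_insert_of_mem ha)
    have h1 := hG a (Finset.mem_insert_of_mem ha)
    have hg := hasSubst_graph ha0
    have h2 : onGraph a (X 0 - inSecond b) = a - b := by
      have := onGraph_inSecond ha0 b
      rw [onGraph] at this
      rw [onGraph, subst_sub hg, this, subst_X hg]
      rfl
    rw [onGraph, subst_mul hg] at h1
    rw [onGraph] at h2
    rw [h2] at h1
    have hab : (a - b : PowerSeries ℂ) ≠ 0 := by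
      rw [sub_ne_zero]; rintro rfl; exact hb ha
    exact ((mul_eq_zero (M₀ := PowerSeries ℂ)).1 h1).resolve_left hab

lemma constantCoeff_subst_of_zero {τ : Type*} {a b : MvPowerSeries τ ℂ}
    (ha : constantCoeff a = 0) (hb : constantCoeff b = 0) (H : MvPowerSeries (Fin 2) ℂ) :
    constantCoeff (subst ![a, b] H) = constantCoeff H := by
  have h := hasSubst_pair ha hb
  have h1 := constantCoeff_subst_eq_zero h (by intro i; fin_cases i <;> assumption)
    (f := H - C (constantCoeff H)) (by simp)
  rw [subst_sub h, map_sub, subst_C, constantCoeff_C, sub_eq_zero] at h1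
  exact h1

/-- A factor of a series vanishing along `(u, τ ^ d)`, where `u` has `d` distinct conjugates. -/
lemma X_pow_dvd_of_conjugates {d : ℕ} (hd : d ≠ 0) {u : PowerSeries ℂ}
    (hu : PowerSeries.constantCoeff u = 0)
    (hinj : ∀ ζ ζ' : ℂ, ζ ^ d = 1 → ζ' ^ d = 1 → PowerSeries.rescale ζ u = PowerSeries.rescale ζ' u →
      ζ = ζ') {G : MvPowerSeries (Fin 2) ℂ}
    (hG : subst ![u, (PowerSeries.X : PowerSeries ℂ) ^ d] G = (0 : PowerSeries ℂ)) :
    (PowerSeries.X : PowerSeries ℂ) ^ d ∣ subst ![PowerSeries.X, (0 : PowerSeries ℂ)] G := by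
  classical
  have hXd : PowerSeries.constantCoeff ((PowerSeries.X : PowerSeries ℂ) ^ d) = 0 := by simp [hd]
  have hXd' : constantCoeff ((X 1 : MvPowerSeries (Fin 2) ℂ) ^ d) = 0 := by simp [hd]
  have hud : HasSubst (τ := Unit) (S := ℂ) ![u, (PowerSeries.X : PowerSeries ℂ) ^ d] :=
    hasSubst_pair hu hXd
  have hpow : HasSubst ![(X 0 : MvPowerSeries (Fin 2) ℂ), X 1 ^ d] := hasSubst_pair (by simp) hXd'
  set s : Finset (PowerSeries ℂ) :=
    (Polynomial.nthRootsFinset d (1 : ℂ)).image fun ζ => PowerSeries.rescale ζ u with hs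
  have hcard : s.card = d := by
    rw [hs, Finset.card_image_of_injOn, (Complex.isPrimitiveRoot_exp d hd).card_nthRootsFinset]
    intro ζ hζ ζ' hζ' h
    exact hinj ζ ζ' ((Polynomial.mem_nthRootsFinset (Nat.pos_of_ne_zero hd) 1).1 hζ)
      ((Polynomial.mem_nthRootsFinset (Nat.pos_of_ne_zero hd) 1).1 hζ') h
  have hs0 : ∀ a ∈ s, PowerSeries.constantCoeff a = 0 := by
    intro a ha
    obtain ⟨ζ, -, rfl⟩ := Finset.mem_image.1 ha
    rw [← PowerSeries.coeff_zero_eq_constantCoeff_apply, PowerSeries.coeff_rescale,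
      PowerSeries.coeff_zero_eq_constantCoeff_apply, hu, mul_zero]
  -- The rotation τ ↦ ζτ fixes τ^d, so it carries the relation for u to its conjugates. The d
  -- conjugates are distinct roots, and each linear factor becomes X when the second variable is set
  -- to 0.
  have hroot : ∀ a ∈ s, onGraph a (subst ![(X 0 : MvPowerSeries (Fin 2) ℂ), X 1 ^ d] G) = 0 := by
    intro a ha
    have hg := hasSubst_graph (hs0 a ha)
    obtain ⟨ζ, hζ, rfl⟩ := Finset.mem_image.1 ha
    have hζ1 : ζ ^ d = 1 := (Polynomial.mem_nthRootsFinset (Nat.pos_of_ne_zero hd) 1).1 hζ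
    have hζX : PowerSeries.HasSubst (ζ • PowerSeries.X : PowerSeries ℂ) :=
      PowerSeries.HasSubst.smul_X' ζ
    have h1 := congrArg (PowerSeries.rescale ζ) hG
    rw [map_zero, PowerSeries.rescale_eq_subst, PowerSeries.subst,
      subst_comp_subst_apply hud hζX.const] at h1
    rw [onGraph, subst_comp_subst_apply hpow hg, ← h1]
    congr 1
    ext i : 1
    fin_cases i
    · simp only [Fin.zero_eta, Matrix.cons_val_zero, subst_X hg]
      rw [PowerSeries.rescale_eq_subst]
      rfl
    · simp only [Fin.mk_one, Matrix.cons_val_one, Matrix.cons_val_fin_one, subst_pow hg, subst_X hg]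
      have : PowerSeries.subst (ζ • PowerSeries.X : PowerSeries ℂ)
          ((PowerSeries.X : PowerSeries ℂ) ^ d) = (PowerSeries.X : PowerSeries ℂ) ^ d := by
        rw [PowerSeries.subst_pow hζX, PowerSeries.subst_X hζX, smul_pow, hζ1, one_smul]
      exact this.symm
  obtain ⟨q, hq⟩ := prod_dvd_of_onGraph_eq_zero s hs0 _ hroot
  have hax : HasSubst (τ := Unit) (S := ℂ) ![PowerSeries.X, (0 : PowerSeries ℂ)] :=
    hasSubst_pair PowerSeries.constantCoeff_X (map_zero _)
  have h2 := congrArg (subst ![PowerSeries.X, (0 : PowerSeries ℂ)]) hq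
  rw [subst_comp_subst_apply hpow hax, subst_mul hax, ← coe_substAlgHom hax, map_prod,
    coe_substAlgHom] at h2
  have h3 : (fun i => subst ![PowerSeries.X, (0 : PowerSeries ℂ)]
      ((![X 0, X 1 ^ d] : Fin 2 → MvPowerSeries (Fin 2) ℂ) i)) =
      (![PowerSeries.X, (0 : PowerSeries ℂ)] : Fin 2 → PowerSeries ℂ) := by
    ext i : 1
    fin_cases i
    · simp only [Fin.zero_eta, Matrix.cons_val_zero, subst_X hax]
    · simp only [Fin.mk_one, Matrix.cons_val_one, Matrix.cons_val_fin_one, subst_pow hax,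
        subst_X hax, zero_pow hd]
  have h4 : ∀ a ∈ s, subst ![PowerSeries.X, (0 : PowerSeries ℂ)] (X 0 - inSecond a) =
      (PowerSeries.X : PowerSeries ℂ) := by
    intro a ha
    rw [subst_sub hax, subst_X hax, subst_inSecond PowerSeries.constantCoeff_X (map_zero _)]
    have : PowerSeries.subst (0 : PowerSeries ℂ) a = (0 : PowerSeries ℂ) :=
      PowerSeries.subst_zero_of_constantCoeff_zero (hs0 a ha)
    rw [this]
    exact sub_zero _
  rw [h3, Finset.prod_congr rfl h4, Finset.prod_const, hcard] at h2
  exact ⟨_, h2⟩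

end MvPowerSeries

variable {d : ℕ} {L : List ℕ}

open MvPowerSeries in
-- In a factorization one factor vanishes on the branch (u, τ^d), so its restriction to z = 0 is
-- divisible by X^d. The equation restricts there to a unit times X^d, so the other factor has
-- nonzero constant term.
lemma amsCurve_isLocallyIrreducibleAt (hL : ∀ k ∈ L, 2 ≤ k) (hd : L.prod = d) (h2 : 2 < d) :
    (amsCurve d L hL hd).IsLocallyIrreducibleAt cuspPoint := by
  refine ⟨cuspFrame, isFrameAt_cuspFrame, ?_⟩
  have hF : ((amsCurve d L hL hd).localEquation cuspFrame : MvPowerSeries (Fin 2) ℂ) =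
      (eqPair (X 0) 1 (X 1) L.reverse).2 := by
    have := congrArg Prod.snd (map_eqPair (MvPolynomial.coeToMvPowerSeries.ringHom (σ := Fin 2)
      (R := ℂ)) (MvPolynomial.X 0) 1 (MvPolynomial.X 1) L.reverse)
    simp only [map_one, MvPolynomial.coeToMvPowerSeries.ringHom_apply, MvPolynomial.coe_X] at this
    rw [localEquation_cuspFrame, this]
  rw [hF]
  set F : MvPowerSeries (Fin 2) ℂ := (eqPair (X 0) 1 (X 1) L.reverse).2 with hFdef
  have hP₀ := (constantCoeff_paramPair L hL).1
  have htl : L.tail.prod < d := by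
    cases L with
    | nil => simp at hd; omega
    | cons n L =>
      have hn : 2 ≤ n := hL n (by simp)
      have hpos : 0 < L.prod := prod_pos_of_two_le fun k hk => hL k (by simp [hk])
      rw [List.prod_cons] at hd
      have : 2 * L.prod ≤ n * L.prod := Nat.mul_le_mul hn le_rfl
      rw [List.tail_cons]; omega
  obtain ⟨S, T, hS0, hS1, hT0, hTS, hST, hTP, -⟩ :=
    PowerSeries.exists_uniformizer hP₀ (show d ≠ 0 by omega)
  have hSS : PowerSeries.HasSubst S := .of_constantCoeff_zero' hS0
  set P₀ := (paramPair (PowerSeries.X : PowerSeries ℂ) 1 L).1 with hP₀def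
  set P₁ := (paramPair (PowerSeries.X : PowerSeries ℂ) 1 L).2 with hP₁def
  have hi₀ : P₀ * P₀⁻¹ = 1 := PowerSeries.mul_inv_cancel _ (by simp [hP₀])
  have hw : PowerSeries.subst S (PowerSeries.X ^ d * P₀⁻¹ : PowerSeries ℂ) =
      (PowerSeries.X ^ d : PowerSeries ℂ) := by
    have : PowerSeries.X ^ d * P₀⁻¹ = T ^ d := by
      rw [← hTP, mul_assoc, hi₀, mul_one]
    rw [this, PowerSeries.subst_pow hSS, hTS]
  set u : PowerSeries ℂ :=
    PowerSeries.subst S (PowerSeries.X ^ (d - L.tail.prod) * (P₁ * P₀⁻¹) : PowerSeries ℂ) with hudef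
  have hu0 : PowerSeries.constantCoeff u = 0 := by
    rw [hudef, PowerSeries.constantCoeff_subst_of_zero hS0]
    have : d - L.tail.prod ≠ 0 := by omega
    simp [this]
  have heq := eqPair_subst_cusp_series hL hd hS0
  rw [← hP₀def, ← hP₁def, hw, ← hudef] at heq
  set e := L.reverse.tail.prod with he
  have he0 : 0 < e := prod_pos_of_two_le (tail_two_le (reverse_two_le hL))
  set f : PowerSeries ℂ := PowerSeries.subst S
    (P₀⁻¹ ^ e * PowerSeries.X ^ (d * e - 1) : PowerSeries ℂ) with hf
  have hSf : S * f = PowerSeries.X ^ (d * e) := by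
    have h1 : PowerSeries.X * (P₀⁻¹ ^ e * PowerSeries.X ^ (d * e - 1)) =
        (PowerSeries.X ^ d * P₀⁻¹) ^ e := by
      have : d * e = d * e - 1 + 1 := (Nat.sub_add_cancel (Nat.mul_pos (by omega) he0)).symm
      rw [mul_pow, ← pow_mul]
      conv_rhs => rw [this, pow_succ]
      ring
    have h2 := congrArg (PowerSeries.subst S) h1
    rw [PowerSeries.subst_mul hSS, PowerSeries.subst_X hSS, PowerSeries.subst_pow hSS, hw,
      ← pow_mul] at h2
    exact h2
  -- The value f of q_r on the branch is a polynomial in u and τ^d, and S·f = τ^{de}. So equal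
  -- conjugates of u give equal conjugates of S, whose linear coefficient is nonzero.
  have hinj : ∀ ζ ζ' : ℂ, ζ ^ d = 1 → ζ' ^ d = 1 →
      PowerSeries.rescale ζ u = PowerSeries.rescale ζ' u → ζ = ζ' := by
    intro ζ ζ' hζ hζ' h
    have hXd : ∀ z : ℂ, z ^ d = 1 → PowerSeries.rescale z (PowerSeries.X ^ d) =
        (PowerSeries.X ^ d : PowerSeries ℂ) := by
      intro z hz
      rw [map_pow, PowerSeries.rescale_X, mul_pow, ← map_pow, hz, map_one, one_mul]
    have hfr : ∀ z : ℂ, z ^ d = 1 → PowerSeries.rescale z f =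
        (eqPair (PowerSeries.rescale z u) 1 (PowerSeries.X ^ d) L.reverse).1 := by
      intro z hz
      have := congrArg Prod.fst
        (map_eqPair (PowerSeries.rescale z) u 1 (PowerSeries.X ^ d) L.reverse)
      rw [hXd z hz, map_one, heq] at this
      exact this.symm
    have hff : PowerSeries.rescale ζ f = PowerSeries.rescale ζ' f := by
      rw [hfr ζ hζ, hfr ζ' hζ', h]
    have hSr : ∀ z : ℂ, z ^ d = 1 → PowerSeries.rescale z S * PowerSeries.rescale z f =
        PowerSeries.X ^ (d * e) := by
      intro z hz
      rw [← map_mul, hSf, pow_mul, map_pow, hXd z hz]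
    have h1 := hSr ζ hζ
    have h3 := hSr ζ' hζ'
    rw [← hff] at h3
    have hne : PowerSeries.rescale ζ f ≠ 0 := by
      intro h0
      rw [h0, mul_zero] at h1
      exact pow_ne_zero _ PowerSeries.X_ne_zero h1.symm
    have h4 := congrArg (PowerSeries.coeff 1) (mul_right_cancel₀ hne (h1.trans h3.symm))
    rw [PowerSeries.coeff_rescale, PowerSeries.coeff_rescale, pow_one, pow_one] at h4
    exact mul_right_cancel₀ hS1 h4
  have hXd : PowerSeries.constantCoeff ((PowerSeries.X : PowerSeries ℂ) ^ d) = 0 := by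
    have : d ≠ 0 := by omega
    simp [this]
  have hud : HasSubst (τ := Unit) (S := ℂ) ![u, (PowerSeries.X : PowerSeries ℂ) ^ d] :=
    hasSubst_pair hu0 hXd
  have hax : HasSubst (τ := Unit) (S := ℂ) ![PowerSeries.X, (0 : PowerSeries ℂ)] :=
    hasSubst_pair PowerSeries.constantCoeff_X (map_zero _)
  have hsubF : ∀ (a b : PowerSeries ℂ), HasSubst (τ := Unit) (S := ℂ) ![a, b] →
      subst ![a, b] F = (eqPair a 1 b L.reverse).2 := by
    intro a b hab
    have := congrArg Prod.snd (map_eqPair (substAlgHom (R := ℂ) hab).toRingHom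
      (X 0) 1 (X 1) L.reverse)
    simp only [AlgHom.toRingHom_eq_coe, RingHom.coe_coe, map_one, coe_substAlgHom,
      subst_X hab] at this
    exact this.symm
  have hFγ : subst ![u, (PowerSeries.X : PowerSeries ℂ) ^ d] F = (0 : PowerSeries ℂ) := by
    rw [hsubF _ _ hud]
    exact congrArg Prod.snd heq
  obtain ⟨ε, hε, hFax⟩ := eqPair_z_zero (PowerSeries.X : PowerSeries ℂ) 1 L.reverse
    (reverse_two_le hL)
  rw [List.prod_reverse, hd] at hFax
  have key : ∀ G H : MvPowerSeries (Fin 2) ℂ, F = G * H →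
      subst ![u, (PowerSeries.X : PowerSeries ℂ) ^ d] G = (0 : PowerSeries ℂ) → IsUnit H := by
    intro G H hGH hG
    obtain ⟨q, hq⟩ := X_pow_dvd_of_conjugates (by omega) hu0 hinj hG
    have h1 := hsubF _ _ hax
    rw [hFax, hGH, subst_mul hax, hq] at h1
    have h3 : (PowerSeries.X : PowerSeries ℂ) ^ d *
        (q * subst ![PowerSeries.X, (0 : PowerSeries ℂ)] H) = PowerSeries.X ^ d * ε := by
      rw [← mul_assoc, mul_comm _ ε]; exact h1
    have h4 := mul_left_cancel₀ (pow_ne_zero d PowerSeries.X_ne_zero) h3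
    have h5 : IsUnit (subst ![PowerSeries.X, (0 : PowerSeries ℂ)] H) :=
      isUnit_of_mul_isUnit_right (h4 ▸ hε)
    rw [MvPowerSeries.isUnit_iff_constantCoeff]
    rw [MvPowerSeries.isUnit_iff_constantCoeff,
      constantCoeff_subst_of_zero PowerSeries.constantCoeff_X (map_zero _)] at h5
    exact h5
  refine ⟨fun hu => ?_, fun G H hGH => ?_⟩
  · have := hu.map (substAlgHom (R := ℂ) hud)
    rw [coe_substAlgHom, hFγ] at this
    exact not_isUnit_zero this
  · have h1 := hFγ
    rw [hGH, subst_mul hud] at h1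
    rcases (mul_eq_zero (M₀ := PowerSeries ℂ)).1 h1 with h3 | h3
    · exact Or.inr (key G H hGH h3)
    · exact Or.inl (key H G (by rw [hGH, mul_comm]) h3)
end

/-! ### Orders of vanishing at the cusp. -/

noncomputable section

section Weights

open Polynomial

/-- Total degree at most `k`, for polynomials in `y` (inner variable) and `x` (outer variable). -/
def TotalDegreeLE (k : ℕ) (f : ℂ[X][X]) : Prop :=
  ∀ i j, k < i + j → (f.coeff j).coeff i = 0

lemma TotalDegreeLE.sub {k : ℕ} {f g : ℂ[X][X]} (hf : TotalDegreeLE k f)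
    (hg : TotalDegreeLE k g) : TotalDegreeLE k (f - g) := by
  intro i j h
  rw [coeff_sub, coeff_sub, hf i j h, hg i j h, sub_zero]

lemma TotalDegreeLE.add {k : ℕ} {f g : ℂ[X][X]} (hf : TotalDegreeLE k f)
    (hg : TotalDegreeLE k g) : TotalDegreeLE k (f + g) := by
  intro i j h
  rw [coeff_add, coeff_add, hf i j h, hg i j h, zero_add]

lemma TotalDegreeLE.sum {ι : Type*} {k : ℕ} (s : Finset ι) {f : ι → ℂ[X][X]}
    (hf : ∀ a ∈ s, TotalDegreeLE k (f a)) : TotalDegreeLE k (∑ a ∈ s, f a) := by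
  intro i j h
  rw [finsetSum_coeff, finsetSum_coeff]
  exact Finset.sum_eq_zero fun a ha => hf a ha i j h

lemma TotalDegreeLE.mul {k l : ℕ} {f g : ℂ[X][X]} (hf : TotalDegreeLE k f)
    (hg : TotalDegreeLE l g) : TotalDegreeLE (k + l) (f * g) := by
  intro i j h
  rw [coeff_mul, finsetSum_coeff]
  refine Finset.sum_eq_zero fun p hp => ?_
  rw [coeff_mul]
  refine Finset.sum_eq_zero fun q hq => ?_
  rw [Finset.HasAntidiagonal.mem_antidiagonal] at hp hq
  by_cases h1 : k < q.1 + p.1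
  · rw [hf _ _ h1, zero_mul]
  · rw [hg q.2 p.2 (by omega), mul_zero]

/-- Division with remainder by a polynomial which is monic in `x` up to a scalar. -/
lemma exists_div_of_totalDegreeLE {q : ℂ[X][X]} {N : ℕ} (hN : q.natDegree = N)
    (hu : IsUnit q.leadingCoeff) (hq : TotalDegreeLE N q) {k : ℕ} (f : ℂ[X][X])
    (hf : TotalDegreeLE k f) :
    ∃ g r : ℂ[X][X], f = q * g + r ∧ r.degree < N ∧
      (g = 0 ∨ ∃ l, l + N = k ∧ TotalDegreeLE l g) := by
  obtain ⟨u, hu0, hu'⟩ := Polynomial.isUnit_iff.1 hu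
  have hu1 : u ≠ 0 := hu0.ne_zero
  induction hn : f.natDegree using Nat.strong_induction_on generalizing f with
  | _ n ih =>
    by_cases hlt : f.degree < N
    · exact ⟨0, f, by simp, hlt, Or.inl rfl⟩
    have hf0 : f ≠ 0 := by rintro rfl; simp at hlt
    have hNn : N ≤ n := by
      rw [not_lt, degree_eq_natDegree hf0, hn] at hlt
      exact_mod_cast hlt
    set c := f.leadingCoeff with hc
    have hc0 : c ≠ 0 := leadingCoeff_ne_zero.2 hf0
    set m : ℂ[X][X] := C (C u⁻¹ * c) * X ^ (n - N) with hm
    have hnk : n ≤ k := by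
      by_contra h
      have := hf c.natDegree n (by omega)
      rw [← hn] at this
      exact leadingCoeff_ne_zero.2 hc0 this
    have hmW : TotalDegreeLE (k - N) m := by
      intro i j h
      rw [hm, coeff_C_mul_X_pow]
      split_ifs with hj
      · rw [coeff_C_mul, hc, leadingCoeff, hn, hf i n (by omega), mul_zero]
      · rfl
    have hqmW : TotalDegreeLE k (q * m) := by
      have := hq.mul hmW
      rwa [show N + (k - N) = k by omega] at this
    have hlead : (q * m).leadingCoeff = c := by
      rw [leadingCoeff_mul, hm, leadingCoeff_mul, leadingCoeff_C, leadingCoeff_X_pow, mul_one,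
        ← hu', ← mul_assoc, ← C_mul, mul_inv_cancel₀ hu1, C_1, one_mul]
    have hqm0 : q * m ≠ 0 := by
      intro h0
      rw [h0, leadingCoeff_zero] at hlead
      exact hc0 hlead.symm
    have hdeg : f.degree = (q * m).degree := by
      rw [degree_eq_natDegree hf0, degree_eq_natDegree hqm0, natDegree_mul (left_ne_zero_of_mul hqm0)
        (right_ne_zero_of_mul hqm0), hN, hm, natDegree_C_mul_X_pow _ _ (by simp [hu1, hc0]), hn]
      congr 1; omega
    have hlt' := degree_sub_lt_left hdeg hf0 (hc.symm.trans hlead.symm)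
    by_cases h0 : f - q * m = 0
    · exact ⟨m, 0, by rw [add_zero]; exact sub_eq_zero.1 h0, by simp,
        Or.inr ⟨k - N, by omega, hmW⟩⟩
    obtain ⟨g, r, hgr, hr, hg⟩ := ih (f - q * m).natDegree
      (hn ▸ natDegree_lt_natDegree h0 hlt') _ (hf.sub hqmW) rfl
    refine ⟨m + g, r, by linear_combination hgr, hr, Or.inr ⟨k - N, by omega, ?_⟩⟩
    rcases hg with rfl | ⟨l, hl, hg⟩
    · rwa [add_zero]
    · obtain rfl : l = k - N := by omega
      exact hmW.add hg

end Weights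

open Polynomial in
/-- Restriction of forms to the parametrized affine line. -/
def lineRestrict (L : List ℕ) : MvPolynomial (Fin 3) ℂ →ₐ[ℂ] ℂ[X] :=
  MvPolynomial.aeval ![(paramPair 1 X L).2, (paramPair 1 X L).1, 1]

open Polynomial in
/-- Dehomogenization with respect to `z`. -/
def dehomogenize : MvPolynomial (Fin 3) ℂ →ₐ[ℂ] ℂ[X][X] :=
  MvPolynomial.aeval ![X, C X, 1]

open Polynomial

variable {d : ℕ} {L : List ℕ}

lemma restrictLine_dehomogenize (L : List ℕ) (G : MvPolynomial (Fin 3) ℂ) :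
    restrictLine L (dehomogenize G) = lineRestrict L G := by
  have : (restrictLine L).comp dehomogenize.toRingHom = (lineRestrict L).toRingHom := by
    refine MvPolynomial.ringHom_ext (fun r => ?_) (fun i => ?_)
    · simp [restrictLine, dehomogenize, lineRestrict]
    · fin_cases i <;> simp [restrictLine, dehomogenize, lineRestrict]
  exact RingHom.congr_fun this G

lemma degree_eq_of_mem_support {G : MvPolynomial (Fin 3) ℂ} {k : ℕ} (hG : G.IsHomogeneous k)
    {m : Fin 3 →₀ ℕ} (hm : m ∈ G.support) : m 0 + m 1 + m 2 = k := by
  have := hG (MvPolynomial.mem_support_iff.1 hm)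
  rw [Finsupp.weight_apply, Finsupp.sum_fintype _ _ (by simp), Fin.sum_univ_three] at this
  simpa using this

lemma totalDegreeLE_dehomogenize {G : MvPolynomial (Fin 3) ℂ} {k : ℕ} (hG : G.IsHomogeneous k) :
    TotalDegreeLE k (dehomogenize G) := by
  rw [G.as_sum, map_sum]
  refine TotalDegreeLE.sum _ fun m hm => ?_
  have hk := degree_eq_of_mem_support hG hm
  have : dehomogenize (MvPolynomial.monomial m (G.coeff m)) =
      C (C (G.coeff m) * X ^ m 1) * X ^ m 0 := by
    rw [dehomogenize, MvPolynomial.aeval_monomial, Finsupp.prod_fintype _ _ (by simp),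
      Fin.prod_univ_three]
    have : algebraMap ℂ ℂ[X][X] (G.coeff m) = C (C (G.coeff m)) := rfl
    rw [this]
    simp
    ring
  rw [this]
  intro i j h
  rw [coeff_C_mul_X_pow]
  split_ifs with hj
  · rw [coeff_C_mul_X_pow, if_neg (by omega)]
  · rfl

lemma tail_prod_lt_of_one_lt (hL : ∀ k ∈ L, 2 ≤ k) (h : 1 < L.prod) : L.tail.prod < L.prod := by
  cases L with
  | nil => simp at h
  | cons n L =>
    have hn : 2 ≤ n := hL n (by simp)
    have hpos : 0 < L.prod := prod_pos_of_two_le fun k hk => hL k (by simp [hk])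
    rw [List.prod_cons, List.tail_cons]
    nlinarith

lemma ne_nil_of_one_lt (h : 1 < L.prod) : L ≠ [] := by rintro rfl; simp at h

/-- The degree and the leading coefficient of a form restricted to the line. -/
lemma lineRestrict_degree (hL : ∀ k ∈ L, 2 ≤ k) (h1 : 1 < L.prod) {G : MvPolynomial (Fin 3) ℂ}
    {k : ℕ} (hG : G.IsHomogeneous k) :
    (lineRestrict L G).natDegree ≤ k * L.prod ∧
      (lineRestrict L G).coeff (k * L.prod) = MvPolynomial.eval cuspVec G := by
  obtain ⟨⟨m0, n0⟩, h2⟩ := paramPair_monic L hL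
  obtain ⟨m1, n1⟩ := h2 (ne_nil_of_one_lt h1)
  have htl := tail_prod_lt_of_one_lt hL h1
  set p0 := (paramPair (1 : ℂ[X]) X L).1
  set p1 := (paramPair (1 : ℂ[X]) X L).2
  have hmon : ∀ m ∈ G.support, (p1 ^ m 0 * p0 ^ m 1).Monic ∧
      (p1 ^ m 0 * p0 ^ m 1).natDegree = m 0 * L.tail.prod + m 1 * L.prod := by
    intro m _
    refine ⟨(m1.pow _).mul (m0.pow _), ?_⟩
    rw [(m1.pow _).natDegree_mul (m0.pow _), m1.natDegree_pow, m0.natDegree_pow, n0, n1]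
  have hbound : ∀ m ∈ G.support, m 0 * L.tail.prod + m 1 * L.prod ≤ k * L.prod := by
    intro m hm
    rw [← degree_eq_of_mem_support hG hm]
    have := Nat.mul_le_mul (le_refl (m 0)) htl.le
    nlinarith [Nat.zero_le (m 2 * L.prod)]
  have hsum : lineRestrict L G = ∑ m ∈ G.support, C (G.coeff m) * (p1 ^ m 0 * p0 ^ m 1) := by
    conv_lhs => rw [G.as_sum, map_sum]
    refine Finset.sum_congr rfl fun m hm => ?_
    rw [lineRestrict, MvPolynomial.aeval_monomial, Finsupp.prod_fintype _ _ (by simp),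
      Fin.prod_univ_three]
    simp [p0, p1]
  rw [hsum]
  constructor
  · refine natDegree_sum_le_of_forall_le _ _ fun m hm => ?_
    exact (natDegree_C_mul_le _ _).trans ((hmon m hm).2.le.trans (hbound m hm))
  · rw [finsetSum_coeff, MvPolynomial.eval_eq']
    refine Finset.sum_congr rfl fun m hm => ?_
    have hk := degree_eq_of_mem_support hG hm
    rw [coeff_C_mul, Fin.prod_univ_three]
    congr 1
    simp only [cuspVec, Matrix.cons_val_zero, Matrix.cons_val_one, Matrix.cons_val, one_pow, mul_one]
    -- As deg p_1 < deg p_0, only the monomial y^k attains degree k·d on the line, and its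
    -- coefficient is the value of the form at the cusp.
    by_cases h0 : m 0 = 0 ∧ m 2 = 0
    · rw [h0.1, h0.2]
      have h3 : k * L.prod = (p1 ^ m 0 * p0 ^ m 1).natDegree := by
        rw [(hmon m hm).2, h0.1, ← hk, h0.1, h0.2]; ring
      rw [← h0.1, h3, (hmon m hm).1.coeff_natDegree, h0.1]; simp
    · have h3 : (p1 ^ m 0 * p0 ^ m 1).natDegree < k * L.prod := by
        rw [(hmon m hm).2, ← hk]
        have e1 : (m 0 + m 1 + m 2) * L.prod = m 0 * L.prod + m 1 * L.prod + m 2 * L.prod := by ring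
        rw [e1]
        by_cases h00 : m 0 = 0
        · have h02 : 0 < m 2 := Nat.pos_of_ne_zero fun h => h0 ⟨h00, h⟩
          have := Nat.mul_pos h02 (show 0 < L.prod by omega)
          rw [h00]; omega
        · have := Nat.mul_lt_mul_of_pos_left htl (Nat.pos_of_ne_zero h00)
          omega
      rw [coeff_eq_zero_of_natDegree_lt h3]
      by_cases h00 : m 0 = 0
      · have h02 : m 2 ≠ 0 := fun h => h0 ⟨h00, h⟩
        simp [h02]
      · simp [h00]

lemma exists_div_eqPair (M : List ℕ) (hM : ∀ k ∈ M, 2 ≤ k) {k : ℕ} (f : ℂ[X][X])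
    (hf : TotalDegreeLE k f) :
    ∃ g r : ℂ[X][X], f = (eqPair (X : ℂ[X][X]) (C X) 1 M).2 * g + r ∧ r.degree < M.prod ∧
      (g = 0 ∨ ∃ l, l + M.prod = k ∧ TotalDegreeLE l g) := by
  obtain ⟨-, h1, h2⟩ := eqPair_natDegree (X : ℂ[X]) 1 M hM
  rw [map_one] at h1 h2
  refine exists_div_of_totalDegreeLE h1 h2 ?_ f hf
  have h3 := totalDegreeLE_dehomogenize
    (eqPair_isHomogeneous (MvPolynomial.isHomogeneous_X ℂ (0 : Fin 3))
      (MvPolynomial.isHomogeneous_X ℂ 1) (MvPolynomial.isHomogeneous_X ℂ 2) M hM).2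
  have h4 := congrArg Prod.snd (map_eqPair dehomogenize.toRingHom (MvPolynomial.X 0)
    (MvPolynomial.X 1) (MvPolynomial.X 2) M)
  simp only [AlgHom.toRingHom_eq_coe, RingHom.coe_coe] at h4
  rw [← h4] at h3
  simpa [dehomogenize] using h3

lemma exists_totalDegreeLE (f : ℂ[X][X]) : ∃ k, TotalDegreeLE k f := by
  refine ⟨f.natDegree + f.support.sup fun j => (f.coeff j).natDegree, fun i j h => ?_⟩
  by_cases hj : j ∈ f.support
  · have h1 := le_natDegree_of_mem_supp j hj
    have h2 : (f.coeff j).natDegree ≤ f.support.sup fun j => (f.coeff j).natDegree :=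
      Finset.le_sup (f := fun j => (f.coeff j).natDegree) hj
    exact coeff_eq_zero_of_natDegree_lt (by omega)
  · rw [notMem_support_iff.1 hj, coeff_zero]

/-- A nonzero polynomial whose degree in `x` is less than that of `q_{i+1}` does not vanish on the
line, and the degree of its restriction is divisible by the degree of `p_i`. -/
lemma dvd_natDegree_restrictLine (M L : List ℕ) (hM : ∀ k ∈ M, 2 ≤ k) (hL : ∀ k ∈ L, 2 ≤ k)
    {f : ℂ[X][X]} (hf : f ≠ 0) (hdeg : f.degree < M.prod) :
    restrictLine (M.reverseAux L) f ≠ 0 ∧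
      L.prod ∣ (restrictLine (M.reverseAux L) f).natDegree := by
  induction M generalizing L f with
  | nil =>
    obtain ⟨⟨hm, hn⟩, -⟩ := paramPair_monic L hL
    rw [List.prod_nil, Nat.cast_one, Nat.WithBot.lt_one_iff_le_zero] at hdeg
    rw [eq_C_of_degree_le_zero hdeg] at hf ⊢
    have hpos := prod_pos_of_two_le hL
    have h1 : restrictLine ([].reverseAux L) (C (f.coeff 0)) =
        (f.coeff 0).comp (paramPair 1 X L).1 := by
      simp [restrictLine, List.reverseAux, comp]
    rw [h1]
    refine ⟨fun h0 => ?_, ?_⟩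
    · rw [comp_eq_zero_iff] at h0
      rcases h0 with h0 | ⟨-, h0⟩
      · exact hf (by rw [h0, C_0])
      · have := congrArg natDegree h0
        rw [hn, natDegree_C] at this
        omega
    · rw [natDegree_comp, hn]
      exact Dvd.intro_left _ rfl
  | cons n M ih =>
    have hn := hM n (by simp)
    have hM' : ∀ k ∈ M, 2 ≤ k := fun k hk => hM k (by simp [hk])
    have hnL : ∀ k ∈ n :: L, 2 ≤ k := by simpa [hn] using hL
    have hpos := prod_pos_of_two_le hL
    simp only [List.reverseAux]
    set ρ := restrictLine (M.reverseAux (n :: L)) with hρ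
    set Q := (eqPair (X : ℂ[X][X]) (C X) 1 M).2 with hQ
    have hρQ : ρ Q = (paramPair 1 X L).1 := congrArg Prod.snd (restrictLine_eqPair M (n :: L))
    obtain ⟨⟨hm, hdm⟩, -⟩ := paramPair_monic L hL
    obtain ⟨-, hQn, hQu⟩ := eqPair_natDegree (X : ℂ[X]) 1 M hM'
    rw [map_one, ← hQ] at hQn hQu
    have hQ0 : Q ≠ 0 := by rintro h; rw [h] at hQu; simp at hQu
    -- Q-adic expansion with fewer than α digits. A nonzero digit restricts to degree divisible by
    -- n·L.prod and Q to degree L.prod, so the j-th term has degree congruent to j·L.prod modulo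
    -- n·L.prod. Since j < n these degrees differ and nothing cancels.
    have key : ∀ α ≤ n, ∀ f : ℂ[X][X], f ≠ 0 → f.degree < (α * M.prod : ℕ) →
        ρ f ≠ 0 ∧ ∃ β < α, ∃ c, (ρ f).natDegree = (c * n + β) * L.prod := by
      intro α
      induction α with
      | zero =>
        intro _ f hf hdeg
        rw [degree_eq_natDegree hf] at hdeg
        simp at hdeg
      | succ α ihα =>
        intro hα f hf hdeg
        obtain ⟨k, hk⟩ := exists_totalDegreeLE f
        obtain ⟨g, r, hfgr, hr, -⟩ := exists_div_eqPair M hM' f hk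
        rw [← hQ] at hfgr
        have hr' : r ≠ 0 → ρ r ≠ 0 ∧ ∃ c, (ρ r).natDegree = (c * n) * L.prod := by
          intro hr0
          obtain ⟨h1, c, h2⟩ := ih (n :: L) hM' hnL hr0 hr
          exact ⟨h1, c, by rw [h2, List.prod_cons]; ring⟩
        by_cases hg0 : g = 0
        · rw [hg0, mul_zero, zero_add] at hfgr
          subst hfgr
          obtain ⟨h1, c, h2⟩ := hr' hf
          exact ⟨h1, 0, by omega, c, by rw [h2, add_zero]⟩
        have hQg : (Q * g).degree = ((M.prod + g.natDegree : ℕ) : WithBot ℕ) := by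
          rw [degree_mul, degree_eq_natDegree hQ0, degree_eq_natDegree hg0, hQn]; rfl
        have hfdeg : f.degree = ((M.prod + g.natDegree : ℕ) : WithBot ℕ) := by
          rw [hfgr, degree_add_eq_left_of_degree_lt, hQg]
          rw [hQg]
          exact lt_of_lt_of_le hr (by exact_mod_cast Nat.le_add_right _ _)
        have hgdeg : g.degree < (α * M.prod : ℕ) := by
          rw [hfdeg, Nat.cast_lt, Nat.succ_mul] at hdeg
          rw [degree_eq_natDegree hg0, Nat.cast_lt]
          omega
        obtain ⟨hg1, β, hβ, c, hc⟩ := ihα (by omega) g hg0 hgdeg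
        have hQgρ : ρ (Q * g) ≠ 0 := by
          rw [map_mul, hρQ]; exact mul_ne_zero hm.ne_zero hg1
        have hQgdeg : (ρ (Q * g)).natDegree = (c * n + (β + 1)) * L.prod := by
          rw [map_mul, hρQ, natDegree_mul hm.ne_zero hg1, hdm, hc]; ring
        by_cases hr0 : r = 0
        · rw [hr0, add_zero] at hfgr
          rw [hfgr]
          exact ⟨hQgρ, β + 1, by omega, c, hQgdeg⟩
        obtain ⟨hr1, c', hc'⟩ := hr' hr0
        have hne : (ρ (Q * g)).natDegree ≠ (ρ r).natDegree := by
          rw [hQgdeg, hc']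
          intro h
          have h3 := Nat.eq_of_mul_eq_mul_right hpos h
          have h4 := congrArg (· % n) h3
          simp only [Nat.mul_mod_left, Nat.mul_add_mod_self_right] at h4
          rw [Nat.mod_eq_of_lt (by omega)] at h4
          omega
        rw [hfgr, map_add]
        rcases lt_or_gt_of_ne hne with h | h
        · have h5 : (ρ (Q * g) + ρ r).natDegree = (ρ r).natDegree :=
            natDegree_add_eq_right_of_natDegree_lt h
          refine ⟨fun h0 => ?_, 0, by omega, c', by rw [h5, hc', add_zero]⟩
          rw [h0, natDegree_zero] at h5
          omega
        · have h5 : (ρ (Q * g) + ρ r).natDegree = (ρ (Q * g)).natDegree :=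
            natDegree_add_eq_left_of_natDegree_lt h
          refine ⟨fun h0 => ?_, β + 1, by omega, c, by rw [h5, hQgdeg]⟩
          rw [h0, natDegree_zero] at h5
          omega
    obtain ⟨h1, β, -, c, h2⟩ := key n le_rfl f hf (by rwa [List.prod_cons] at hdeg)
    exact ⟨h1, by rw [h2]; exact Dvd.intro_left _ rfl⟩

lemma natDegree_restrictLine_le (hL : ∀ k ∈ L, 2 ≤ k) (h1 : 1 < L.prod) {l : ℕ} {g : ℂ[X][X]}
    (hg : TotalDegreeLE l g) : (restrictLine L g).natDegree ≤ l * L.prod := by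
  obtain ⟨⟨m0, n0⟩, h2⟩ := paramPair_monic L hL
  obtain ⟨m1, n1⟩ := h2 (ne_nil_of_one_lt h1)
  rw [restrictLine, coe_eval₂RingHom, eval₂_eq_sum_range]
  refine natDegree_sum_le_of_forall_le _ _ fun j _ => ?_
  by_cases hc : g.coeff j = 0
  · simp [hc]
  have hle : (g.coeff j).natDegree + j ≤ l := by
    by_contra h
    exact leadingCoeff_ne_zero.2 hc (hg _ j (not_le.1 h))
  have hcomp : (eval₂RingHom C (paramPair 1 X L).1 (g.coeff j)).natDegree =
      (g.coeff j).natDegree * L.prod := by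
    rw [← n0, ← natDegree_comp]; rfl
  refine natDegree_mul_le.trans ?_
  rw [hcomp, m1.natDegree_pow, n1]
  calc (g.coeff j).natDegree * L.prod + j * L.tail.prod
      ≤ (g.coeff j).natDegree * L.prod + j * L.prod :=
        Nat.add_le_add_left (Nat.mul_le_mul_left j (tail_prod_le hL)) _
    _ = ((g.coeff j).natDegree + j) * L.prod := by ring
    _ ≤ l * L.prod := Nat.mul_le_mul_right _ hle

/-- The values at the cusp of the local ring of the curve. -/
def cuspValues (L : List ℕ) : Set ℕ :=
  {v | ∃ (k : ℕ) (G : MvPolynomial (Fin 3) ℂ), G.IsHomogeneous k ∧ lineRestrict L G ≠ 0 ∧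
    v + (lineRestrict L G).natDegree = k * L.prod}

lemma lineRestrict_eqPair (M L : List ℕ) :
    (lineRestrict (M.reverseAux L) (eqPair (MvPolynomial.X 0) (MvPolynomial.X 1)
      (MvPolynomial.X 2) M).1, lineRestrict (M.reverseAux L) (eqPair (MvPolynomial.X 0)
        (MvPolynomial.X 1) (MvPolynomial.X 2) M).2) = paramPair 1 X L := by
  have h := map_eqPair (lineRestrict (M.reverseAux L)).toRingHom (MvPolynomial.X 0)
    (MvPolynomial.X 1) (MvPolynomial.X 2) M
  simp only [AlgHom.toRingHom_eq_coe, RingHom.coe_coe] at h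
  rw [← h, ← eqPair_paramPair X M L]
  simp [lineRestrict]

/-- The value is that of the form q of degree M.prod, which restricts to a polynomial of degree
L.prod. -/
lemma mem_cuspValues (M : List ℕ) (n : ℕ) (L : List ℕ) (hM : ∀ k ∈ M, 2 ≤ k)
    (hL : ∀ k ∈ n :: L, 2 ≤ k) :
    M.prod * (M.reverseAux (n :: L)).prod - L.prod ∈ cuspValues (M.reverseAux (n :: L)) := by
  have h := congrArg Prod.snd (lineRestrict_eqPair M (n :: L))
  simp only at h
  obtain ⟨hm, hn⟩ := (paramPair_monic (n :: L) hL).2 (by simp)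
  refine ⟨M.prod, _, (eqPair_isHomogeneous (MvPolynomial.isHomogeneous_X ℂ (0 : Fin 3))
      (MvPolynomial.isHomogeneous_X ℂ 1) (MvPolynomial.isHomogeneous_X ℂ 2) M hM).2, ?_, ?_⟩
  · rw [h]; exact hm.ne_zero
  · rw [h, hn, List.tail_cons]
    apply Nat.sub_add_cancel
    have h1 := prod_pos_of_two_le hM
    have h2 : 2 ≤ n := hL n (by simp)
    rw [prod_reverseAux, List.prod_cons]
    calc L.prod = 1 * (1 * (1 * L.prod)) := by ring
      _ ≤ _ := Nat.mul_le_mul h1 (Nat.mul_le_mul h1 (Nat.mul_le_mul (by omega) le_rfl))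

/-- Divide by that q. The remainder restricts to degree divisible by (n :: L).prod, and the multiple
of q has degree at most (k - M.prod)d + L.prod. A smaller value means larger degree, hence the
degree of the remainder, which forces divisibility. -/
lemma le_of_mem_cuspValues (M : List ℕ) (n : ℕ) (L : List ℕ) (hM : ∀ k ∈ M, 2 ≤ k)
    (hL : ∀ k ∈ n :: L, 2 ≤ k) {v : ℕ} (hv : v ∈ cuspValues (M.reverseAux (n :: L)))
    (hdvd : ¬ (n :: L).prod ∣ v) : M.prod * (M.reverseAux (n :: L)).prod - L.prod ≤ v := by
  obtain ⟨k, G, hG, hG0, hval⟩ := hv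
  by_contra hlt
  rw [not_le] at hlt
  have hL' : ∀ k ∈ L, 2 ≤ k := fun k hk => hL k (by simp [hk])
  have hfull := reverseAux_two_le hM hL
  have hdd : (n :: L).prod ∣ (M.reverseAux (n :: L)).prod := by
    rw [prod_reverseAux]; exact Dvd.intro_left _ rfl
  have hone : 1 < (M.reverseAux (n :: L)).prod := by
    have h1 := prod_pos_of_two_le hM
    have h2 : 2 ≤ n := hL n (by simp)
    have h3 := prod_pos_of_two_le hL'
    rw [prod_reverseAux, List.prod_cons]
    calc 1 < 1 * (2 * 1) := by norm_num
      _ ≤ _ := Nat.mul_le_mul h1 (Nat.mul_le_mul h2 h3)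
  obtain ⟨g, r, hgr, hr, hg⟩ := exists_div_eqPair M hM _ (totalDegreeLE_dehomogenize hG)
  set ρ := restrictLine (M.reverseAux (n :: L)) with hρ
  have hρQ : ρ (eqPair (X : ℂ[X][X]) (C X) 1 M).2 = (paramPair 1 X L).1 :=
    congrArg Prod.snd (restrictLine_eqPair M (n :: L))
  obtain ⟨⟨hm, hdm⟩, -⟩ := paramPair_monic L hL'
  have hGρ : lineRestrict (M.reverseAux (n :: L)) G = (paramPair 1 X L).1 * ρ g + ρ r := by
    rw [← restrictLine_dehomogenize, ← hρ, hgr, map_add, map_mul, hρQ]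
  have hnd : ¬ (n :: L).prod ∣ (lineRestrict (M.reverseAux (n :: L)) G).natDegree := by
    intro h
    have h1 := (Nat.dvd_add_left h).1 (by rw [hval]; exact hdd.mul_left k)
    exact hdvd h1
  have hdegle : ((paramPair 1 X L).1 * ρ g).natDegree <
      (lineRestrict (M.reverseAux (n :: L)) G).natDegree := by
    rcases hg with rfl | ⟨l, hl, hg⟩
    · rw [map_zero, mul_zero, natDegree_zero]
      exact Nat.pos_of_ne_zero fun h => hnd (h ▸ dvd_zero _)
    · have hgdeg : (ρ g).natDegree ≤ l * (M.reverseAux (n :: L)).prod := by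
        exact natDegree_restrictLine_le hfull hone hg
      have h1 : ((paramPair 1 X L).1 * ρ g).natDegree ≤
          L.prod + l * (M.reverseAux (n :: L)).prod :=
        natDegree_mul_le.trans (by rw [hdm]; omega)
      have h2 : k * (M.reverseAux (n :: L)).prod = l * (M.reverseAux (n :: L)).prod +
        M.prod * (M.reverseAux (n :: L)).prod := by rw [← hl]; ring
      omega
  have hr0 : r ≠ 0 := by
    rintro rfl
    rw [map_zero, add_zero] at hGρ
    rw [hGρ] at hdegle
    exact lt_irrefl _ hdegle
  have h1 := (dvd_natDegree_restrictLine M (n :: L) hM hL hr0 hr).2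
  apply hnd
  have h2 : ρ r = lineRestrict (M.reverseAux (n :: L)) G - (paramPair 1 X L).1 * ρ g := by
    rw [hGρ]; ring
  rw [← hρ, h2, natDegree_sub_eq_left_of_natDegree_lt hdegle] at h1
  exact h1
end

/-! ### Injective regular maps and the values at the cusp. -/

noncomputable section

section Moebius

open Polynomial

/-- A rational function which is injective outside a finite set has degree at most one. -/
lemma natDegree_le_one_of_injective {a c : ℂ[X]} (hac : IsCoprime a c) (B : Set ℂ) (hB : B.Finite)
    (hinj : ∀ s t, s ∉ B → t ∉ B → c.eval s ≠ 0 → c.eval t ≠ 0 →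
      a.eval s * c.eval t = a.eval t * c.eval s → s = t) :
    a.natDegree ≤ 1 ∧ c.natDegree ≤ 1 := by
  by_contra hcon
  obtain ⟨n, hn⟩ : ∃ n, max a.natDegree c.natDegree = n := ⟨_, rfl⟩
  have hn2 : 2 ≤ n := by omega
  -- The numerator of the derivative of a/c. A generic value l avoids the values at zeros of W, at B
  -- and at infinity; then a - l·c has degree n ≥ 2, injectivity makes two roots coincide, and a
  -- double root is a zero of W.
  set W := derivative a * c - a * derivative c with hW
  have hder : ∀ p : ℂ[X], p ∣ derivative p → p.natDegree = 0 := by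
    intro p hp
    by_contra h0
    have h1 : derivative p ≠ 0 := fun h => h0 (derivative_eq_zero.1 h)
    have h2 := natDegree_le_of_dvd hp h1
    have h3 := natDegree_derivative_lt h0
    omega
  have hW0 : W ≠ 0 := by
    intro h0
    rw [hW, sub_eq_zero] at h0
    have h1 : a ∣ derivative a := hac.dvd_of_dvd_mul_right (h0 ▸ Dvd.intro _ rfl)
    have h2 : c ∣ derivative c := hac.symm.dvd_of_dvd_mul_left (h0 ▸ Dvd.intro_left _ rfl)
    have h3 := hder a h1
    have h4 := hder c h2
    omega
  set Z : Set ℂ := {t | W.IsRoot t} ∪ B with hZ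
  have hZfin : Z.Finite := (finite_setOfPred_isRoot hW0).union hB
  have hbad := (hZfin.image fun t => a.eval t / c.eval t).insert (a.coeff n / c.coeff n)
  obtain ⟨l, hl⟩ := hbad.infinite_compl.nonempty
  rw [Set.mem_compl_iff, Set.mem_insert_iff, not_or] at hl
  obtain ⟨hl1, hl2⟩ := hl
  set f := a - C l * c with hf
  have hfn : f.coeff n ≠ 0 := by
    rw [hf, coeff_sub, coeff_C_mul]
    intro h0
    by_cases hc : c.coeff n = 0
    · rw [hc, mul_zero, sub_zero] at h0
      rcases max_choice a.natDegree c.natDegree with h | h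
      · rw [hn] at h
        rw [h] at h0
        have : a ≠ 0 := by rintro rfl; simp at h; omega
        exact leadingCoeff_ne_zero.2 this h0
      · rw [hn] at h
        rw [h] at hc
        have : c ≠ 0 := by rintro rfl; simp at h; omega
        exact leadingCoeff_ne_zero.2 this hc
    · apply hl1
      rw [eq_div_iff hc]
      exact (sub_eq_zero.1 h0).symm
  have hfdeg : f.natDegree = n := by
    apply le_antisymm _ (le_natDegree_of_ne_zero hfn)
    refine (natDegree_sub_le _ _).trans (max_le ?_ ((natDegree_C_mul_le _ _).trans ?_)) <;> omega
  have hroot : ∀ t, f.eval t = 0 → c.eval t ≠ 0 ∧ t ∉ Z ∧ a.eval t = l * c.eval t := by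
    intro t ht
    rw [hf, eval_sub, eval_mul, eval_C, sub_eq_zero] at ht
    have hct : c.eval t ≠ 0 := by
      intro h0
      rw [h0, mul_zero] at ht
      obtain ⟨p, q, hpq⟩ := hac
      have := congrArg (eval t) hpq
      simp [h0, ht] at this
    refine ⟨hct, fun hZt => hl2 ⟨t, hZt, ?_⟩, ht⟩
    change a.eval t / c.eval t = l
    rw [ht, mul_div_cancel_right₀ _ hct]
  have hf0 : f ≠ 0 := by rintro h; rw [h] at hfdeg; simp at hfdeg; omega
  obtain ⟨t, ht⟩ := IsAlgClosed.exists_root f (by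
    rw [degree_eq_natDegree hf0, hfdeg]; exact_mod_cast (by omega : n ≠ 0))
  obtain ⟨h, hh⟩ := dvd_iff_isRoot.2 ht
  have hh0 : h ≠ 0 := by rintro rfl; rw [mul_zero] at hh; exact hf0 hh
  have hhdeg : h.natDegree + 1 = n := by
    rw [← hfdeg, hh, natDegree_mul (X_sub_C_ne_zero t) hh0, natDegree_X_sub_C, add_comm]
  obtain ⟨s, hs⟩ := IsAlgClosed.exists_root h (by
    rw [degree_eq_natDegree hh0]; exact_mod_cast (by omega : h.natDegree ≠ 0))
  have hfs : f.eval s = 0 := by rw [hh, eval_mul, hs.eq_zero, mul_zero]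
  obtain ⟨ht1, ht2, ht3⟩ := hroot t ht
  obtain ⟨hs1, hs2, hs3⟩ := hroot s hfs
  have hst : s = t := hinj s t (fun hb => hs2 (Or.inr hb)) (fun hb => ht2 (Or.inr hb)) hs1 ht1
    (by rw [ht3, hs3]; ring)
  subst hst
  apply ht2
  left
  have h1 : eval s (derivative f) = 0 := by
    rw [hh, derivative_mul, eval_add, eval_mul, eval_mul, hs.eq_zero, eval_sub, eval_X, eval_C]
    ring
  rw [hf, derivative_sub, derivative_C_mul, eval_sub, eval_C_mul, sub_eq_zero] at h1
  change eval s W = 0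
  rw [hW, eval_sub, eval_mul, eval_mul, h1, ht3]; ring

lemma paramPair_smul {R : Type*} [CommRing R] (c S T : R) (L : List ℕ) (hL : ∀ k ∈ L, 2 ≤ k) :
    paramPair (c * S) (c * T) L =
      (c ^ L.prod * (paramPair S T L).1, c ^ L.tail.prod * (paramPair S T L).2) := by
  induction L with
  | nil => simp [paramPair]
  | cons n L ih =>
    have hn := hL n (by simp)
    have hL' : ∀ k ∈ L, 2 ≤ k := fun k hk => hL k (by simp [hk])
    have e1 : L.tail.prod < n * L.prod := tail_prod_lt hL' hn
    have e2 : c ^ (n * L.prod) = c ^ (n * L.prod - L.tail.prod) * c ^ L.tail.prod := by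
      rw [← pow_add, Nat.sub_add_cancel e1.le]
    simp only [paramPair, ih hL', List.tail_cons, List.prod_cons, Prod.mk.injEq, and_true]
    rw [mul_pow, mul_pow, ← pow_mul, mul_comm L.prod n, e2]
    ring

lemma natDegree_paramPair_le {S T : ℂ[X]} (hS : S.natDegree ≤ 1) (hT : T.natDegree ≤ 1)
    (L : List ℕ) (hL : ∀ k ∈ L, 2 ≤ k) :
    (paramPair S T L).1.natDegree ≤ L.prod ∧ (paramPair S T L).2.natDegree ≤ L.tail.prod := by
  induction L with
  | nil => simpa [paramPair] using hT
  | cons n L ih =>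
    have hn := hL n (by simp)
    have hL' : ∀ k ∈ L, 2 ≤ k := fun k hk => hL k (by simp [hk])
    have e1 : L.tail.prod < n * L.prod := tail_prod_lt hL' hn
    obtain ⟨h1, h2⟩ := ih hL'
    refine ⟨?_, by simpa [paramPair] using h1⟩
    simp only [paramPair, List.prod_cons]
    refine natDegree_add_le_of_degree_le ?_ ?_
    · exact natDegree_pow_le_of_le n h1
    · refine natDegree_mul_le.trans ?_
      have h3 := natDegree_pow_le_of_le (n * L.prod - L.tail.prod) hS
      omega

end Moebius

open MvPolynomial

variable {d : ℕ} {L L' : List ℕ}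

lemma eval_lineRestrict (L : List ℕ) (t : ℂ) (G : MvPolynomial (Fin 3) ℂ) :
    (lineRestrict L G).eval t = eval (lineVec L t) G := by
  have : (Polynomial.evalRingHom t).comp (lineRestrict L).toRingHom = eval (lineVec L t) := by
    refine MvPolynomial.ringHom_ext (fun r => ?_) (fun i => ?_)
    · simp
    · have h := map_paramPair (Polynomial.evalRingHom t) 1 Polynomial.X L
      simp only [map_one, Polynomial.coe_evalRingHom, Polynomial.eval_X] at h
      fin_cases i <;> simp [lineRestrict, lineVec, h]
  exact RingHom.congr_fun this G

lemma evalForms_mk {k : ℕ} {A : Fin 3 → MvPolynomial (Fin 3) ℂ} (hA : ∀ i, (A i).IsHomogeneous k)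
    (v : Fin 3 → ℂ) (hv : v ≠ 0) : ∃ c : ℂ, c ≠ 0 ∧
      evalForms A (Projectivization.mk ℂ v hv) = c • fun i => eval v (A i) := by
  obtain ⟨c, hc, h⟩ := exists_rep_eq_smul v hv
  refine ⟨c ^ k, pow_ne_zero k hc, ?_⟩
  ext i
  rw [evalForms, h, eval_smul_of_isHomogeneous (hA i)]
  rfl

/-- The affine point of the curve with parameter `t`. -/
def linePoint (hL : ∀ k ∈ L, 2 ≤ k) (hd : L.prod = d) (t : ℂ) : (amsCurve d L hL hd).points :=
  ⟨Projectivization.mk ℂ (lineVec L t) (lineVec_ne_zero L t),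
    (mk_mem_points _ _ _).2 (eval_lineVec hL hd t).2⟩

lemma linePoint_injective (hL : ∀ k ∈ L, 2 ≤ k) (hd : L.prod = d) :
    Function.Injective (linePoint hL hd) := by
  intro s t h
  have h1 := congrArg Subtype.val h
  simp only [linePoint] at h1
  rw [Projectivization.mk_eq_mk_iff'] at h1
  obtain ⟨a, ha⟩ := h1
  have h2 : a = 1 := by simpa [lineVec] using congrFun ha 2
  rw [h2, one_smul] at ha
  rw [← (eval_lineVec hL hd s).1, ← (eval_lineVec hL hd t).1, ha]

/-- Regular injective maps do not enlarge the set of values at the cusp. -/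
lemma cuspValues_subset (hL : ∀ k ∈ L, 2 ≤ k) (hd : L.prod = d) (hL' : ∀ k ∈ L', 2 ≤ k)
    (hd' : L'.prod = d) (h2 : 2 < d)
    (φ : (amsCurve d L hL hd).points → (amsCurve d L' hL' hd').points)
    (hφ : Function.Injective φ)
    (hreg : PlaneCurve.IsRegularMap (amsCurve d L hL hd) (amsCurve d L' hL' hd') φ) :
    cuspValues L' ⊆ cuspValues L := by
  obtain ⟨k, A, hA, hAp, hAq⟩ := hreg ⟨cuspPoint, cuspPoint_mem hL hd⟩
  set Ap : Fin 3 → ℂ := fun i => eval cuspVec (A i) with hApdef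
  set P : Fin 3 → Polynomial ℂ := fun i => lineRestrict L (A i) with hP
  set Pt : ℂ → Fin 3 → ℂ := fun t i => (P i).eval t with hPt
  -- values of the map in terms of the forms
  have hmap : ∀ t, Pt t ≠ 0 → ∃ c : ℂ, c ≠ 0 ∧ (φ (linePoint hL hd t)).1.rep = c • Pt t := by
    intro t ht
    obtain ⟨c, hc, h⟩ := evalForms_mk hA (lineVec L t) (lineVec_ne_zero L t)
    have h' : evalForms A (linePoint hL hd t).1 = c • Pt t := by
      refine h.trans ?_
      congr 1
      ext i
      exact (eval_lineRestrict L t (A i)).symm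
    have hne : evalForms A (linePoint hL hd t).1 ≠ 0 := by
      rw [h']; exact smul_ne_zero hc ht
    obtain ⟨c', hc', h''⟩ := exists_rep_eq_smul _ hne
    exact ⟨c' * c, mul_ne_zero hc' hc, by rw [hAq _ hne, h'', h', smul_smul]⟩
  have hcusp : ∃ c : ℂ, c ≠ 0 ∧ (φ ⟨cuspPoint, cuspPoint_mem hL hd⟩).1.rep = c • Ap := by
    obtain ⟨c, hc, h⟩ := evalForms_mk hA cuspVec cuspVec_ne_zero
    obtain ⟨c', hc', h''⟩ := exists_rep_eq_smul _ hAp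
    exact ⟨c' * c, mul_ne_zero hc' hc, by
      rw [hAq _ hAp, h'', ← smul_smul]; congr 1⟩
  have hAp0 : Ap ≠ 0 := by
    obtain ⟨c, hc, h⟩ := evalForms_mk hA cuspVec cuspVec_ne_zero
    intro h0
    apply hAp
    exact h.trans (by rw [show (fun i => eval cuspVec (A i)) = Ap from rfl, h0, smul_zero])
  have hmemD : ∀ {q : P2} {c : ℂ} {v : Fin 3 → ℂ}, q ∈ (amsCurve d L' hL' hd').points →
      c ≠ 0 → q.rep = c • v → eval v (amsCurve d L' hL' hd').F = 0 := by
    intro q c v hq hc h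
    have h1 : eval q.rep (amsCurve d L' hL' hd').F = 0 := hq
    rw [h, eval_smul_of_isHomogeneous (amsCurve d L' hL' hd').isHomogeneous] at h1
    exact (mul_eq_zero.1 h1).resolve_left (pow_ne_zero d hc)
  have hdegP := fun i => lineRestrict_degree hL (by rw [hd]; omega) (hA i)
  simp only [hd] at hdegP
  -- proportional values come from the same parameter
  have hsame : ∀ s t : ℂ, Pt s ≠ 0 → Pt t ≠ 0 → (∃ c : ℂ, Pt s = c • Pt t) → s = t := by
    rintro s t hs ht ⟨c, hc⟩
    obtain ⟨c1, hc1, h1⟩ := hmap s hs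
    obtain ⟨c2, hc2, h2⟩ := hmap t ht
    apply linePoint_injective hL hd
    apply hφ
    apply Subtype.ext
    rw [← (φ (linePoint hL hd s)).1.mk_rep, ← (φ (linePoint hL hd t)).1.mk_rep,
      Projectivization.mk_eq_mk_iff']
    refine ⟨c1 * c * c2⁻¹, ?_⟩
    rw [h2, h1, hc, smul_smul, smul_smul, mul_assoc, inv_mul_cancel₀ hc2, mul_one]
  -- Otherwise all but finitely many points of the line would be mapped to the cusp.
  have hP2 : P 2 ≠ 0 := by
    intro h0
    obtain ⟨i, hi⟩ : ∃ i, Ap i ≠ 0 := by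
      by_contra hcon
      push Not at hcon
      exact hAp0 (funext hcon)
    have hPi : P i ≠ 0 := by
      intro h
      apply hi
      have := (hdegP i).2
      rw [show lineRestrict L (A i) = P i from rfl, h, Polynomial.coeff_zero] at this
      exact this.symm
    have hfin := Polynomial.finite_setOfPred_isRoot hPi
    have hvec : ∀ t, ¬ (P i).IsRoot t → Pt t ≠ 0 ∧ Pt t = Pt t 1 • cuspVec := by
      intro t ht
      have hne : Pt t ≠ 0 := fun h => ht (congrFun h i)
      have hz : Pt t 2 = 0 := by simp [hPt, h0]
      obtain ⟨c, hc, h⟩ := hmap t hne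
      have hx := eq_zero_of_eval_of_z_eq_zero hL' hd' (hmemD (φ (linePoint hL hd t)).2 hc h) hz
      refine ⟨hne, ?_⟩
      ext j; fin_cases j <;> simp [cuspVec, hx, hz]
    obtain ⟨s, hs⟩ := hfin.infinite_compl.nonempty
    obtain ⟨t, ht⟩ := (hfin.insert s).infinite_compl.nonempty
    rw [Set.mem_compl_iff, Set.mem_insert_iff, not_or] at ht
    obtain ⟨hs0, hs1⟩ := hvec s hs
    obtain ⟨ht0, ht1⟩ := hvec t ht.2
    apply ht.1
    symm
    refine hsame s t hs0 ht0 ⟨Pt s 1 * (Pt t 1)⁻¹, ?_⟩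
    have : Pt t 1 ≠ 0 := by
      intro h; rw [h, zero_smul] at ht1; exact ht0 ht1
    rw [ht1, smul_smul, mul_assoc, hs1]
    simp [cuspVec, this]
  set B : Set ℂ := {t | (P 2).IsRoot t} with hBdef
  have hBfin : B.Finite := Polynomial.finite_setOfPred_isRoot hP2
  have hPtB : ∀ t, t ∉ B → Pt t 2 ≠ 0 := fun t ht => ht
  have hPtB' : ∀ t, t ∉ B → Pt t ≠ 0 := fun t ht h => ht (congrFun h 2)
  -- the parameter of the image as a rational function
  set Q := (eqPair (X 0 : MvPolynomial (Fin 3) ℂ) (X 1) (X 2) L'.reverse).1 with hQ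
  set e := L'.reverse.tail.prod with he
  have hQhom : Q.IsHomogeneous e := (eqPair_isHomogeneous (isHomogeneous_X ℂ (0 : Fin 3))
    (isHomogeneous_X ℂ 1) (isHomogeneous_X ℂ 2) L'.reverse (reverse_two_le hL')).1
  have hcomp : ∀ (G : MvPolynomial (Fin 3) ℂ) (t : ℂ),
      (lineRestrict L (aeval A G)).eval t = eval (Pt t) G := by
    intro G t
    rw [eval_lineRestrict]
    have : (eval (lineVec L t)).comp (aeval A : MvPolynomial (Fin 3) ℂ →ₐ[ℂ] _).toRingHom =
        eval (Pt t) := by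
      refine MvPolynomial.ringHom_ext (fun r => ?_) (fun i => ?_)
      · simp
      · simp [hPt, hP, eval_lineRestrict]
    exact RingHom.congr_fun this G
  set num := lineRestrict L (aeval A Q) with hnum
  set den := P 2 ^ e with hden
  have hden0 : den ≠ 0 := pow_ne_zero e hP2
  obtain ⟨g, a, c, hnumg, hdeng, hac⟩ : ∃ g a c : Polynomial ℂ, num = g * a ∧ den = g * c ∧
      IsCoprime a c := by
    have hgcd : EuclideanDomain.gcd num den ≠ 0 := fun h =>
      hden0 (EuclideanDomain.gcd_eq_zero_iff.1 h).2
    obtain ⟨a, ha⟩ := EuclideanDomain.gcd_dvd_left num den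
    obtain ⟨c, hc⟩ := EuclideanDomain.gcd_dvd_right num den
    refine ⟨_, a, c, ha, hc, EuclideanDomain.gcdA num den, EuclideanDomain.gcdB num den, ?_⟩
    apply mul_left_cancel₀ hgcd
    have h := EuclideanDomain.gcd_eq_gcd_ab num den
    generalize EuclideanDomain.gcdA num den = x at h ⊢
    generalize EuclideanDomain.gcdB num den = y at h ⊢
    generalize EuclideanDomain.gcd num den = g at h ha hc ⊢
    rw [mul_one]
    conv_rhs => rw [h, ha, hc]
    ring
  have hg0 : g ≠ 0 := by rintro rfl; rw [zero_mul] at hdeng; exact hden0 hdeng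
  have hc0 : c ≠ 0 := by rintro rfl; rw [mul_zero] at hdeng; exact hden0 hdeng
  have hgc : ∀ t, t ∉ B → g.eval t ≠ 0 ∧ c.eval t ≠ 0 := by
    intro t ht
    have h1 : den.eval t ≠ 0 := by
      rw [hden, Polynomial.eval_pow]; exact pow_ne_zero e (hPtB t ht)
    rw [hdeng, Polynomial.eval_mul] at h1
    exact ⟨left_ne_zero_of_mul h1, right_ne_zero_of_mul h1⟩
  have hline : ∀ t, t ∉ B → Pt t = Pt t 2 • lineVec L' (a.eval t / c.eval t) := by
    intro t ht
    obtain ⟨c', hc', h⟩ := hmap t (hPtB' t ht)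
    have h1 := eq_lineVec_of_eval hL' hd' (hmemD (φ (linePoint hL hd t)).2 hc' h) (hPtB t ht)
    rw [← hQ, eval_smul_of_isHomogeneous hQhom, ← hcomp, ← hnum] at h1
    have h3 : (Pt t 2)⁻¹ ^ e * num.eval t = a.eval t / c.eval t := by
      have h4 : den.eval t = Pt t 2 ^ e := by rw [hden, Polynomial.eval_pow]
      rw [inv_pow, ← h4, hnumg, hdeng, Polynomial.eval_mul, Polynomial.eval_mul]
      obtain ⟨h5, h6⟩ := hgc t ht
      field_simp
    rwa [h3] at h1
  have hinj : ∀ s t, s ∉ B → t ∉ B → c.eval s ≠ 0 → c.eval t ≠ 0 →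
      a.eval s * c.eval t = a.eval t * c.eval s → s = t := by
    intro s t hs ht hcs hct heq
    refine hsame s t (hPtB' s hs) (hPtB' t ht) ⟨Pt s 2 * (Pt t 2)⁻¹, ?_⟩
    have h1 : a.eval s / c.eval s = a.eval t / c.eval t := by
      rw [div_eq_div_iff hcs hct, heq]
    rw [hline t ht, smul_smul]
    have h3 := hPtB t ht
    have h4 : (Pt t 2 • lineVec L' (Polynomial.eval t a / Polynomial.eval t c)) 2 = Pt t 2 := by
      simp [lineVec]
    rw [h4, mul_assoc, inv_mul_cancel₀ h3, mul_one, ← h1]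
    exact hline s hs
  obtain ⟨hdega, hdegc⟩ := natDegree_le_one_of_injective hac B hBfin hinj
  have hnotconst : ∀ b : ℂ, a ≠ Polynomial.C b * c := by
    intro b hab
    obtain ⟨s, hs⟩ := hBfin.infinite_compl.nonempty
    obtain ⟨t, ht⟩ := (hBfin.insert s).infinite_compl.nonempty
    rw [Set.mem_compl_iff, Set.mem_insert_iff, not_or] at ht
    refine ht.1 (hinj s t hs ht.2 (hgc s hs).2 (hgc t ht.2).2 ?_).symm
    rw [hab]; simp; ring
  obtain ⟨c₀, hc₀, hcusprep⟩ := hcusp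
  have hApF := hmemD (φ ⟨cuspPoint, cuspPoint_mem hL hd⟩).2 hc₀ hcusprep
  by_cases hAp2 : Ap 2 = 0
  · -- the cusp is mapped to the cusp
    have hApx : Ap 0 = 0 := eq_zero_of_eval_of_z_eq_zero hL' hd' hApF hAp2
    have hAp1 : Ap 1 ≠ 0 := by
      intro h; apply hAp0; ext i; fin_cases i <;> simp [h, hApx, hAp2]
    have hP1deg : (P 1).natDegree = k * d := by
      refine le_antisymm (hdegP 1).1 (Polynomial.le_natDegree_of_ne_zero ?_)
      rw [(hdegP 1).2]; exact hAp1
    have hP1 : P 1 ≠ 0 := by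
      intro h
      apply hAp1
      have := (hdegP 1).2
      rw [show lineRestrict L (A 1) = P 1 from rfl, h, Polynomial.coeff_zero] at this
      exact this.symm
    have hP2deg : (P 2).natDegree < k * d := by
      refine lt_of_le_of_ne (hdegP 2).1 fun h => hP2 ?_
      rw [← Polynomial.leadingCoeff_eq_zero, Polynomial.leadingCoeff, h]
      exact (hdegP 2).2.trans hAp2
    have hident : P 1 * c ^ d = P 2 * (paramPair c a L').1 := by
      refine Polynomial.eq_of_infinite_eval_eq _ _ (hBfin.infinite_compl.mono fun t ht => ?_)
      obtain ⟨-, hct⟩ := hgc t ht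
      have h1 : (P 1).eval t = (P 2).eval t * (paramPair 1 (a.eval t / c.eval t) L').1 :=
        congrFun (hline t ht) 1
      have h3 := congrArg Prod.fst (paramPair_smul (c.eval t) 1 (a.eval t / c.eval t) L' hL')
      rw [mul_one, mul_div_cancel₀ _ hct, hd'] at h3
      have h4 := congrArg Prod.fst (map_paramPair (Polynomial.evalRingHom t) c a L')
      simp only [Polynomial.coe_evalRingHom] at h3 h4
      simp only [Set.mem_ofPred_eq, Polynomial.eval_mul, Polynomial.eval_pow, ← h4, h3, h1]
      ring
    -- If c had degree 1, the left side of `hident` would have degree kd + d, while the right side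
    -- has degree less than that. So infinity goes to infinity and the parameter changes affinely.
    have hcdeg : c.natDegree = 0 := by
      have h1 := congrArg Polynomial.natDegree hident
      rw [Polynomial.natDegree_mul hP1 (pow_ne_zero d hc0), Polynomial.natDegree_pow, hP1deg] at h1
      have h3 := Polynomial.natDegree_mul_le (p := P 2) (q := (paramPair c a L').1)
      have h4 := (natDegree_paramPair_le hdegc hdega L' hL').1
      rw [hd'] at h4
      by_contra h0
      have h5 : c.natDegree = 1 := by omega
      rw [h5] at h1
      omega
    obtain ⟨γ, hγ⟩ := Polynomial.natDegree_eq_zero.1 hcdeg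
    have hγ0 : γ ≠ 0 := by rintro rfl; rw [Polynomial.C_0] at hγ; exact hc0 hγ.symm
    set r := Polynomial.C γ⁻¹ * a with hr
    have hreval : ∀ t, a.eval t / c.eval t = r.eval t := by
      intro t; rw [hr, ← hγ]; simp [div_eq_mul_inv, mul_comm]
    have hrdeg : r.natDegree = 1 := by
      have h1 : r.natDegree = a.natDegree := Polynomial.natDegree_C_mul (inv_ne_zero hγ0)
      have h3 : a.natDegree ≠ 0 := by
        intro h
        obtain ⟨α, hα⟩ := Polynomial.natDegree_eq_zero.1 h
        apply hnotconst (α * γ⁻¹)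
        rw [← hα, ← hγ, ← Polynomial.C_mul, mul_assoc, inv_mul_cancel₀ hγ0, mul_one]
      omega
    clear_value r
    have htrans : ∀ (l : ℕ) (G : MvPolynomial (Fin 3) ℂ), G.IsHomogeneous l →
        lineRestrict L (aeval A G) = P 2 ^ l * (lineRestrict L' G).comp r := by
      intro l G hG
      refine Polynomial.eq_of_infinite_eval_eq _ _ (hBfin.infinite_compl.mono fun t ht => ?_)
      rw [Set.mem_ofPred_eq, hcomp, hline t ht, eval_smul_of_isHomogeneous hG, hreval,
        Polynomial.eval_mul, Polynomial.eval_pow, Polynomial.eval_comp,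
        eval_lineRestrict L']
    -- Comparing degrees in P 1 = P 2 · (p_0 ∘ r). This is what makes the pullback of a form have
    -- the same value as the form.
    have hP2deg' : k * d = (P 2).natDegree + d := by
      have h1 := htrans 1 (X 1) (isHomogeneous_X ℂ 1)
      rw [aeval_X, pow_one] at h1
      obtain ⟨⟨hm, hn⟩, -⟩ := paramPair_monic L' hL'
      have h3 : lineRestrict L' (X 1) = (paramPair 1 Polynomial.X L').1 := by simp [lineRestrict]
      rw [h3] at h1
      have h4 : ((paramPair 1 Polynomial.X L').1.comp r).natDegree = d := by
        rw [Polynomial.natDegree_comp, hn, hd', hrdeg, mul_one]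
      have h5 : (paramPair 1 Polynomial.X L').1.comp r ≠ 0 := by
        intro h; rw [h, Polynomial.natDegree_zero] at h4; omega
      rw [← hP1deg, show P 1 = _ from h1, Polynomial.natDegree_mul hP2 h5, h4]
    rintro v ⟨l, G, hG, hG0, hv⟩
    have hcompne : (lineRestrict L' G).comp r ≠ 0 := by
      rw [Ne, Polynomial.comp_eq_zero_iff, not_or]
      refine ⟨hG0, fun h => ?_⟩
      have := congrArg Polynomial.natDegree h.2
      rw [hrdeg, Polynomial.natDegree_C] at this
      omega
    refine ⟨k * l, aeval A G, hG.aeval A hA, ?_, ?_⟩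
    · rw [htrans l G hG]
      exact mul_ne_zero (pow_ne_zero l hP2) hcompne
    · rw [htrans l G hG, Polynomial.natDegree_mul (pow_ne_zero l hP2) hcompne,
        Polynomial.natDegree_pow, Polynomial.natDegree_comp, hrdeg, mul_one, hd]
      rw [hd'] at hv
      have h1 : k * l * d = l * (k * d) := by ring
      rw [h1, hP2deg', mul_add]
      omega
  · -- the cusp cannot be mapped to a smooth point
    exfalso
    have h1 := eq_lineVec_of_eval hL' hd' hApF hAp2
    rw [← hQ, eval_smul_of_isHomogeneous hQhom] at h1
    set b := (Ap 2)⁻¹ ^ e * eval Ap Q with hb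
    have hP2deg : (P 2).natDegree = k * d := by
      refine le_antisymm (hdegP 2).1 (Polynomial.le_natDegree_of_ne_zero ?_)
      rw [(hdegP 2).2]; exact hAp2
    have hdendeg : den.natDegree = e * (k * d) := by
      rw [hden, Polynomial.natDegree_pow, hP2deg]
    -- The pullback of the local parameter q_r - b at the image of the cusp. It vanishes at the
    -- cusp, and since a and c have degree at most 1 its value is exactly 1, whereas values not
    -- divisible by d are at least d - L.prod ≥ 2 once L is written n :: L.
    set H := aeval A (Q - C b * X 2 ^ e) with hH
    have hHhom : H.IsHomogeneous (k * e) := by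
      refine IsHomogeneous.aeval (hQhom.sub ?_) A hA
      have := (isHomogeneous_C (Fin 3) b).mul (isHomogeneous_X_pow (R := ℂ) (2 : Fin 3) e)
      rwa [zero_add] at this
    have hHline : lineRestrict L H = g * (a - Polynomial.C b * c) := by
      have h3 : lineRestrict L H = num - Polynomial.C b * den := by
        rw [hH, map_sub, map_sub, map_mul, map_mul, map_pow, map_pow, aeval_X, aeval_C]
        congr 2
        exact (lineRestrict L).commutes b
      rw [h3, hnumg, hdeng]; ring
    have hH0 : lineRestrict L H ≠ 0 := by
      rw [hHline]
      exact mul_ne_zero hg0 (sub_ne_zero.2 (hnotconst b))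
    obtain ⟨hHdeg, hHcoeff⟩ := lineRestrict_degree hL (by rw [hd]; omega) hHhom
    have hHcusp : eval cuspVec H = 0 := by
      have h3 : eval cuspVec H = eval Ap (Q - C b * X 2 ^ e) := by
        have : (eval cuspVec).comp (aeval A : MvPolynomial (Fin 3) ℂ →ₐ[ℂ] _).toRingHom =
            eval Ap := by
          refine MvPolynomial.ringHom_ext (fun r => ?_) (fun i => ?_)
          · simp
          · simp [hApdef]
        exact RingHom.congr_fun this _
      rw [h3, map_sub, map_mul, map_pow, eval_C, eval_X, hb, inv_pow]
      field_simp
      ring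
    have hHlt : (lineRestrict L H).natDegree < den.natDegree := by
      rw [hd] at hHdeg hHcoeff
      rw [hdendeg]
      have h3 : k * e * d = e * (k * d) := by ring
      rw [h3] at hHdeg hHcoeff
      refine lt_of_le_of_ne hHdeg fun h => hH0 ?_
      rw [← Polynomial.leadingCoeff_eq_zero, Polynomial.leadingCoeff, h, hHcoeff, hHcusp]
    have hone : 1 ∈ cuspValues L := by
      refine ⟨k * e, H, hHhom, hH0, ?_⟩
      rw [hd, show k * e * d = e * (k * d) by ring, ← hdendeg]
      rw [hHline, hdeng, Polynomial.natDegree_mul hg0 (sub_ne_zero.2 (hnotconst b)),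
        Polynomial.natDegree_mul hg0 hc0] at hHlt ⊢
      omega
    cases L with
    | nil => simp at hd; omega
    | cons n L =>
      have hpos : 0 < L.prod := prod_pos_of_two_le fun k hk => hL k (by simp [hk])
      have hn : 2 ≤ n := hL n (by simp)
      have h3 := le_of_mem_cuspValues [] n L (by simp) hL hone (by
        rw [hd]; intro h; have := Nat.le_of_dvd one_pos h; omega)
      simp only [List.reverseAux, List.prod_nil, one_mul] at h3
      rw [List.prod_cons] at hd h3
      have h4 : 2 * L.prod ≤ n * L.prod := Nat.mul_le_mul hn le_rfl
      omega
end

/-! ### Distinguishing factorizations. -/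

noncomputable section

variable {d : ℕ} {L L' : List ℕ}

/-- Two different lists with the same product, all of whose entries are at least two, differ
first at some common position. -/
lemma exists_common_prefix (hL : ∀ k ∈ L, 2 ≤ k) (hL' : ∀ k ∈ L', 2 ≤ k) (hprod : L.prod = L'.prod)
    (hne : L ≠ L') :
    ∃ (M A A' : List ℕ) (a a' : ℕ), L = M ++ a :: A ∧ L' = M ++ a' :: A' ∧ a ≠ a' := by
  induction L generalizing L' with
  | nil =>
    cases L' with
    | nil => exact absurd rfl hne
    | cons b B =>
      have h1 : 0 < B.prod := prod_pos_of_two_le fun k hk => hL' k (by simp [hk])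
      have h2 := hL' b (by simp)
      have h3 : 2 * 1 ≤ b * B.prod := Nat.mul_le_mul h2 h1
      simp only [List.prod_nil, List.prod_cons] at hprod
      omega
  | cons a A ih =>
    cases L' with
    | nil =>
      have h1 : 0 < A.prod := prod_pos_of_two_le fun k hk => hL k (by simp [hk])
      have h2 := hL a (by simp)
      have h3 : 2 * 1 ≤ a * A.prod := Nat.mul_le_mul h2 h1
      simp only [List.prod_nil, List.prod_cons] at hprod
      omega
    | cons b B =>
      by_cases hab : a = b
      · subst hab
        have h2 := hL a (by simp)
        obtain ⟨M, A', B', a', b', h3, h4, h5⟩ := ih (L' := B) (fun k hk => hL k (by simp [hk]))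
          (fun k hk => hL' k (by simp [hk]))
          (Nat.eq_of_mul_eq_mul_left (by omega : 0 < a) (by simpa only [List.prod_cons] using hprod))
          (by simpa using hne)
        exact ⟨a :: M, A', B', a', b', by simp [h3], by simp [h4], h5⟩
      · exact ⟨[], A, B, a, b, rfl, rfl, hab⟩

/-- The value M.prod·d - A.prod of the first curve is not divisible by the common product of a :: A
and b :: B. On the second curve such values are at least M.prod·d - B.prod, which is larger because
a < b forces B.prod < A.prod. -/
lemma not_cuspValues_subset {M A B : List ℕ} {a b : ℕ} (hA : ∀ k ∈ M ++ a :: A, 2 ≤ k)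
    (hB : ∀ k ∈ M ++ b :: B, 2 ≤ k) (hprod : (M ++ a :: A).prod = (M ++ b :: B).prod)
    (hab : a < b) : ¬ cuspValues (M ++ a :: A) ⊆ cuspValues (M ++ b :: B) := by
  intro hsub
  have hM : ∀ k ∈ M.reverse, 2 ≤ k := fun k hk => hA k (by simp_all)
  have hA' : ∀ k ∈ a :: A, 2 ≤ k := fun k hk => hA k (List.mem_append_right _ hk)
  have hB' : ∀ k ∈ b :: B, 2 ≤ k := fun k hk => hB k (List.mem_append_right _ hk)
  have hMpos := prod_pos_of_two_le hM
  have hApos : 0 < A.prod := prod_pos_of_two_le fun k hk => hA' k (by simp [hk])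
  have hBpos : 0 < B.prod := prod_pos_of_two_le fun k hk => hB' k (by simp [hk])
  have ha : 2 ≤ a := hA' a (by simp)
  have h1 := mem_cuspValues M.reverse a A hM hA'
  have e1 : M.reverse.reverseAux (a :: A) = M ++ a :: A := by simp [List.reverseAux_eq]
  have e2 : M.reverse.reverseAux (b :: B) = M ++ b :: B := by simp [List.reverseAux_eq]
  rw [e1] at h1
  have h2 := hsub h1
  rw [← e2] at h2
  have e3 : (a :: A).prod = (b :: B).prod := by
    rw [List.prod_append, List.prod_append] at hprod
    rw [List.prod_reverse] at hMpos
    exact Nat.eq_of_mul_eq_mul_left hMpos hprod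
  have hdvd : (a :: A).prod ∣ M.reverse.prod * (M ++ a :: A).prod := by
    rw [List.prod_append]
    exact Dvd.intro_left _ (by rw [mul_assoc])
  have hlt : A.prod < (a :: A).prod := by
    rw [List.prod_cons]
    have : 2 * A.prod ≤ a * A.prod := Nat.mul_le_mul ha le_rfl
    omega
  have hpos : 0 < M.reverse.prod * (M ++ a :: A).prod :=
    Nat.mul_pos hMpos (prod_pos_of_two_le hA)
  have hle : (a :: A).prod ≤ M.reverse.prod * (M ++ a :: A).prod := Nat.le_of_dvd hpos hdvd
  have h3 := le_of_mem_cuspValues M.reverse b B hM hB' h2 (by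
    rw [← e3]
    intro h
    have h4 := (Nat.dvd_sub_iff_right (by omega) hdvd).1 h
    exact absurd (Nat.le_of_dvd hApos h4) (by omega))
  rw [e2, ← hprod] at h3
  have h5 : B.prod < A.prod := by
    rw [List.prod_cons, List.prod_cons] at e3
    by_contra hcon
    have : a * A.prod < b * B.prod :=
      (Nat.mul_lt_mul_of_pos_right hab hApos).trans_le (Nat.mul_le_mul le_rfl (by omega))
    omega
  omega

lemma eq_of_isomorphic (hL : ∀ k ∈ L, 2 ≤ k) (hd : L.prod = d) (hL' : ∀ k ∈ L', 2 ≤ k)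
    (hd' : L'.prod = d) (h2 : 2 < d)
    (h : (amsCurve d L hL hd).Isomorphic (amsCurve d L' hL' hd')) : L = L' := by
  obtain ⟨φ, h1, h3⟩ := h
  have s1 := cuspValues_subset hL hd hL' hd' h2 φ φ.injective h1
  have s2 := cuspValues_subset hL' hd' hL hd h2 φ.symm φ.symm.injective h3
  by_contra hne
  have hprod := hd.trans hd'.symm
  obtain ⟨M, A, A', a, a', rfl, rfl, hab⟩ := exists_common_prefix hL hL' hprod hne
  rcases hab.lt_or_gt with h | h
  · exact not_cuspValues_subset hL hL' hprod h s2
  · exact not_cuspValues_subset hL' hL hprod.symm h s1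

lemma eq_singleton_two_of_prod (hL : ∀ k ∈ L, 2 ≤ k) (h : L.prod = 2) : L = [2] := by
  cases L with
  | nil => simp at h
  | cons a A =>
    have ha := hL a (by simp)
    cases A with
    | nil => simpa using h
    | cons b B =>
      have hb := hL b (by simp)
      have hB : 0 < B.prod := prod_pos_of_two_le fun k hk => hL k (by simp [hk])
      have h1 : 2 * (2 * 1) ≤ a * (b * B.prod) := Nat.mul_le_mul ha (Nat.mul_le_mul hb hB)
      simp only [List.prod_cons] at h
      omega

lemma amsTail_injective (k k' : ℕ) : ∀ L L' : List ℕ, amsTail k L = amsTail k' L' → L = L'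
  | [], [], _ => rfl
  | [], _ :: _, h => by simp [amsTail] at h
  | _ :: _, [], h => by simp [amsTail] at h
  | m :: L, m' :: L', h => by
    simp only [amsTail, List.cons.injEq, Prod.mk.injEq] at h
    rw [h.1.1, amsTail_injective m m' L L' h.2]

lemma amsNewtonPairs_cons_of_two_lt {n : ℕ} (hn : 2 < n) (L : List ℕ) :
    amsNewtonPairs (n :: L) = (n - 1, n) :: amsTail n L := by
  have h : n ≠ 2 := by omega
  cases L <;> simp [amsNewtonPairs, amsTail, h]

/-- The entries of the first pair differ by 1 when n > 2, but (m, 4m - 1) never has this property.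
-/
lemma amsNewtonPairs_two_ne {n : ℕ} (hn : 2 < n) (L L' : List ℕ) (hL : ∀ k ∈ L, 2 ≤ k) :
    amsNewtonPairs (2 :: L) ≠ amsNewtonPairs (n :: L') := by
  rw [amsNewtonPairs_cons_of_two_lt hn]
  cases L with
  | nil => simp [amsNewtonPairs]
  | cons m L =>
    have hm := hL m (by simp)
    simp only [amsNewtonPairs, if_true, ne_eq, List.cons.injEq, Prod.mk.injEq]
    omega

lemma amsNewtonPairs_injective {d : ℕ} (hd : 1 < d) :
    Function.Injective (fun n : OrderedFactorization d => amsNewtonPairs n.1) := by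
  rintro ⟨L, hL, hLd⟩ ⟨L', hL', hLd'⟩ h
  simp only at h
  apply Subtype.ext
  change L = L'
  rcases L with _ | ⟨a, L⟩
  · simp at hLd; omega
  rcases L' with _ | ⟨b, L'⟩
  · simp at hLd'; omega
  have ha := hL a (by simp)
  have hb := hL' b (by simp)
  rcases ha.eq_or_lt with rfl | ha <;> rcases hb.eq_or_lt with rfl | hb
  · rcases L with _ | ⟨m, L⟩ <;> rcases L' with _ | ⟨m', L'⟩
    · rfl
    · simp [amsNewtonPairs] at h
    · simp [amsNewtonPairs] at h
    · simp only [amsNewtonPairs, if_true, List.cons.injEq, Prod.mk.injEq] at h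
      rw [h.1.1, amsTail_injective m m' L L' h.2]
  · exact absurd h (amsNewtonPairs_two_ne hb L L' fun k hk => hL k (by simp [hk]))
  · exact absurd h.symm (amsNewtonPairs_two_ne ha L' L fun k hk => hL' k (by simp [hk]))
  · rw [amsNewtonPairs_cons_of_two_lt ha, amsNewtonPairs_cons_of_two_lt hb] at h
    simp only [List.cons.injEq, Prod.mk.injEq] at h
    rw [h.1.2, amsTail_injective a b L L' h.2]

end

theorem theorem1p4 (d : ℕ) (hd : 1 < d) :
    Function.Injective (fun n : OrderedFactorization d => amsNewtonPairs n.1) ∧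
    ∃ C : OrderedFactorization d → PlaneCurve d,
      (∀ n, (C n).IsRational) ∧
      (d = 2 → ∀ n, (C n).IsSmooth) ∧
      (2 < d → ∀ n, ∃ p : P2, (C n).IsUnicuspidalAt p ∧ (C n).TangentLineMeetsOnlyAt p ∧
        (C n).HasNewtonPairsAt p (amsNewtonPairs n.1)) ∧
      Pairwise (fun m n => ¬ (C m).Isomorphic (C n)) := by
  refine ⟨amsNewtonPairs_injective hd, fun n => amsCurve d n.1 n.2.1 n.2.2,
    fun n => amsCurve_isRational n.2.1 n.2.2, fun h n => amsCurve_isSmooth n.2.1 n.2.2 h,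
    fun h n => ⟨cuspPoint, ⟨amsCurve_isSingularAt n.2.1 n.2.2 h, fun q hq =>
      eq_cuspPoint_of_z_eq_zero n.2.1 n.2.2 hq.1 (rep_z_eq_zero_of_isSingularAt n.2.1 n.2.2 hq),
      amsCurve_isLocallyIrreducibleAt n.2.1 n.2.2 h⟩, amsCurve_tangent n.2.1 n.2.2 h,
      amsCurve_hasNewtonPairs n.2.1 n.2.2 h⟩, fun m n hmn hiso => hmn (Subtype.ext ?_)⟩
  -- For d = 2 there is only one factorization, so the claim is vacuous.
  rcases (Nat.succ_le_of_lt hd).eq_or_lt with h | h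
  · rw [eq_singleton_two_of_prod m.2.1 (m.2.2.trans h.symm),
      eq_singleton_two_of_prod n.2.1 (n.2.2.trans h.symm)]
  · exact eq_of_isomorphic m.2.1 m.2.2 n.2.1 n.2.2 h hiso
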